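/- **Notation.** Radial profiles are functions of $r>0$, and $\mathfrak m=-2$. An $\mathfrak m$-equivariant function on $\mathbb R^2$ is one of the form $u(r)e^{i\mathfrak m\theta}$; function-space norms of a profile $u$ are those of this function on $\mathbb R^2$, so $\|u\|_{L^2}^2=2\pi\int_0^\infty|u|^2\,r\,dr$, and $\|u\|_{H^{1,1}_{\mathfrak m}}=\|u\|_{H^1_{\mathfrak m}}+\|ru\|_{L^2}$. For a profile $u$ put $$A_\theta[u](r)=-\tfrac12\int_0^r|u|^2r'\,dr',\qquad {\bf D}_u^{(\mathfrak m)}w=\partial_rw-\frac{\mathfrak m+A_\theta[u]}{r}w,\qquad \partial_-^{(\mathfrak m)}w=\partial_rw+\frac{\mathfrak m}{r}w .$$ For $k\in\mathbb N=\{0,1,2,\dots\}$ put $|f|_k=\max_{0\le j\le k}|(r\partial_r)^jf|$, and put $|f|_{-1}=\max\{|\partial_rf|,|f/r|\}$. Let $\chi$ be a fixed smooth radial cutoff with $\chi(r)=1$ for $r\le1$ and $\chi(r)=0$ for $r\ge2$. Complex powers of $4it$ are taken with the principal branch. Implicit constants may depend on $q,\nu,\chi$ (and on $k$ where indicated), but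 not on $t$, $r$, $s$. **Proposition (Properties of the radiation).** Let $q,\nu\in\mathbb C$ with $\operatorname{Re}\nu>0$ and $q\ne0$. Then there exist $\delta_z>0$ and $z(t,r)$, $\Psi_z(t,r)$, $t\in[-1,1]$, $r>0$, with $z(0,r)=qr^\nu\chi(r)$, such that $$i\partial_tz+\partial_{rr}z+\frac1r\partial_rz-\Big(\frac{\mathfrak m+A_\theta[z]}{r}\Big)^2z-\Big(\int_0^r(\mathfrak m+A_\theta[z])|z|^2\frac{dr'}{r'}\Big)z+|z|^2z=\Psi_z$$ with $\mathfrak m=-2$ holds for $t\in[-1,1]\setminus\{0\}$, $r>0$, and such that the following hold (all estimates are for $t\in[-1,1]\setminus\{0\}$). 1. (Initial data and smoothness) $\lim_{t\to0}\|z(t,r)-qr^\nu\chi(r)\|_{H^{1,1}_{\mathfrak m}}=0$. For every $t\neq0$, $z(t,r)e^{i\mathfrak m\theta}$ is a smooth function on $\mathbb R^2$ and $\Psi_z(t,\cdot)$ is $C^1$ on $(0,\infty)$. 2. (Self-similar zone) Let $p=\frac12\Gamma(\frac\nu2+2)$ and $z_1={\bf D}_z^{(\mathfrak m)}z$. For every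 $k\in\mathbb N$ and $0<r\le|t|^{1/2}$, $$|z|_k\lesssim_k|t|^{\frac12(\operatorname{Re}\nu-2)}r^2,\qquad |z-qp(4it)^{\frac{\nu-2}2}r^2|_k\lesssim_k|t|^{\frac12(\operatorname{Re}\nu-4)}r^4,$$ $$|z_1-4qp(4it)^{\frac{\nu-2}2}r|_k\lesssim_k|t|^{\frac12(\operatorname{Re}\nu-4)}r^3,\qquad |\partial_-^{(\mathfrak m)}z|_k\lesssim_k|t|^{\frac12(\operatorname{Re}\nu-4)}r^3 .$$ 3. (Outside the self-similar zone) For every $k\in\mathbb N$ and $r\ge|t|^{1/2}$, $$|z(t,r)|_k\lesssim_k{\bf 1}_{|t|^{1/2}\le r\le2}\big\{r^{\operatorname{Re}\nu}+|t|^{\operatorname{Re}\nu+1-k}\,r^{-\operatorname{Re}\nu-2+2k}\big\}.$$ 4. (Error) $$\|\Psi_z\|_{L^2}\lesssim|t|^{\frac12(\operatorname{Re}\nu-1)+\delta_z},\qquad \|r^{-s}|\Psi_z|_{-1}\|_{L^2}\lesssim|t|^{\frac12(\operatorname{Re}\nu-2)+\delta_z}\quad\text{for all }s\in[0,\delta_z].$$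 -/

import Mathlib

open Set Filter Topology MeasureTheory
open scoped ENNReal ContDiff

/-! Radial profiles are functions `u : ℝ → ℂ`, of which only the values at `r > 0` matter.
A spacetime function is `z : ℝ → ℝ → ℂ`, written `z t r`. The plane `ℝ²` is `ℂ`, with
`x₁ + i x₂ = r e^{iθ}`. -/

noncomputable section

namespace CSS

/-- The `m`-equivariant function `x = r e^{iθ} ↦ u(r) e^{imθ}` on the plane with radial profile `u`.
(At `x = 0` this is `0` when `m ≠ 0` and `u 0` when `m = 0`.) -/
def equivariant (m : ℤ) (u : ℝ → ℂ) (x : ℂ) : ℂ :=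
  u ‖x‖ * (x / (‖x‖ : ℂ)) ^ m

/-- `A_θ[u](r) = -½ ∫₀^r |u|² r' dr'`. -/
def Atheta (u : ℝ → ℂ) (r : ℝ) : ℝ :=
  -(1 / 2) * ∫ s in (0 : ℝ)..r, ‖u s‖ ^ 2 * s

/-- `∫₀^r (m + A_θ[u]) |u|² dr'/r'`, the potential of the phase-rotated equation that replaces
`A_t[u] = -∫_r^∞ (m + A_θ[u]) |u|² dr'/r'`. -/
def phaseRotatedAt (m : ℤ) (u : ℝ → ℂ) (r : ℝ) : ℝ :=
  ∫ s in (0 : ℝ)..r, ((m : ℝ) + Atheta u s) * ‖u s‖ ^ 2 / s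

/-- The terms of the `m`-equivariant phase-rotated self-dual Chern-Simons-Schrödinger equation
without time derivative, at the profile `u`:
`u_rr + u_r / r - ((m + A_θ[u]) / r)² u - (∫₀^r (m + A_θ[u]) |u|² dr'/r') u + |u|² u`. -/
def spatialPart (m : ℤ) (u : ℝ → ℂ) (r : ℝ) : ℂ :=
  deriv (deriv u) r + (1 / r : ℂ) * deriv u r
    - (((((m : ℝ) + Atheta u r) / r) ^ 2 : ℝ) : ℂ) * u r
    - (phaseRotatedAt m u r : ℂ) * u r
    + ((‖u r‖ ^ 2 : ℝ) : ℂ) * u r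

/-- The covariant Cauchy-Riemann operator `D_u^{(m)} w = ∂_r w - (m + A_θ[u]) w / r`. -/
def covCR (m : ℤ) (u w : ℝ → ℂ) (r : ℝ) : ℂ :=
  deriv w r - ((((m : ℝ) + Atheta u r) / r : ℝ) : ℂ) * w r

/-- The radial part `∂_-^{(m)} = ∂_r + m / r` of `∂₁ - i ∂₂` on `m`-equivariant functions. -/
def dMinus (m : ℤ) (u : ℝ → ℂ) (r : ℝ) : ℂ :=
  deriv u r + (m : ℂ) / (r : ℂ) * u r

/-- The operator `r ∂_r`. -/
def rdr (f : ℝ → ℂ) (r : ℝ) : ℂ := (r : ℂ) * deriv f r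

/-- `|f|_k = max {|f|, |r ∂_r f|, …, |(r ∂_r)^k f|}`. -/
def absPos (k : ℕ) (f : ℝ → ℂ) (r : ℝ) : ℝ :=
  (Finset.range (k + 1)).sup' Finset.nonempty_range_add_one (fun j => ‖(rdr^[j]) f r‖)

/-- `|f|_{-k} = max {|∂_r^k f|, |r⁻¹ ∂_r^{k-1} f|, …, |r^{-k} f|}`. -/
def absNeg (k : ℕ) (f : ℝ → ℂ) (r : ℝ) : ℝ :=
  (Finset.range (k + 1)).sup' Finset.nonempty_range_add_one
    (fun j => ‖iteratedDeriv (k - j) f r‖ / r ^ j)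

/-- The measure `2π r dr` on `(0, ∞)`, i.e. the image of Lebesgue measure on the plane
under `x ↦ |x|`. -/
def radialMeasure : Measure ℝ :=
  (volume.restrict (Ioi (0 : ℝ))).withDensity (fun r => ENNReal.ofReal (2 * Real.pi * r))

/-- `g₁`, `g₂` are the weak (distributional) partial derivatives of `φ` on the plane. -/
def IsWeakGradient (φ g₁ g₂ : ℂ → ℂ) : Prop :=
  LocallyIntegrable φ ∧ LocallyIntegrable g₁ ∧ LocallyIntegrable g₂ ∧
  ∀ ψ : ℂ → ℝ, ContDiff ℝ ∞ ψ → HasCompactSupport ψ →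
    (∫ x, ((fderiv ℝ ψ x 1 : ℝ) : ℂ) * φ x) = -∫ x, (ψ x : ℂ) * g₁ x ∧
    (∫ x, ((fderiv ℝ ψ x Complex.I : ℝ) : ℂ) * φ x) = -∫ x, (ψ x : ℂ) * g₂ x

/-- The norm `‖φ‖_{H^{1,1}} = ‖φ‖_{H¹} + ‖ |x| φ ‖_{L²}` of a function on the plane, where
`‖φ‖_{H¹} = ‖φ‖_{L²} + ‖∂₁φ‖_{L²} + ‖∂₂φ‖_{L²}`; it is `∞` unless `φ` is in `H^{1,1}`.
(Weak derivatives are unique almost everywhere, so the infimum is over at most one value.) -/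
def normH11 (φ : ℂ → ℂ) : ℝ≥0∞ :=
  ⨅ (g₁ : ℂ → ℂ) (g₂ : ℂ → ℂ) (_ : IsWeakGradient φ g₁ g₂),
    eLpNorm φ 2 volume + eLpNorm g₁ 2 volume + eLpNorm g₂ 2 volume
      + eLpNorm (fun x : ℂ => (‖x‖ : ℂ) * φ x) 2 volume

/-- `χ` is (the radial profile of) a smooth cutoff, `1` on the unit ball and `0` outside
the ball of radius `2`. -/
def IsCutoff (χ : ℝ → ℝ) : Prop :=
  ContDiff ℝ ∞ χ ∧ (∀ r, |r| ≤ 1 → χ r = 1) ∧ ∀ r, 2 ≤ |r| → χ r = 0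

/-- The asymptotic profile `z*(r) = q r^ν χ(r)`. -/
def profile (χ : ℝ → ℝ) (q ν : ℂ) (r : ℝ) : ℂ := q * (r : ℂ) ^ ν * (χ r : ℂ)

/-- The constant `p = ½ Γ(ν/2 + 2)`. -/
def pConst (ν : ℂ) : ℂ := 1 / 2 * Complex.Gamma (ν / 2 + 2)

/-- The coefficient `q p (4it)^{(ν-2)/2}` (principal branch) of the leading term. -/
def leadCoeff (q ν : ℂ) (t : ℝ) : ℂ :=
  q * pConst ν * (4 * Complex.I * (t : ℂ)) ^ ((ν - 2) / 2)

end CSS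

end

/-! Write L = ∂_rr + r⁻¹∂_r − 4r⁻² for the linear part of the equation (`lapTwo`). The data q r^ν
evolve under i∂_t + L into the self-similar solution q p (4it)^{(ν−2)/2} r² G(r²/4t), where G(ρ) =
M(a, 3, iρ) is Kummer's function with a = 1 − ν/2 (`lapTwo_linSol`). Since G is smooth with G(0) =
1, the behaviour in the self-similar zone can be read off directly. For large |ρ|, G is a series of
inverse powers plus an oscillating part (`exists_confluent`): Euler's integral is rotated into
decaying Laplace integrals when 0 < Re a ≤ 1, and a contiguous relation lowers a by one as often as
needed. Hence outside the self-similar zone the linear solution is Σ t^j c_j r^{ν−2j} up to a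
remainder; the oscillation in it has relative size (|t|/r²)^{Re ν+1} and loses a factor r²/|t| with
each derivative (`exists_far_linSol`). The constant p is the one that makes c_0 = q.

The cutoff χ and the nonlinearity create errors. Outside the self-similar zone these are compensated
by a polynomial in time V = Σ t^j W_j with W_0 = 0, where W_{j+1} is chosen so that the coefficient
of t^j in the equation vanishes (`corrStep`, `exists_correction`). The potentials are integrals from
r = 0, so their coefficients must be integrable there; this is why the number of steps is limited by
N < Re ν + 1. The radiation is z = χ·(linear solution) + η V, where η removes the region r <
|t|^{1/2}.

To control the nonlinearity, functions are described by `HasExpansion`: a size bound in the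
self-similar zone and an expansion in powers of t with relative error (|t|/r²)^κ outside. This class
is stable under products and radial integration (`HasExpansion.mul`, `HasExpansion.prim`). In the
self-similar zone the error is the nonlinearity alone (`Psi_near`). Outside (`Psi_far`) it consists
of terms of relative size (|t|/r²)^κ and of the commutator of χ with the remainder of the linear
solution, which lives in 1 ≤ r ≤ 2. After extraction of the power of |t| a power of r above −1 is
left, which is square integrable for r dr; `exists_expansionOrder` chooses N, κ and δ so that
everything fits. -/

noncomputable section

namespace CSS

/-! ### Symbol classes -/

/-- A region of pairs `(t, r)`, `r > 0`, with open slices at fixed `t`. -/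
structure Zone where
  mem : ℝ → ℝ → Prop
  isOpen_slice : ∀ t, IsOpen {r | mem t r}
  pos : ∀ {t r}, mem t r → 0 < r

/-- `|f| ≲ w` on the zone `U`. -/
def BddBy (U : Zone) (w : ℝ → ℝ → ℝ) (f : ℝ → ℝ → ℂ) : Prop :=
  ∃ C, 0 ≤ C ∧ ∀ t r, U.mem t r → ‖f t r‖ ≤ C * w t r

/-- `|(r ∂_r)^j f| ≲ w` on the zone `U` for all `j ≤ k`, uniformly in `t`. -/
def Sym (U : Zone) (w : ℝ → ℝ → ℝ) : ℕ → (ℝ → ℝ → ℂ) → Prop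
  | 0, f => BddBy U w f
  | k + 1, f => BddBy U w f ∧ (∀ t r, U.mem t r → DifferentiableAt ℝ (f t) r) ∧
      Sym U w k (fun t => rdr (f t))

section Sym

variable {U V : Zone} {w v : ℝ → ℝ → ℝ} {k j : ℕ} {f g : ℝ → ℝ → ℂ}

theorem Zone.mem_nhds (U : Zone) {t r : ℝ} (h : U.mem t r) : ∀ᶠ s in 𝓝 r, U.mem t s :=
  (U.isOpen_slice t).mem_nhds h

theorem Sym.bdd (h : Sym U w k f) : BddBy U w f := by
  cases k with
  | zero => exact h
  | succ k => exact h.1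

theorem Sym.diff (h : Sym U w (k + 1) f) {t r : ℝ} (m : U.mem t r) :
    DifferentiableAt ℝ (f t) r := h.2.1 t r m

theorem Sym.rdr (h : Sym U w (k + 1) f) : Sym U w k (fun t => rdr (f t)) := h.2.2

theorem rdr_congr {f g : ℝ → ℂ} {r : ℝ} (h : f =ᶠ[𝓝 r] g) : CSS.rdr f r = CSS.rdr g r := by
  simp only [CSS.rdr, h.deriv_eq]

theorem Zone.rdr_congr (h : ∀ t r, U.mem t r → f t r = g t r) {t r : ℝ} (m : U.mem t r) :
    CSS.rdr (f t) r = CSS.rdr (g t) r := by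
  apply CSS.rdr_congr
  filter_upwards [U.mem_nhds m] with s hs using h t s hs

theorem Sym.congr (hf : Sym U w k f) (h : ∀ t r, U.mem t r → f t r = g t r) : Sym U w k g := by
  induction k generalizing f g with
  | zero =>
    obtain ⟨C, hC, hb⟩ := hf
    exact ⟨C, hC, fun t r m => h t r m ▸ hb t r m⟩
  | succ k ih =>
    obtain ⟨⟨C, hC, hb⟩, hd, hr⟩ := hf
    refine ⟨⟨C, hC, fun t r m => h t r m ▸ hb t r m⟩, fun t r m => ?_,
      ih hr fun t r m => U.rdr_congr h m⟩
    refine (hd t r m).congr_of_eventuallyEq ?_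
    filter_upwards [U.mem_nhds m] with s hs using (h t s hs).symm

theorem Sym.mono_zone (hf : Sym U w k f) (h : ∀ t r, V.mem t r → U.mem t r) : Sym V w k f := by
  induction k generalizing f with
  | zero => exact hf.imp fun C hC => ⟨hC.1, fun t r m => hC.2 t r (h t r m)⟩
  | succ k ih =>
    exact ⟨hf.1.imp fun C hC => ⟨hC.1, fun t r m => hC.2 t r (h t r m)⟩,
      fun t r m => hf.diff (h t r m), ih hf.rdr⟩

theorem BddBy.mono (hf : BddBy U w f) {D : ℝ} (hD : 0 ≤ D)
    (h : ∀ t r, U.mem t r → w t r ≤ D * v t r) : BddBy U v f := by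
  obtain ⟨C, hC, hb⟩ := hf
  refine ⟨C * D, by positivity, fun t r m => (hb t r m).trans ?_⟩
  rw [mul_assoc]
  exact mul_le_mul_of_nonneg_left (h t r m) hC

theorem Sym.mono (hf : Sym U w k f) {D : ℝ} (hD : 0 ≤ D)
    (h : ∀ t r, U.mem t r → w t r ≤ D * v t r) : Sym U v k f := by
  induction k generalizing f with
  | zero => exact BddBy.mono hf hD h
  | succ k ih => exact ⟨hf.1.mono hD h, hf.2.1, ih hf.rdr⟩

theorem Sym.weight_congr (hf : Sym U w k f) (h : ∀ t r, U.mem t r → w t r = v t r) :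
    Sym U v k f :=
  hf.mono zero_le_one fun t r m => by rw [one_mul, h t r m]

theorem Sym.of_le (hf : Sym U w k f) (h : j ≤ k) : Sym U w j f := by
  induction j generalizing f k with
  | zero => exact hf.bdd
  | succ j ih =>
    obtain ⟨k, rfl⟩ : ∃ l, k = l + 1 := ⟨k - 1, by omega⟩
    exact ⟨hf.1, hf.2.1, ih hf.rdr (by omega)⟩

theorem Sym.iterate (hf : Sym U w k f) (h : j ≤ k) : BddBy U w (fun t => CSS.rdr^[j] (f t)) := by
  induction j generalizing f k with
  | zero => exact hf.bdd
  | succ j ih =>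
    obtain ⟨k, rfl⟩ : ∃ l, k = l + 1 := ⟨k - 1, by omega⟩
    exact ih hf.rdr (by omega)

/-- Only finitely many orders enter, so the sum of their constants serves all of them. -/
theorem Sym.absPos_le (hf : Sym U w k f) :
    ∃ C, 0 ≤ C ∧ ∀ t r, U.mem t r → absPos k (f t) r ≤ C * w t r := by
  choose! C hC hb using fun j (hj : j ≤ k) => hf.iterate hj
  refine ⟨∑ j ∈ Finset.range (k + 1), C j, Finset.sum_nonneg fun j hj =>
    hC j (by simpa [Nat.lt_succ_iff] using hj), fun t r m => ?_⟩
  refine Finset.sup'_le _ _ fun j hj => ?_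
  have hj' : j ≤ k := by simpa [Nat.lt_succ_iff] using hj
  refine (hb j hj' t r m).trans ?_
  rw [Finset.sum_mul]
  exact Finset.single_le_sum (f := fun j => C j * w t r)
    (fun i hi => (norm_nonneg _).trans (hb i (by simpa [Nat.lt_succ_iff] using hi) t r m)) hj

theorem rdr_add_of_diff {f g : ℝ → ℂ} {r : ℝ} (hf : DifferentiableAt ℝ f r)
    (hg : DifferentiableAt ℝ g r) :
    CSS.rdr (fun r => f r + g r) r = CSS.rdr f r + CSS.rdr g r := by
  simp only [CSS.rdr]
  rw [deriv_fun_add hf hg]; ring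

theorem rdr_mul_of_diff {f g : ℝ → ℂ} {r : ℝ} (hf : DifferentiableAt ℝ f r)
    (hg : DifferentiableAt ℝ g r) :
    CSS.rdr (fun r => f r * g r) r = CSS.rdr f r * g r + f r * CSS.rdr g r := by
  simp only [CSS.rdr]
  rw [deriv_fun_mul hf hg]; ring

theorem rdr_const_mul (c : ℂ) (f : ℝ → ℂ) (r : ℝ) :
    CSS.rdr (fun r => c * f r) r = c * CSS.rdr f r := by
  simp only [CSS.rdr]
  rw [deriv_const_mul_field]; ring

theorem BddBy.add_same (hf : BddBy U w f) (hg : BddBy U w g) :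
    BddBy U w (fun t r => f t r + g t r) := by
  obtain ⟨C, hC, hb⟩ := hf
  obtain ⟨D, hD, hb'⟩ := hg
  refine ⟨C + D, by positivity, fun t r m => (norm_add_le _ _).trans ?_⟩
  rw [add_mul]
  exact add_le_add (hb t r m) (hb' t r m)

theorem BddBy.mul (hf : BddBy U w f) (hg : BddBy U v g) :
    BddBy U (fun t r => w t r * v t r) (fun t r => f t r * g t r) := by
  obtain ⟨C, hC, hb⟩ := hf
  obtain ⟨D, hD, hb'⟩ := hg
  refine ⟨C * D, by positivity, fun t r m => ?_⟩
  rw [norm_mul, mul_mul_mul_comm]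
  exact mul_le_mul (hb t r m) (hb' t r m) (norm_nonneg _) ((norm_nonneg _).trans (hb t r m))

theorem Sym.add (hf : Sym U w k f) (hg : Sym U w k g) : Sym U w k (fun t r => f t r + g t r) := by
  induction k generalizing f g with
  | zero => exact BddBy.add_same hf hg
  | succ k ih =>
    refine ⟨hf.bdd.add_same hg.bdd, fun t r m => (hf.diff m).add (hg.diff m), ?_⟩
    exact (ih hf.rdr hg.rdr).congr fun t r m => (rdr_add_of_diff (hf.diff m) (hg.diff m)).symm

theorem Sym.mul (hf : Sym U w k f) (hg : Sym U v k g) :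
    Sym U (fun t r => w t r * v t r) k (fun t r => f t r * g t r) := by
  induction k generalizing f g with
  | zero => exact BddBy.mul hf hg
  | succ k ih =>
    refine ⟨hf.bdd.mul hg.bdd, fun t r m => (hf.diff m).mul (hg.diff m), ?_⟩
    exact ((ih hf.rdr (hg.of_le k.le_succ)).add (ih (hf.of_le k.le_succ) hg.rdr)).congr
      fun t r m => (rdr_mul_of_diff (hf.diff m) (hg.diff m)).symm

theorem Sym.zero : Sym U w k (fun _ _ => 0) := by
  induction k with
  | zero => exact ⟨0, le_rfl, fun t r m => by simp⟩
  | succ k ih =>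
    refine ⟨⟨0, le_rfl, fun t r m => by simp⟩, fun t r m => differentiableAt_const _, ?_⟩
    exact ih.congr fun t r m => by simp [CSS.rdr]

theorem Sym.of_time {c : ℝ → ℂ} {b : ℝ → ℝ} (D : ℝ) (hD : 0 ≤ D)
    (h : ∀ t r, U.mem t r → ‖c t‖ ≤ D * b t) :
    Sym U (fun t _ => b t) k (fun t _ => c t) := by
  cases k with
  | zero => exact ⟨D, hD, h⟩
  | succ k =>
    refine ⟨⟨D, hD, h⟩, fun t r m => differentiableAt_const _, ?_⟩
    have h0 : Sym U (fun t _ => ‖c t‖) k (fun _ _ => 0) := Sym.zero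
    exact (h0.mono hD h).congr fun t r m => by simp [CSS.rdr]

theorem Sym.const (c : ℂ) : Sym U (fun _ _ => 1) k (fun _ _ => c) :=
  Sym.of_time ‖c‖ (norm_nonneg _) fun t r m => by simp

theorem Sym.const_mul (c : ℂ) (hf : Sym U w k f) : Sym U w k (fun t r => c * f t r) :=
  ((Sym.const c).mul hf).weight_congr fun t r m => by simp

theorem Sym.neg (hf : Sym U w k f) : Sym U w k (fun t r => -f t r) :=
  (hf.const_mul (-1)).congr fun t r m => by ring

theorem Sym.sub (hf : Sym U w k f) (hg : Sym U w k g) : Sym U w k (fun t r => f t r - g t r) :=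
  (hf.add hg.neg).congr fun t r m => by ring

theorem Sym.sum {ι : Type*} (S : Finset ι) {F : ι → ℝ → ℝ → ℂ}
    (h : ∀ i ∈ S, Sym U w k (F i)) :
    Sym U w k (fun t r => ∑ i ∈ S, F i t r) := by
  classical
  induction S using Finset.induction_on with
  | empty => simpa using Sym.zero
  | insert a S ha ih =>
    refine ((h a (Finset.mem_insert_self a S)).add
      (ih fun i hi => h i (Finset.mem_insert_of_mem hi))).congr fun t r m => ?_
    rw [Finset.sum_insert ha]

theorem rdr_conj (f : ℝ → ℂ) (r : ℝ) :
    CSS.rdr (fun r => (starRingEnd ℂ) (f r)) r = (starRingEnd ℂ) (CSS.rdr f r) := by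
  have : deriv (fun r => (starRingEnd ℂ) (f r)) r = (starRingEnd ℂ) (deriv f r) := deriv.star
  simp [CSS.rdr, this]

theorem Sym.conj (hf : Sym U w k f) : Sym U w k (fun t r => (starRingEnd ℂ) (f t r)) := by
  induction k generalizing f with
  | zero => exact hf.imp fun C hC => ⟨hC.1, fun t r m => by simpa using hC.2 t r m⟩
  | succ k ih =>
    refine ⟨hf.bdd.imp fun C hC => ⟨hC.1, fun t r m => by simpa using hC.2 t r m⟩,
      fun t r m => ?_, (ih hf.rdr).congr fun t r m => (rdr_conj _ _).symm⟩
    exact (hf.diff m).star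

theorem hasDerivAt_ofReal_cpow_of_pos (c : ℂ) {r : ℝ} (hr : 0 < r) :
    HasDerivAt (fun r : ℝ => (r : ℂ) ^ c) (c * (r : ℂ) ^ (c - 1)) r := by
  have := (hasDerivAt_id (r : ℂ)).cpow_const (c := c) (by simp [Complex.slitPlane, hr])
  simpa using this.comp_ofReal

theorem rdr_cpow (c : ℂ) {r : ℝ} (hr : 0 < r) :
    CSS.rdr (fun r : ℝ => (r : ℂ) ^ c) r = c * (r : ℂ) ^ c := by
  rw [CSS.rdr, (hasDerivAt_ofReal_cpow_of_pos c hr).deriv]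
  have h0 : (r : ℂ) ≠ 0 := by exact_mod_cast hr.ne'
  rw [Complex.cpow_sub _ _ h0, Complex.cpow_one]
  field_simp

theorem Sym.cpow (c : ℂ) : Sym U (fun _ r => r ^ c.re) k (fun _ r => (r : ℂ) ^ c) := by
  have hb : BddBy U (fun _ r => r ^ c.re) (fun _ r => (r : ℂ) ^ c) :=
    ⟨1, zero_le_one, fun t r m => by
      rw [Complex.norm_cpow_eq_rpow_re_of_pos (U.pos m), one_mul]⟩
  induction k with
  | zero => exact hb
  | succ k ih =>
    exact ⟨hb, fun t r m => (hasDerivAt_ofReal_cpow_of_pos c (U.pos m)).differentiableAt,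
      (ih.const_mul c).congr fun t r m => (rdr_cpow c (U.pos m)).symm⟩

theorem rdr_comp_pow {g : ℝ → ℂ} {c r : ℝ} {p : ℕ}
    (hg : DifferentiableAt ℝ g (c * r ^ p)) :
    CSS.rdr (fun r => g (c * r ^ p)) r = p * CSS.rdr g (c * r ^ p) := by
  have h1 : HasDerivAt (fun r : ℝ => c * r ^ p) (c * (p * r ^ (p - 1))) r :=
    (hasDerivAt_pow p r).const_mul c
  have := hg.hasDerivAt.scomp r h1
  simp only [CSS.rdr]
  rw [show (fun r => g (c * r ^ p)) = g ∘ (fun r => c * r ^ p) from rfl, this.deriv]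
  rw [Complex.real_smul]
  cases p with
  | zero => simp
  | succ p =>
    push_cast
    ring

/-- The operator r∂_r is invariant under dilations and only picks up the factor p under r ↦ r^p. The
constants therefore do not depend on c(t). -/
theorem Sym.comp {e c : ℝ → ℝ} {p : ℕ} (hf : Sym V w k f)
    (h : ∀ t r, U.mem t r → V.mem (e t) (c t * r ^ p)) :
    Sym U (fun t r => w (e t) (c t * r ^ p)) k (fun t r => f (e t) (c t * r ^ p)) := by
  induction k generalizing f with
  | zero => exact hf.imp fun C hC => ⟨hC.1, fun t r m => hC.2 _ _ (h t r m)⟩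
  | succ k ih =>
    refine ⟨hf.bdd.imp fun C hC => ⟨hC.1, fun t r m => hC.2 _ _ (h t r m)⟩, fun t r m => ?_, ?_⟩
    · exact (hf.diff (h t r m)).comp r
        (by fun_prop : DifferentiableAt ℝ (fun r : ℝ => c t * r ^ p) r)
    · exact ((ih hf.rdr).const_mul p).congr fun t r m =>
        (rdr_comp_pow (hf.diff (h t r m))).symm

theorem deriv_eq_rdr {f : ℝ → ℂ} {r : ℝ} (hr : 0 < r) : deriv f r = (r : ℂ)⁻¹ * CSS.rdr f r := by
  have h0 : (r : ℂ) ≠ 0 := by exact_mod_cast hr.ne'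
  simp [CSS.rdr, h0]

/-- Away from r = 0, ∂_r = r⁻¹(r∂_r), so control of all powers of r∂_r is smoothness. -/
theorem contDiffOn_of_sym {t : ℝ} (hf : ∀ k, Sym U w k f) :
    ContDiffOn ℝ ∞ (f t) {r | U.mem t r} := by
  rw [contDiffOn_infty]
  intro n
  induction n generalizing f with
  | zero =>
    rw [CharP.cast_eq_zero, contDiffOn_zero]
    exact fun r m => ((hf 1).diff m).continuousAt.continuousWithinAt
  | succ n ih =>
    push_cast
    rw [contDiffOn_succ_iff_deriv_of_isOpen (U.isOpen_slice t)]
    refine ⟨fun r m => ((hf 1).diff m).differentiableWithinAt, by simp, ?_⟩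
    have h1 : ContDiffOn ℝ n (fun r : ℝ => (r : ℂ)⁻¹ * CSS.rdr (f t) r) {r | U.mem t r} := by
      refine ContDiffOn.mul ?_ (ih fun k => (hf (k + 1)).rdr)
      exact Complex.ofRealCLM.contDiff.contDiffOn.inv fun r m => by
        have := U.pos m; simp [this.ne']
    exact h1.congr fun r m => deriv_eq_rdr (U.pos m)

theorem contDiff_rdr {f : ℝ → ℂ} (hf : ContDiff ℝ ∞ f) : ContDiff ℝ ∞ (CSS.rdr f) :=
  Complex.ofRealCLM.contDiff.mul (contDiff_infty_iff_deriv.1 hf).2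

theorem contDiffOn_rdr {f : ℝ → ℂ} {S : Set ℝ} (hS : IsOpen S) (hf : ContDiffOn ℝ ∞ f S) :
    ContDiffOn ℝ ∞ (CSS.rdr f) S :=
  Complex.ofRealCLM.contDiff.contDiffOn.mul ((contDiffOn_infty_iff_deriv_of_isOpen hS).1 hf).2

theorem contDiffOn_rdr_iterate {f : ℝ → ℂ} {S : Set ℝ} (hS : IsOpen S) (hf : ContDiffOn ℝ ∞ f S)
    (k : ℕ) : ContDiffOn ℝ ∞ (CSS.rdr^[k] f) S := by
  induction k generalizing f with
  | zero => exact hf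
  | succ k ih => exact ih (contDiffOn_rdr hS hf)

/-- A smooth function which vanishes on an open set of radii outside of the zone's image and is
bounded by the weight with all its derivatives on a compact set. -/
theorem Sym.of_contDiff {h : ℝ → ℂ} (hh : ContDiff ℝ ∞ h) {K : Set ℝ} (hK : IsCompact K)
    {Z : Set ℝ} (hZ : IsOpen Z) (h0 : ∀ r ∈ Z, h r = 0) {D : ℝ} (hD : 0 ≤ D)
    (hU : ∀ t r, U.mem t r → 0 ≤ w t r ∧ (r ∉ Z → r ∈ K ∧ 1 ≤ D * w t r)) :
    Sym U w k (fun _ => h) := by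
  have key : ∀ h : ℝ → ℂ, ContDiff ℝ ∞ h → (∀ r ∈ Z, h r = 0) → BddBy U w (fun _ => h) := by
    intro h hh h0
    obtain ⟨C, hC⟩ := hK.exists_bound_of_continuousOn hh.continuous.continuousOn
    refine ⟨max C 0 * D, by positivity, fun t r m => ?_⟩
    obtain ⟨hw, hr⟩ := hU t r m
    by_cases hrZ : r ∈ Z
    · simp only [h0 r hrZ, norm_zero]; positivity
    · obtain ⟨h1, h2⟩ := hr hrZ
      rw [mul_assoc]
      exact ((hC r h1).trans (le_max_left _ _)).trans
        (le_mul_of_one_le_right (le_max_right _ _) h2)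
  induction k generalizing h with
  | zero => exact key h hh h0
  | succ k ih =>
    refine ⟨key h hh h0, fun t r m => hh.differentiable (by simp) r,
      ih (contDiff_rdr hh) fun r hr => ?_⟩
    rw [CSS.rdr_congr (g := fun _ => 0) (by filter_upwards [hZ.mem_nhds hr] using h0)]
    simp [CSS.rdr]

end Sym

/-! ### Laplace integrals -/

/-- The half lines `s > 1/16`, labelled by a sign. -/
def zoneHalf : Zone where
  mem ε s := (ε = 1 ∨ ε = -1) ∧ 1 / 16 < s
  isOpen_slice ε := isOpen_const.inter isOpen_Ioi
  pos m := lt_trans (by norm_num) m.2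

theorem integrableOn_rpow_mul_exp {c b : ℝ} (hc : 0 < c) (hb : 0 < b) :
    IntegrableOn (fun τ : ℝ => τ ^ (c - 1) * Real.exp (-(b * τ))) (Ioi 0) := by
  have := integrableOn_rpow_mul_exp_neg_mul_rpow (p := 1) (s := c - 1) (b := b) (by linarith)
    one_pos hb
  simpa [neg_mul] using this

theorem norm_cexp_mul_le {h : ℝ → ℂ} {c C : ℝ}
    (hb : ∀ τ : ℝ, 0 < τ → ‖h τ‖ ≤ C * (τ ^ (c - 1) * Real.exp (τ / 32))) (s : ℝ) {τ : ℝ}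
    (hτ : 0 < τ) :
    ‖Complex.exp (-(s * τ)) * h τ‖ ≤ C * (τ ^ (c - 1) * Real.exp (-((s - 1 / 32) * τ))) := by
  rw [norm_mul, show ‖Complex.exp (-(s * τ))‖ = Real.exp (-(s * τ)) by rw [Complex.norm_exp]; simp]
  calc _ ≤ Real.exp (-(s * τ)) * (C * (τ ^ (c - 1) * Real.exp (τ / 32))) := by
        gcongr; exact hb τ hτ
    _ = _ := by
        rw [show -((s - 1 / 32) * τ) = -(s * τ) + τ / 32 by ring, Real.exp_add]; ring

theorem aestronglyMeasurable_cexp_mul {h : ℝ → ℂ} (hm : ContinuousOn h (Ioi 0)) (s : ℝ) :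
    AEStronglyMeasurable (fun τ : ℝ => Complex.exp (-(s * τ)) * h τ)
      (volume.restrict (Ioi 0)) :=
  ((by fun_prop : Continuous fun τ : ℝ => Complex.exp (-(s * τ))).continuousOn.mul
    hm).aestronglyMeasurable measurableSet_Ioi

theorem laplace_integrable {h : ℝ → ℝ → ℂ} {c : ℝ} (hc : 0 < c)
    (hm : ∀ ε, (ε = 1 ∨ ε = -1) → ContinuousOn (h ε) (Ioi 0)) {C : ℝ}
    (hb : ∀ ε, (ε = 1 ∨ ε = -1) → ∀ τ : ℝ, 0 < τ →
      ‖h ε τ‖ ≤ C * (τ ^ (c - 1) * Real.exp (τ / 32)))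
    {ε s : ℝ} (m : zoneHalf.mem ε s) :
    IntegrableOn (fun τ : ℝ => Complex.exp (-(s * τ)) * h ε τ) (Ioi 0) := by
  refine ((integrableOn_rpow_mul_exp hc (b := s - 1 / 32) (by linarith [m.2])).const_mul C).mono'
    (aestronglyMeasurable_cexp_mul (hm ε m.1) s) ?_
  filter_upwards [ae_restrict_mem measurableSet_Ioi] with τ hτ
    using norm_cexp_mul_le (hb ε m.1) s hτ

/-- After the growth e^{τ/32} is absorbed the decay rate is s − 1/32 ≥ s/2, because s > 1/16. What
is left is a Gamma integral comparable to s^{-c}. -/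
theorem laplace_bddBy {h : ℝ → ℝ → ℂ} {c : ℝ} (hc : 0 < c)
    {C : ℝ}
    (hb : ∀ ε, (ε = 1 ∨ ε = -1) → ∀ τ : ℝ, 0 < τ →
      ‖h ε τ‖ ≤ C * (τ ^ (c - 1) * Real.exp (τ / 32))) :
    BddBy zoneHalf (fun _ s => s ^ (-c))
      (fun ε s => ∫ τ in Ioi (0 : ℝ), Complex.exp (-(s * τ)) * h ε τ) := by
  have hC : 0 ≤ C := by
    have := (norm_nonneg _).trans (hb 1 (Or.inl rfl) 1 one_pos)
    have h2 : 0 < (1 : ℝ) ^ (c - 1) * Real.exp (1 / 32) := by positivity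
    exact nonneg_of_mul_nonneg_left this h2
  refine ⟨C * (2 ^ c * Real.Gamma c), by positivity, fun ε s m => ?_⟩
  obtain ⟨hε, hs⟩ := m
  have h1 : ‖∫ τ in Ioi (0 : ℝ), Complex.exp (-(s * τ)) * h ε τ‖ ≤
      ∫ τ in Ioi (0 : ℝ), C * (τ ^ (c - 1) * Real.exp (-((s - 1 / 32) * τ))) := by
    refine norm_integral_le_of_norm_le
      ((integrableOn_rpow_mul_exp hc (b := s - 1 / 32) (by linarith)).const_mul C) ?_
    filter_upwards [ae_restrict_mem measurableSet_Ioi] with τ hτ using norm_cexp_mul_le (hb ε hε) s hτ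
  rw [integral_const_mul, Real.integral_rpow_mul_exp_neg_mul_Ioi hc (by linarith)] at h1
  refine h1.trans ?_
  have h2 : (1 / (s - 1 / 32)) ^ c ≤ 2 ^ c * s ^ (-c) := by
    rw [Real.rpow_neg (by linarith), ← Real.inv_rpow (by linarith),
      ← Real.mul_rpow (by norm_num) (by rw [inv_nonneg]; linarith)]
    refine Real.rpow_le_rpow (by rw [one_div, inv_nonneg]; linarith) ?_ hc.le
    rw [div_le_iff₀ (by linarith)]
    have : s * s⁻¹ = 1 := mul_inv_cancel₀ (by linarith)
    have : 0 < s⁻¹ := by rw [inv_pos]; linarith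
    nlinarith
  have := Real.Gamma_pos_of_pos hc
  calc _ ≤ C * (2 ^ c * s ^ (-c) * Real.Gamma c) := by gcongr
    _ = _ := by ring

theorem laplace_hasDerivAt {h : ℝ → ℝ → ℂ} {c : ℝ} (hc : 0 < c)
    (hm : ∀ ε, (ε = 1 ∨ ε = -1) → ContinuousOn (h ε) (Ioi 0)) {C : ℝ}
    (hb : ∀ ε, (ε = 1 ∨ ε = -1) → ∀ τ : ℝ, 0 < τ →
      ‖h ε τ‖ ≤ C * (τ ^ (c - 1) * Real.exp (τ / 32)))
    {ε s : ℝ} (m : zoneHalf.mem ε s) : HasDerivAt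
      (fun s : ℝ => ∫ τ in Ioi (0 : ℝ), Complex.exp (-(s * τ)) * h ε τ)
      (∫ τ in Ioi (0 : ℝ), Complex.exp (-(s * τ)) * (-τ * h ε τ)) s := by
  have hC : 0 ≤ C := by
    have := (norm_nonneg _).trans (hb 1 (Or.inl rfl) 1 one_pos)
    have h2 : 0 < (1 : ℝ) ^ (c - 1) * Real.exp (1 / 32) := by positivity
    exact nonneg_of_mul_nonneg_left this h2
  obtain ⟨hε, hs⟩ := m
  refine (hasDerivAt_integral_of_dominated_loc_of_deriv_le
    (F' := fun s τ => Complex.exp (-(s * τ)) * (-τ * h ε τ))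
    -- The slowest rate on the half line s > 1/16 dominates the derivative uniformly.
    (bound := fun τ => C * (τ ^ (c + 1 - 1) * Real.exp (-((1 / 16 - 1 / 32) * τ))))
    (Ioi_mem_nhds hs) (Eventually.of_forall fun s => aestronglyMeasurable_cexp_mul (hm ε hε) s)
    (laplace_integrable hc hm hb ⟨hε, hs⟩) ?_ ?_ ?_
    ?_).2
  · refine ContinuousOn.aestronglyMeasurable ?_ measurableSet_Ioi
    refine (by fun_prop : Continuous fun τ : ℝ => Complex.exp (-(s * τ))).continuousOn.mul ?_
    exact (by fun_prop : Continuous fun τ : ℝ => -(τ : ℂ)).continuousOn.mul (hm ε hε)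
  · filter_upwards [ae_restrict_mem measurableSet_Ioi] with τ hτ x hx
    have hτ : 0 < τ := hτ
    have hx : 1 / 16 < x := hx
    calc ‖Complex.exp (-(x * τ)) * (-τ * h ε τ)‖
        = τ * ‖Complex.exp (-(x * τ)) * h ε τ‖ := by
          simp only [norm_mul, norm_neg, Complex.norm_real, Real.norm_eq_abs, abs_of_pos hτ]
          ring
      _ ≤ τ * (C * (τ ^ (c - 1) * Real.exp (-((x - 1 / 32) * τ)))) := by
          gcongr; exact norm_cexp_mul_le (hb ε hε) x hτ
      _ ≤ τ * (C * (τ ^ (c - 1) * Real.exp (-((1 / 16 - 1 / 32) * τ)))) := by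
          gcongr
      _ = _ := by
          rw [show c + 1 - 1 = c - 1 + 1 by ring, Real.rpow_add_one hτ.ne']; ring
  · exact (integrableOn_rpow_mul_exp (c := c + 1) (by linarith) (by norm_num)).const_mul C
  · refine Eventually.of_forall fun τ x hx => ?_
    have h1 : HasDerivAt (fun x : ℝ => -((x : ℂ) * τ)) (-(1 * (τ : ℂ))) x :=
      (((hasDerivAt_id (x : ℂ)).comp_ofReal).mul_const _).neg
    exact ((h1.cexp).mul_const (h ε τ)).congr_deriv (by ring)

/-- Differentiation in s brings down −τ, which turns c into c + 1, and the factor s in s∂_s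
compensates this; the same weight is reproduced at every order. -/
theorem Sym.laplace {h : ℝ → ℝ → ℂ} {c : ℝ} {k : ℕ} (hc : 0 < c)
    (hm : ∀ ε, (ε = 1 ∨ ε = -1) → ContinuousOn (h ε) (Ioi 0)) {C : ℝ}
    (hb : ∀ ε, (ε = 1 ∨ ε = -1) → ∀ τ : ℝ, 0 < τ →
      ‖h ε τ‖ ≤ C * (τ ^ (c - 1) * Real.exp (τ / 32))) :
    Sym zoneHalf (fun _ s => s ^ (-c)) k
      (fun ε s => ∫ τ in Ioi (0 : ℝ), Complex.exp (-(s * τ)) * h ε τ) := by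
  induction k generalizing h c C with
  | zero => exact laplace_bddBy hc hb
  | succ k ih =>
    refine ⟨laplace_bddBy hc hb,
      fun ε s m => (laplace_hasDerivAt hc hm hb m).differentiableAt, ?_⟩
    have hb' : ∀ ε, (ε = 1 ∨ ε = -1) → ∀ τ : ℝ, 0 < τ →
        ‖-τ * h ε τ‖ ≤ C * (τ ^ (c + 1 - 1) * Real.exp (τ / 32)) := by
      intro ε hε τ hτ
      rw [norm_mul, norm_neg, Complex.norm_real, Real.norm_eq_abs, abs_of_pos hτ,
        show c + 1 - 1 = c - 1 + 1 by ring, Real.rpow_add_one hτ.ne']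
      calc _ ≤ τ * (C * (τ ^ (c - 1) * Real.exp (τ / 32))) := by gcongr; exact hb ε hε τ hτ
        _ = _ := by ring
    have h1 := ih (c := c + 1) (by linarith) (fun ε hε =>
      (by fun_prop : Continuous fun τ : ℝ => -(τ : ℂ)).continuousOn.mul (hm ε hε)) hb'
    refine (((Sym.cpow (U := zoneHalf) (k := k) 1).mul h1).weight_congr fun ε s m => ?_).congr
      fun ε s m => ?_
    · rw [Complex.one_re, ← Real.rpow_add (zoneHalf.pos m)]; congr 1; ring
    · simp only [CSS.rdr, (laplace_hasDerivAt hc hm hb m).deriv, Complex.cpow_one]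
      rfl

/-! ### Powers along the imaginary direction -/

/-- The coefficients `w (w-1) ⋯ (w-j+1) / j!` of the binomial series. -/
def binomCoeff : ℂ → ℕ → ℂ
  | _, 0 => 1
  | w, j + 1 => w * binomCoeff (w - 1) j / (j + 1)

theorem one_add_I_mul_mem_slitPlane (σ τ : ℝ) : 1 + Complex.I * σ * τ ∈ Complex.slitPlane := by
  left; simp

theorem hasDerivAt_one_add_cpow (w : ℂ) (σ τ : ℝ) :
    HasDerivAt (fun τ : ℝ => (1 + Complex.I * σ * τ) ^ w)
      (Complex.I * σ * (w * (1 + Complex.I * σ * τ) ^ (w - 1))) τ := by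
  have h1 : HasDerivAt (fun x : ℝ => 1 + Complex.I * σ * (x : ℂ)) (Complex.I * σ * 1) τ :=
    (((hasDerivAt_id (τ : ℂ)).comp_ofReal).const_mul _).const_add _
  have h2 := (hasDerivAt_id' (1 + Complex.I * σ * (τ : ℂ))).cpow_const (c := w)
    (one_add_I_mul_mem_slitPlane σ τ)
  refine (HasDerivAt.comp (h₂ := fun z : ℂ => z ^ w) τ h2 h1).congr_deriv ?_
  ring

theorem continuous_one_add_cpow (w : ℂ) (σ : ℝ) :
    Continuous (fun τ : ℝ => (1 + Complex.I * σ * τ) ^ w) :=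
  continuous_iff_continuousAt.2 fun τ => (hasDerivAt_one_add_cpow w σ τ).continuousAt

theorem norm_cpow_le_rpow_mul_exp (z w : ℂ) :
    ‖z ^ w‖ ≤ ‖z‖ ^ w.re * Real.exp (Real.pi * |w.im|) := by
  refine (Complex.norm_cpow_le z w).trans ?_
  rw [div_eq_mul_inv, ← Real.exp_neg]
  gcongr
  calc -(z.arg * w.im) ≤ |z.arg * w.im| := neg_le_abs _
    _ = |z.arg| * |w.im| := abs_mul _ _
    _ ≤ _ := by gcongr; exact Complex.abs_arg_le_pi z

/-- With K = m/b + 1 one has 1 + τ ≤ K e^{τ/K}, and the m-th power has rate m/K ≤ b. -/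
theorem one_add_rpow_le_exp {m τ b : ℝ} (hm : 0 ≤ m) (hb : 0 < b) (hτ : 0 ≤ τ) :
    (1 + τ) ^ m ≤ (m / b + 1) ^ m * Real.exp (b * τ) := by
  have hK : 0 < m / b + 1 := by positivity
  have h1 : 1 + τ ≤ (m / b + 1) * Real.exp (τ / (m / b + 1)) := by
    have := Real.add_one_le_exp (τ / (m / b + 1))
    have h2 : (m / b + 1) * (τ / (m / b + 1) + 1) = τ + (m / b + 1) := by field_simp
    have h3 : 0 ≤ m / b := by positivity
    nlinarith
  calc (1 + τ) ^ m ≤ ((m / b + 1) * Real.exp (τ / (m / b + 1))) ^ m := by gcongr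
    _ = (m / b + 1) ^ m * Real.exp (τ / (m / b + 1) * m) := by
        rw [Real.mul_rpow hK.le (Real.exp_pos _).le, ← Real.exp_mul]
    _ ≤ _ := by
        refine mul_le_mul_of_nonneg_left (Real.exp_le_exp.2 ?_) (by positivity)
        have h4 : τ / (m / b + 1) * m = (b * τ) * (m / (m + b)) := by field_simp
        rw [h4]
        exact mul_le_of_le_one_right (by positivity) (div_le_one_of_le₀ (by linarith) (by linarith))

theorem exists_norm_one_add_cpow_le (w : ℂ) : ∃ C, 0 ≤ C ∧ ∀ σ τ : ℝ, (σ = 1 ∨ σ = -1) → 0 ≤ τ →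
    ‖(1 + Complex.I * σ * τ) ^ w‖ ≤ C * Real.exp (τ / 32) := by
  refine ⟨(|w.re| / (1 / 32) + 1) ^ |w.re| * Real.exp (Real.pi * |w.im|), by positivity,
    fun σ τ hσ hτ => ?_⟩
  have hσ' : |σ| = 1 := by rcases hσ with rfl | rfl <;> simp
  have h1 : 1 ≤ ‖1 + Complex.I * σ * τ‖ := by
    have := Complex.abs_re_le_norm (1 + Complex.I * σ * τ)
    simpa using this
  have h2 : ‖1 + Complex.I * σ * τ‖ ≤ 1 + τ := by
    refine (norm_add_le _ _).trans ?_
    simp [hσ', abs_of_nonneg hτ]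
  have h3 : ‖1 + Complex.I * σ * τ‖ ^ w.re ≤ (1 + τ) ^ |w.re| :=
    (Real.rpow_le_rpow_of_exponent_le h1 (le_abs_self _)).trans
      (Real.rpow_le_rpow (by linarith) h2 (abs_nonneg _))
  have h4 := one_add_rpow_le_exp (abs_nonneg w.re) (b := 1 / 32) (by norm_num) hτ
  calc _ ≤ (1 + τ) ^ |w.re| * Real.exp (Real.pi * |w.im|) :=
        (norm_cpow_le_rpow_mul_exp _ _).trans (by gcongr)
    _ ≤ (|w.re| / (1 / 32) + 1) ^ |w.re| * Real.exp (1 / 32 * τ) *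
          Real.exp (Real.pi * |w.im|) := by gcongr
    _ = _ := by rw [show 1 / 32 * τ = τ / 32 by ring]; ring

/-- The derivative of the remainder of order n + 1 for the exponent w is iσw times the remainder of
order n for w − 1. Since the remainder vanishes at τ = 0, the mean value inequality gives one more
power of τ. The recursion defining `binomCoeff` is adapted to this induction. -/
theorem exists_norm_one_add_cpow_sub_le (w : ℂ) (n : ℕ) :
    ∃ C, 0 ≤ C ∧ ∀ σ τ : ℝ, (σ = 1 ∨ σ = -1) → 0 ≤ τ →
    ‖(1 + Complex.I * σ * τ) ^ w
      - ∑ j ∈ Finset.range n, binomCoeff w j * (Complex.I * σ * τ) ^ j‖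
      ≤ C * (τ ^ n * Real.exp (τ / 32)) := by
  induction n generalizing w with
  | zero => simpa using exists_norm_one_add_cpow_le w
  | succ n ih =>
    obtain ⟨C, hC, hb⟩ := ih (w - 1)
    refine ⟨‖w‖ * C, by positivity, fun σ τ hσ hτ => ?_⟩
    have hσ' : ‖Complex.I * (σ : ℂ)‖ = 1 := by rcases hσ with rfl | rfl <;> simp
    set R : ℝ → ℂ := fun τ => (1 + Complex.I * σ * τ) ^ w
      - ∑ j ∈ Finset.range (n + 1), binomCoeff w j * (Complex.I * σ * τ) ^ j with hR
    have hder : ∀ x : ℝ, HasDerivAt R (Complex.I * σ * w * ((1 + Complex.I * σ * x) ^ (w - 1)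
        - ∑ j ∈ Finset.range n, binomCoeff (w - 1) j * (Complex.I * σ * x) ^ j)) x := by
      intro x
      have h1 : HasDerivAt (fun x : ℝ => ∑ j ∈ Finset.range (n + 1),
          binomCoeff w j * (Complex.I * σ * x) ^ j)
          (∑ j ∈ Finset.range (n + 1),
            binomCoeff w j * (j * (Complex.I * σ * x) ^ (j - 1) * (Complex.I * σ * 1))) x := by
        refine HasDerivAt.fun_sum fun j _ => HasDerivAt.const_mul _ ?_
        exact (((hasDerivAt_id (x : ℂ)).comp_ofReal).const_mul (Complex.I * σ)).pow j
      refine ((hasDerivAt_one_add_cpow w σ x).sub h1).congr_deriv ?_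
      rw [Finset.sum_range_succ']
      have : ∀ j ∈ Finset.range n, binomCoeff w (j + 1) *
          (((j + 1 : ℕ) : ℂ) * (Complex.I * σ * x) ^ (j + 1 - 1) * (Complex.I * σ * 1))
          = Complex.I * σ * w * (binomCoeff (w - 1) j * (Complex.I * σ * x) ^ j) := by
        intro j _
        have hj : (j : ℂ) + 1 ≠ 0 := by exact_mod_cast j.succ_ne_zero
        rw [binomCoeff, Nat.add_sub_cancel]
        push_cast
        field_simp
      rw [Finset.sum_congr rfl this, ← Finset.mul_sum]
      simp
      ring
    have h0 : R 0 = 0 := by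
      simp [hR, Finset.sum_range_succ', binomCoeff]
    have h := norm_image_sub_le_of_norm_deriv_le_segment' (a := 0) (b := τ)
      (C := ‖w‖ * (C * (τ ^ n * Real.exp (τ / 32)))) (fun x _ => (hder x).hasDerivWithinAt) (by
        intro x hx
        rw [norm_mul, norm_mul, hσ', one_mul]
        gcongr
        refine (hb σ x hσ hx.1).trans ?_
        have := hx.1; have := hx.2.le
        gcongr) τ (right_mem_Icc.2 hτ)
    rw [h0, sub_zero, sub_zero] at h
    refine h.trans (le_of_eq ?_)
    ring

/-- The amplitude `∫₀^∞ e^{-sτ} τ^{2-a} (1 + iετ)^{a-1} dτ` of the oscillating solution. -/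
def oscAmp (a : ℂ) (ε s : ℝ) : ℂ :=
  ∫ τ in Ioi (0 : ℝ), Complex.exp (-(s * τ)) *
    ((τ : ℂ) ^ (2 - a) * (1 + Complex.I * ε * τ) ^ (a - 1))

theorem continuousOn_cpow_mul {g : ℝ → ℂ} (hg : Continuous g) (c : ℂ) :
    ContinuousOn (fun τ : ℝ => (τ : ℂ) ^ c * g τ) (Ioi 0) := by
  refine ContinuousOn.mul (fun τ hτ => ?_) hg.continuousOn
  exact (hasDerivAt_ofReal_cpow_of_pos c hτ).continuousAt.continuousWithinAt

theorem exists_norm_cpow_mul_le {c : ℂ} {w : ℂ} : ∃ C : ℝ, ∀ ε : ℝ, (ε = 1 ∨ ε = -1) →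
    ∀ τ : ℝ, 0 < τ →
    ‖(τ : ℂ) ^ c * (1 + Complex.I * ε * τ) ^ w‖ ≤ C * (τ ^ (c.re + 1 - 1) * Real.exp (τ / 32)) := by
  obtain ⟨C, hC, hb⟩ := exists_norm_one_add_cpow_le w
  refine ⟨C, fun ε hε τ hτ => ?_⟩
  rw [norm_mul, Complex.norm_cpow_eq_rpow_re_of_pos hτ, add_sub_cancel_right]
  calc _ ≤ τ ^ c.re * (C * Real.exp (τ / 32)) := by gcongr; exact hb ε τ hε hτ.le
    _ = _ := by ring

theorem sym_oscAmp {a : ℂ} (ha : a.re < 3) (k : ℕ) :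
    Sym zoneHalf (fun _ s => s ^ (a.re - 3)) k (oscAmp a) := by
  obtain ⟨C, hb⟩ := exists_norm_cpow_mul_le (c := 2 - a) (w := a - 1)
  refine (Sym.laplace (c := (2 - a).re + 1) (by simp; linarith)
    (fun ε hε => continuousOn_cpow_mul (continuous_one_add_cpow _ _) _) hb).weight_congr
    fun t r m => ?_
  congr 1; simp; ring

/-- Integration by parts in τ: the derivative of e^{-sτ} τ^{3−a} (1+iετ)^{a−1} integrates to zero,
the value at τ = 0 vanishing because Re a < 3. This is the form of the contiguous relation that the
amplitude obeys. -/
theorem rdr_oscAmp {a : ℂ} (ha : a.re < 3) {ε s : ℝ} (m : zoneHalf.mem ε s) :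
    CSS.rdr (oscAmp a ε) s =
      -(3 - a) * oscAmp a ε s - (a - 1) * (Complex.I * ε) * oscAmp (a - 1) ε s := by
  obtain ⟨C, hb⟩ := exists_norm_cpow_mul_le (c := 2 - a) (w := a - 1)
  obtain ⟨C₁, hb₁⟩ := exists_norm_cpow_mul_le (c := 3 - a) (w := a - 1)
  obtain ⟨C₂, hb₂⟩ := exists_norm_cpow_mul_le (c := 3 - a) (w := a - 2)
  have i0 := laplace_integrable (c := (2 - a).re + 1) (by simp; linarith)
    (fun ε hε => continuousOn_cpow_mul (continuous_one_add_cpow _ _) _) hb m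
  have i1 := laplace_integrable (c := (3 - a).re + 1) (by simp; linarith)
    (fun ε hε => continuousOn_cpow_mul (continuous_one_add_cpow _ _) _) hb₁ m
  have i2 := laplace_integrable (c := (3 - a).re + 1) (by simp; linarith)
    (fun ε hε => continuousOn_cpow_mul (continuous_one_add_cpow _ _) _) hb₂ m
  have hd := laplace_hasDerivAt (c := (2 - a).re + 1) (by simp; linarith)
    (fun ε hε => continuousOn_cpow_mul (continuous_one_add_cpow _ _) _) hb m
  have h3 : (3 - a) ≠ 0 := fun h => by
    have := congrArg Complex.re h; simp at this; linarith
  set F : ℝ → ℂ := fun τ => Complex.exp (-(s * τ)) *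
    ((τ : ℂ) ^ (3 - a) * (1 + Complex.I * ε * τ) ^ (a - 1)) with hF
  set F' : ℝ → ℂ := fun τ => -s * F τ + ((3 - a) * (Complex.exp (-(s * τ)) *
    ((τ : ℂ) ^ (2 - a) * (1 + Complex.I * ε * τ) ^ (a - 1))) +
    (a - 1) * (Complex.I * ε) * (Complex.exp (-(s * τ)) *
    ((τ : ℂ) ^ (3 - a) * (1 + Complex.I * ε * τ) ^ (a - 2)))) with hF'
  have hder : ∀ τ ∈ Ioi (0 : ℝ), HasDerivAt F (F' τ) τ := by
    intro τ hτ
    have h1 : HasDerivAt (fun x : ℝ => -((s : ℂ) * x)) (-((s : ℂ) * 1)) τ :=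
      (((hasDerivAt_id (τ : ℂ)).comp_ofReal).const_mul _).neg
    refine ((h1.cexp).mul ((hasDerivAt_ofReal_cpow_of_pos (3 - a) hτ).mul
      (hasDerivAt_one_add_cpow (a - 1) ε τ))).congr_deriv ?_
    rw [show (3 : ℂ) - a - 1 = 2 - a by ring, show a - 1 - 1 = a - 2 by ring, hF']
    simp only [hF, Pi.mul_apply]
    ring
  have i02 : IntegrableOn (fun τ : ℝ => (3 - a) * (Complex.exp (-(s * τ)) *
      ((τ : ℂ) ^ (2 - a) * (1 + Complex.I * ε * τ) ^ (a - 1))) +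
      (a - 1) * (Complex.I * ε) * (Complex.exp (-(s * τ)) *
      ((τ : ℂ) ^ (3 - a) * (1 + Complex.I * ε * τ) ^ (a - 2)))) (Ioi 0) :=
    (i0.const_mul _).add (i2.const_mul _)
  have hint : IntegrableOn F' (Ioi 0) := (i1.const_mul _).add i02
  have hlim := tendsto_zero_of_hasDerivAt_of_integrableOn_Ioi hder hint i1
  have hcont : ContinuousWithinAt F (Ici 0) 0 := by
    refine Continuous.continuousWithinAt ?_
    exact (by fun_prop : Continuous fun τ : ℝ => Complex.exp (-(s * τ))).mul
      ((Complex.continuous_ofReal_cpow_const (by simp; linarith)).mul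
        (continuous_one_add_cpow _ _))
  have hI := integral_Ioi_of_hasDerivAt_of_tendsto hcont hder hint hlim
  have hF0 : F 0 = 0 := by simp [hF, h3]
  rw [hF0, sub_zero, hF', integral_add (i1.const_mul _) i02,
    integral_add (i0.const_mul _) (i2.const_mul _), integral_const_mul, integral_const_mul,
    integral_const_mul] at hI
  have e1 : CSS.rdr (oscAmp a ε) s = -s * ∫ τ in Ioi (0 : ℝ), F τ := by
    have : deriv (oscAmp a ε) s = _ := hd.deriv
    rw [CSS.rdr, this, neg_mul, ← mul_neg, ← integral_neg]
    congr 1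
    refine setIntegral_congr_fun measurableSet_Ioi fun τ hτ => ?_
    have hτ0 : (τ : ℂ) ≠ 0 := by exact_mod_cast (ne_of_gt hτ)
    simp only [hF]
    rw [show (3 : ℂ) - a = 2 - a + 1 by ring, Complex.cpow_add _ _ hτ0, Complex.cpow_one]
    ring
  have e2 : oscAmp (a - 1) ε s = ∫ τ in Ioi (0 : ℝ), Complex.exp (-(s * τ)) *
      ((τ : ℂ) ^ (3 - a) * (1 + Complex.I * ε * τ) ^ (a - 2)) := by
    rw [oscAmp, show (2 : ℂ) - (a - 1) = 3 - a by ring, show a - 1 - 1 = a - 2 by ring]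
  rw [e1, e2, oscAmp]
  linear_combination hI

/-! ### Confluent hypergeometric functions on the imaginary axis -/

/-- A positive real factor does not change the argument, so the principal branch is multiplicative
here. -/
theorem mul_ofReal_cpow {z : ℂ} (hz : z ≠ 0) {τ : ℝ} (hτ : 0 < τ) (c : ℂ) :
    (z * τ) ^ c = z ^ c * (τ : ℂ) ^ c := by
  have hτ0 : (τ : ℂ) ≠ 0 := by exact_mod_cast hτ.ne'
  rw [Complex.cpow_def_of_ne_zero (mul_ne_zero hz hτ0), Complex.log_mul_ofReal τ hτ z hz,
    Complex.cpow_def_of_ne_zero hz, Complex.cpow_def_of_ne_zero hτ0, ← Complex.exp_add,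
    Complex.ofReal_log hτ.le]
  congr 1; ring

/-- The Fourier integral `∫₀¹ e^{iρu} h(u) du`. -/
def fourierUnit (h : ℝ → ℂ) (ρ : ℝ) : ℂ :=
  ∫ u in (0 : ℝ)..1, Complex.exp (Complex.I * ρ * u) * h u

theorem norm_exp_I_mul (x y : ℝ) : ‖Complex.exp (Complex.I * x * y)‖ = 1 := by
  rw [Complex.norm_exp]; simp

theorem intervalIntegrable_exp_mul {h : ℝ → ℂ} (hh : IntervalIntegrable h volume 0 1) (ρ : ℝ) :
    IntervalIntegrable (fun u : ℝ => Complex.exp (Complex.I * ρ * u) * h u) volume 0 1 :=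
  hh.continuousOn_mul (by fun_prop : Continuous fun u : ℝ =>
    Complex.exp (Complex.I * ρ * u)).continuousOn

theorem intervalIntegrable_I_mul {h : ℝ → ℂ} (hh : IntervalIntegrable h volume 0 1) :
    IntervalIntegrable (fun u : ℝ => Complex.I * u * h u) volume 0 1 :=
  hh.continuousOn_mul (by fun_prop : Continuous fun u : ℝ => Complex.I * u).continuousOn

theorem hasDerivAt_fourierUnit {h : ℝ → ℂ} (hh : IntervalIntegrable h volume 0 1) (ρ : ℝ) :
    HasDerivAt (fourierUnit h) (fourierUnit (fun u => Complex.I * u * h u) ρ) ρ := by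
  refine (intervalIntegral.hasDerivAt_integral_of_dominated_loc_of_deriv_le
    (F := fun (ρ : ℝ) (u : ℝ) => Complex.exp (Complex.I * ρ * u) * h u)
    (F' := fun (ρ : ℝ) (u : ℝ) => Complex.exp (Complex.I * ρ * u) * (Complex.I * u * h u))
    (bound := fun u => ‖h u‖) (s := univ) univ_mem
    (Eventually.of_forall fun x => ?_) (intervalIntegrable_exp_mul hh ρ) ?_ ?_ hh.norm ?_).2
  · have := (intervalIntegrable_exp_mul hh x).aestronglyMeasurable
    rwa [uIoc_of_le zero_le_one]
  · have := (intervalIntegrable_exp_mul (intervalIntegrable_I_mul hh) ρ).aestronglyMeasurable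
    rwa [uIoc_of_le zero_le_one]
  · refine Eventually.of_forall fun u hu x _ => ?_
    rw [uIoc_of_le zero_le_one] at hu
    rw [norm_mul, norm_exp_I_mul, one_mul, norm_mul, norm_mul, Complex.norm_I, one_mul,
      Complex.norm_real, Real.norm_eq_abs, abs_of_pos hu.1]
    exact mul_le_of_le_one_left (norm_nonneg _) hu.2
  · refine Eventually.of_forall fun u hu x _ => ?_
    have h1 : HasDerivAt (fun x : ℝ => Complex.I * (x : ℂ) * u) (Complex.I * 1 * u) x :=
      (((hasDerivAt_id (x : ℂ)).comp_ofReal).const_mul _).mul_const _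
    exact (h1.cexp.mul_const (h u)).congr_deriv (by ring)

theorem contDiff_fourierUnit {h : ℝ → ℂ} (hh : IntervalIntegrable h volume 0 1) :
    ContDiff ℝ ∞ (fourierUnit h) := by
  rw [contDiff_infty]
  intro n
  induction n generalizing h with
  | zero =>
    rw [CharP.cast_eq_zero, contDiff_zero]
    exact continuous_iff_continuousAt.2 fun ρ => (hasDerivAt_fourierUnit hh ρ).continuousAt
  | succ n ih =>
    push_cast
    rw [contDiff_succ_iff_deriv]
    refine ⟨fun ρ => (hasDerivAt_fourierUnit hh ρ).differentiableAt, by simp, ?_⟩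
    rw [show deriv (fourierUnit h) = fourierUnit (fun u => Complex.I * u * h u) from
      funext fun ρ => (hasDerivAt_fourierUnit hh ρ).deriv]
    exact ih (intervalIntegrable_I_mul hh)

/-- The weight `u^{a-1} (1-u)^{2-a}` of Euler's integral. -/
def eulerWeight (a : ℂ) (u : ℝ) : ℂ := (u : ℂ) ^ (a - 1) * (1 - (u : ℂ)) ^ (2 - a)

/-! ### Euler's integral and Kummer's equation -/

theorem intervalIntegrable_eulerWeight {a : ℂ} (h0 : 0 < a.re) (h3 : a.re < 3) :
    IntervalIntegrable (eulerWeight a) volume 0 1 := by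
  have := Complex.betaIntegral_convergent (u := a) (v := 3 - a) h0 (by simp; linarith)
  rwa [show (3 : ℂ) - a - 1 = 2 - a by ring] at this

theorem fourierUnit_eulerWeight_zero (a : ℂ) :
    fourierUnit (eulerWeight a) 0 = Complex.betaIntegral a (3 - a) := by
  simp only [fourierUnit, eulerWeight, Complex.betaIntegral, Complex.ofReal_zero, mul_zero,
    zero_mul, Complex.exp_zero, one_mul, show (3 : ℂ) - a - 1 = 2 - a by ring]

/-- The left side is −i times the integral of the derivative of e^{iρu} u^a (1−u)^{3−a}, which
vanishes at both end points because 0 < Re a < 3. -/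
theorem fourierUnit_eulerWeight_ode {a : ℂ} (h0 : 0 < a.re) (h3 : a.re < 3) (ρ : ℝ) :
    ρ * deriv (deriv (fourierUnit (eulerWeight a))) ρ
      + (3 - Complex.I * ρ) * deriv (fourierUnit (eulerWeight a)) ρ
      - Complex.I * a * fourierUnit (eulerWeight a) ρ = 0 := by
  have hw := intervalIntegrable_eulerWeight h0 h3
  have hw1 := intervalIntegrable_I_mul hw
  have hw2 := intervalIntegrable_I_mul hw1
  rw [show deriv (fourierUnit (eulerWeight a)) = fourierUnit (fun u => Complex.I * u *
      eulerWeight a u) from funext fun ρ => (hasDerivAt_fourierUnit hw ρ).deriv,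
    (hasDerivAt_fourierUnit hw1 ρ).deriv]
  have ha0 : a ≠ 0 := fun h => by simp [h] at h0
  have ha3 : 3 - a ≠ 0 := fun h => by
    have := congrArg Complex.re h; simp at this; linarith
  set F : ℝ → ℂ := fun u =>
    Complex.exp (Complex.I * ρ * u) * ((u : ℂ) ^ a * (1 - (u : ℂ)) ^ (3 - a)) with hF
  have hcont : ContinuousOn F (Icc 0 1) := by
    refine Continuous.continuousOn ?_
    refine (by fun_prop : Continuous fun u : ℝ => Complex.exp (Complex.I * ρ * u)).mul
      ((Complex.continuous_ofReal_cpow_const h0).mul ?_)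
    have := (Complex.continuous_ofReal_cpow_const (y := 3 - a) (by simp; linarith)).comp
      (by fun_prop : Continuous fun u : ℝ => 1 - u)
    refine this.congr fun u => ?_
    simp
  have hder : ∀ u ∈ Ioo (0 : ℝ) 1, HasDerivAt F
      (Complex.exp (Complex.I * ρ * u) * ((a - 3 * u + Complex.I * ρ * u * (1 - u))
        * eulerWeight a u)) u := by
    intro u hu
    have h1 : HasDerivAt (fun x : ℝ => Complex.I * ρ * (x : ℂ)) (Complex.I * ρ * 1) u :=
      ((hasDerivAt_id (u : ℂ)).comp_ofReal).const_mul _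
    have h2 := (hasDerivAt_ofReal_cpow_of_pos (3 - a) (sub_pos.2 hu.2)).scomp u
      ((hasDerivAt_id u).const_sub 1)
    have h2' : HasDerivAt (fun u : ℝ => (1 - (u : ℂ)) ^ (3 - a))
        ((-1 : ℝ) • ((3 - a) * ((1 - u : ℝ) : ℂ) ^ (3 - a - 1))) u := by
      refine h2.congr_of_eventuallyEq (Eventually.of_forall fun x => ?_)
      simp
    refine (h1.cexp.mul ((hasDerivAt_ofReal_cpow_of_pos a hu.1).mul h2')).congr_deriv ?_
    have hu0 : (u : ℂ) ≠ 0 := by exact_mod_cast hu.1.ne'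
    have hu1 : 1 - (u : ℂ) ≠ 0 := by
      have := (sub_pos.2 hu.2).ne'
      exact_mod_cast this
    have e1 : (u : ℂ) ^ a = u ^ (a - 1) * u := by
      rw [Complex.cpow_sub _ _ hu0, Complex.cpow_one]; field_simp
    have e2 : (1 - (u : ℂ)) ^ (3 - a) = (1 - (u : ℂ)) ^ (2 - a) * (1 - u) := by
      rw [show (3 : ℂ) - a = 2 - a + 1 by ring, Complex.cpow_add _ _ hu1, Complex.cpow_one]
    rw [show (3 : ℂ) - a - 1 = 2 - a by ring]
    simp only [Pi.mul_apply, eulerWeight, e1, e2, Complex.real_smul]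
    push_cast
    ring
  have hint : IntervalIntegrable (fun u : ℝ => Complex.exp (Complex.I * ρ * u) *
      ((a - 3 * u + Complex.I * ρ * u * (1 - u)) * eulerWeight a u)) volume 0 1 :=
    intervalIntegrable_exp_mul (hw.continuousOn_mul (by fun_prop : Continuous fun u : ℝ =>
      a - 3 * u + Complex.I * ρ * u * (1 - u)).continuousOn) ρ
  have hI := intervalIntegral.integral_eq_sub_of_hasDerivAt_of_le zero_le_one hcont hder hint
  have hF0 : F 0 = 0 := by simp [hF, ha0]
  have hF1 : F 1 = 0 := by simp [hF, ha3]
  rw [hF0, hF1, sub_zero] at hI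
  simp only [fourierUnit]
  rw [← intervalIntegral.integral_const_mul, ← intervalIntegral.integral_const_mul,
    ← intervalIntegral.integral_const_mul, ← intervalIntegral.integral_add
      ((intervalIntegrable_exp_mul hw2 ρ).const_mul _) ((intervalIntegrable_exp_mul hw1 ρ).const_mul _),
    ← intervalIntegral.integral_sub (((intervalIntegrable_exp_mul hw2 ρ).const_mul _).add
      ((intervalIntegrable_exp_mul hw1 ρ).const_mul _)) ((intervalIntegrable_exp_mul hw ρ).const_mul _)]
  have e : ∫ u in (0 : ℝ)..1, -Complex.I * (Complex.exp (Complex.I * ρ * u) *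
      ((a - 3 * u + Complex.I * ρ * u * (1 - u)) * eulerWeight a u)) = 0 := by
    rw [intervalIntegral.integral_const_mul, hI, mul_zero]
  rw [← e]
  congr 1
  ext u
  ring

/-- The integrand of Euler's integral off the real axis. -/
def eulerIntegrand (a : ℂ) (ρ : ℝ) (u : ℂ) : ℂ :=
  Complex.exp (Complex.I * ρ * u) * (u ^ (a - 1) * (1 - u) ^ (2 - a))

/-! ### Rotation of Euler's integral off the real axis -/

theorem differentiableAt_eulerIntegrand (a : ℂ) (ρ : ℝ) {u : ℂ} (hu : u ∈ Complex.slitPlane)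
    (hu' : 1 - u ∈ Complex.slitPlane) : DifferentiableAt ℂ (eulerIntegrand a ρ) u := by
  unfold eulerIntegrand
  refine DifferentiableAt.mul (by fun_prop) (DifferentiableAt.mul ?_ ?_)
  · exact differentiableAt_id.cpow_const hu
  · exact (differentiableAt_id.const_sub 1).cpow_const hu'

theorem abs_of_sign {ε : ℝ} (hε : ε = 1 ∨ ε = -1) : |ε| = 1 := by
  rcases hε with rfl | rfl <;> simp

theorem ne_zero_of_sign {ε : ℝ} (hε : ε = 1 ∨ ε = -1) : (Complex.I * ε : ℂ) ≠ 0 := by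
  rcases hε with rfl | rfl <;> simp

theorem I_mul_sign_sq {ε : ℝ} (hε : ε = 1 ∨ ε = -1) : (Complex.I * ε : ℂ) * (Complex.I * ε) = -1 := by
  rcases hε with rfl | rfl <;> simp

theorem eulerIntegrand_left (a : ℂ) {ε : ℝ} (hε : ε = 1 ∨ ε = -1) (s : ℝ) {τ : ℝ} (hτ : 0 < τ) :
    eulerIntegrand a (ε * s) ((ε * τ : ℝ) * Complex.I) =
      Complex.exp (-(s * τ)) * ((Complex.I * ε) ^ (a - 1) *
        ((τ : ℂ) ^ (a - 1) * (1 + Complex.I * (-ε : ℝ) * τ) ^ (2 - a))) := by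
  have h1 : (((ε * τ : ℝ) : ℂ) * Complex.I) = (Complex.I * ε) * τ := by push_cast; ring
  rw [eulerIntegrand, h1, mul_ofReal_cpow (ne_zero_of_sign hε) hτ]
  have h2 : Complex.I * ((ε * s : ℝ) : ℂ) * (Complex.I * ε * τ) = -(s * τ) := by
    push_cast
    linear_combination (s * τ : ℂ) * I_mul_sign_sq hε
  have h3 : 1 - Complex.I * ε * (τ : ℂ) = 1 + Complex.I * (-ε : ℝ) * τ := by push_cast; ring
  rw [h2, h3]
  ring

/-- On the vertical lines through 0 and 1, directed along iε with ε the sign of ρ, the oscillation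
e^{iρu} becomes decay e^{-sτ}. The line through 1 keeps the factor e^{iεs}, which is the source of
the oscillating part of G. -/
theorem eulerIntegrand_right (a : ℂ) {ε : ℝ} (hε : ε = 1 ∨ ε = -1) (s : ℝ) {τ : ℝ} (hτ : 0 < τ) :
    eulerIntegrand a (ε * s) (1 + (ε * τ : ℝ) * Complex.I) =
      Complex.exp (Complex.I * ε * s) * (-(Complex.I * ε)) ^ (2 - a) *
      (Complex.exp (-(s * τ)) * ((τ : ℂ) ^ (2 - a) * (1 + Complex.I * ε * τ) ^ (a - 1))) := by
  have h1 : (((ε * τ : ℝ) : ℂ) * Complex.I) = (Complex.I * ε) * τ := by push_cast; ring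
  have h3 : 1 - (1 + (Complex.I * ε) * (τ : ℂ)) = -(Complex.I * ε) * τ := by ring
  rw [eulerIntegrand, h1, h3, mul_ofReal_cpow (neg_ne_zero.2 (ne_zero_of_sign hε)) hτ]
  have h2 : Complex.I * ((ε * s : ℝ) : ℂ) * (1 + Complex.I * ε * τ) =
      Complex.I * ε * s + -(s * τ) := by
    push_cast
    linear_combination (s * τ : ℂ) * I_mul_sign_sq hε
  rw [h2, Complex.exp_add]
  ring

/-- Cauchy's theorem on a rectangle of width one. Starting at height δ > 0 keeps the rectangle off
the real axis, hence away from the branch points 0 and 1 and from the cuts of the two powers. -/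
theorem eulerIntegrand_rect (a : ℂ) {ε : ℝ} (hε : ε = 1 ∨ ε = -1) (s : ℝ) {δ T : ℝ} (hδ : 0 < δ)
    (hT : δ ≤ T) :
    (∫ x in (0 : ℝ)..1, eulerIntegrand a (ε * s) (x + (ε * δ : ℝ) * Complex.I))
      - (∫ x in (0 : ℝ)..1, eulerIntegrand a (ε * s) (x + (ε * T : ℝ) * Complex.I))
      + Complex.I * ε * (∫ τ in δ..T, eulerIntegrand a (ε * s) (1 + (ε * τ : ℝ) * Complex.I))
      - Complex.I * ε * (∫ τ in δ..T, eulerIntegrand a (ε * s) ((ε * τ : ℝ) * Complex.I)) = 0 := by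
  have hne : ∀ y ∈ Set.uIcc (ε * δ) (ε * T), y ≠ 0 := by
    intro y hy h0
    subst h0
    rcases hε with rfl | rfl
    · rw [one_mul, one_mul, uIcc_of_le hT] at hy; linarith [hy.1]
    · rw [neg_one_mul, neg_one_mul, uIcc_of_ge (neg_le_neg hT)] at hy; linarith [hy.2]
  have h := Complex.integral_boundary_rect_eq_zero_of_differentiableOn (eulerIntegrand a (ε * s))
    (((0 : ℝ) : ℂ) + (ε * δ : ℝ) * Complex.I) (((1 : ℝ) : ℂ) + (ε * T : ℝ) * Complex.I) (by
      intro u hu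
      rw [Complex.mem_reProdIm] at hu
      have him : u.im ≠ 0 := by
        apply hne
        have := hu.2
        simpa using this
      refine (differentiableAt_eulerIntegrand a _ (Or.inr him) (Or.inr ?_)).differentiableWithinAt
      simpa using him)
  have e0 : ∀ x y : ℝ, ((x : ℂ) + (y : ℂ) * Complex.I).re = x := by simp
  have e1 : ∀ x y : ℝ, ((x : ℂ) + (y : ℂ) * Complex.I).im = y := by simp
  simp only [e0, e1] at h
  rw [← intervalIntegral.smul_integral_comp_mul_left, ← intervalIntegral.smul_integral_comp_mul_left]
    at h
  simp only [smul_eq_mul, Complex.real_smul, Complex.ofReal_zero, zero_add, Complex.ofReal_one] at h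
  rw [← h]
  ring

theorem norm_sub_add_ge {x y : ℝ} (hx : 0 ≤ x) : x ≤ ‖(x : ℂ) + y * Complex.I‖ := by
  have := Complex.abs_re_le_norm ((x : ℂ) + y * Complex.I)
  simpa [abs_of_nonneg hx] using this

theorem norm_add_im_ge (x y : ℝ) : |y| ≤ ‖(x : ℂ) + y * Complex.I‖ := by
  have := Complex.abs_im_le_norm ((x : ℂ) + y * Complex.I)
  simpa using this

theorem norm_add_im_le {x y : ℝ} (hx : 0 ≤ x) : ‖(x : ℂ) + y * Complex.I‖ ≤ x + |y| := by
  refine (norm_add_le _ _).trans ?_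
  simp [abs_of_nonneg hx]

theorem norm_exp_eulerPhase {ε : ℝ} (hε : ε = 1 ∨ ε = -1) (s x τ : ℝ) :
    ‖Complex.exp (Complex.I * (ε * s : ℝ) * ((x : ℂ) + (ε * τ : ℝ) * Complex.I))‖ =
      Real.exp (-(s * τ)) := by
  rw [Complex.norm_exp]
  congr 1
  rcases hε with rfl | rfl <;> simp

theorem one_sub_add_im (x y : ℝ) : 1 - ((x : ℂ) + y * Complex.I) = ((1 - x : ℝ) : ℂ) + (-y : ℝ) * Complex.I := by
  push_cast; ring

/-- Each of the two powers grows at most like e^{T/64}, while the exponential is below e^{-T/16}; a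
decay e^{-T/32} survives. -/
theorem tendsto_eulerIntegrand_top (a : ℂ) {ε s : ℝ} (m : zoneHalf.mem ε s) :
    Tendsto (fun T : ℝ => ∫ x in (0 : ℝ)..1, eulerIntegrand a (ε * s) (x + (ε * T : ℝ) * Complex.I))
      atTop (𝓝 0) := by
  obtain ⟨hε, hs⟩ := m
  have hpow : ∀ c : ℂ, ∃ C, 0 ≤ C ∧ ∀ z : ℂ, ∀ T : ℝ, 0 ≤ T → 1 ≤ ‖z‖ → ‖z‖ ≤ 1 + T →
      ‖z ^ c‖ ≤ C * Real.exp (1 / 64 * T) := by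
    intro c
    refine ⟨(|c.re| / (1 / 64) + 1) ^ |c.re| * Real.exp (Real.pi * |c.im|), by positivity,
      fun z T hT h1 h2 => ?_⟩
    have h3 : ‖z‖ ^ c.re ≤ (1 + T) ^ |c.re| :=
      (Real.rpow_le_rpow_of_exponent_le h1 (le_abs_self _)).trans
        (Real.rpow_le_rpow (by linarith) h2 (abs_nonneg _))
    calc _ ≤ (1 + T) ^ |c.re| * Real.exp (Real.pi * |c.im|) :=
          (norm_cpow_le_rpow_mul_exp _ _).trans (by gcongr)
      _ ≤ (|c.re| / (1 / 64) + 1) ^ |c.re| * Real.exp (1 / 64 * T) * Real.exp (Real.pi * |c.im|) := by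
          gcongr; exact one_add_rpow_le_exp (abs_nonneg _) (by norm_num) hT
      _ = _ := by ring
  obtain ⟨C₁, hC₁, hb₁⟩ := hpow (a - 1)
  obtain ⟨C₂, hC₂, hb₂⟩ := hpow (2 - a)
  have hle : ∀ T : ℝ, 1 ≤ T →
      ‖∫ x in (0 : ℝ)..1, eulerIntegrand a (ε * s) (x + (ε * T : ℝ) * Complex.I)‖ ≤
        C₁ * C₂ * Real.exp (-(T / 32)) := by
    intro T hT
    have habs : |ε * T| = T := by rw [abs_mul, abs_of_sign hε, one_mul, abs_of_pos (by linarith)]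
    have := intervalIntegral.norm_integral_le_of_norm_le_const (a := 0) (b := 1)
      (C := C₁ * C₂ * Real.exp (-(T / 32)))
      (f := fun x : ℝ => eulerIntegrand a (ε * s) (x + (ε * T : ℝ) * Complex.I)) (by
        intro x hx
        rw [uIoc_of_le zero_le_one] at hx
        rw [eulerIntegrand, norm_mul, norm_mul, norm_exp_eulerPhase hε]
        have h1 := hb₁ (x + (ε * T : ℝ) * Complex.I) T (by linarith)
          ((by rw [habs]; exact hT : 1 ≤ |ε * T|).trans (norm_add_im_ge x _))
          ((norm_add_im_le hx.1.le).trans (by rw [habs]; linarith [hx.2]))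
        have h2 := hb₂ (1 - (x + (ε * T : ℝ) * Complex.I)) T (by linarith)
          (by rw [one_sub_add_im]; refine le_trans ?_ (norm_add_im_ge _ _); rw [abs_neg, habs]; exact hT)
          (by
            rw [one_sub_add_im]
            refine (norm_add_im_le (by linarith [hx.2])).trans ?_
            rw [abs_neg, habs]; linarith [hx.1])
        calc _ ≤ Real.exp (-(s * T)) * ((C₁ * Real.exp (1 / 64 * T)) * (C₂ * Real.exp (1 / 64 * T))) := by
              gcongr
          _ = C₁ * C₂ * Real.exp (-(s * T) + 1 / 64 * T + 1 / 64 * T) := by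
              rw [Real.exp_add, Real.exp_add]; ring
          _ ≤ _ := by
              gcongr
              nlinarith)
    simpa using this
  refine squeeze_zero_norm' (a := fun T => C₁ * C₂ * Real.exp (-(T / 32))) ?_ ?_
  · filter_upwards [eventually_ge_atTop 1] with T hT using hle T hT
  · have : Tendsto (fun T : ℝ => Real.exp (-(T / 32))) atTop (𝓝 0) :=
      Real.tendsto_exp_neg_atTop_nhds_zero.comp (tendsto_id.atTop_div_const (by norm_num))
    simpa using this.const_mul (C₁ * C₂)

/-- Dominated convergence. Since Re a − 1 ≤ 0, moving off the real axis only decreases |u|^{Re a−1},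
so x^{Re a−1} is a dominating function; since 2 − Re a ≥ 0, the other power is bounded. This is
where Re a ≤ 1 is needed. -/
theorem tendsto_eulerIntegrand_bottom {a : ℂ} (h0 : 0 < a.re) (h1 : a.re ≤ 1) {ε s : ℝ}
    (m : zoneHalf.mem ε s) :
    Tendsto (fun δ : ℝ => ∫ x in (0 : ℝ)..1, eulerIntegrand a (ε * s) (x + (ε * δ : ℝ) * Complex.I))
      (𝓝[>] 0) (𝓝 (fourierUnit (eulerWeight a) (ε * s))) := by
  obtain ⟨hε, hs⟩ := m
  have hcont : ∀ x ∈ Ioo (0 : ℝ) 1, ∀ δ : ℝ, ContinuousAt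
      (fun δ : ℝ => eulerIntegrand a (ε * s) (x + (ε * δ : ℝ) * Complex.I)) δ := by
    intro x hx δ
    have h2 : ContinuousAt (fun δ : ℝ => ((x : ℂ) + (ε * δ : ℝ) * Complex.I)) δ := by fun_prop
    refine ContinuousAt.comp (g := eulerIntegrand a (ε * s)) ?_ h2
    refine (differentiableAt_eulerIntegrand a _ (Or.inl ?_) (Or.inl ?_)).continuousAt
    · simpa using hx.1
    · simpa using hx.2
  refine intervalIntegral.tendsto_integral_filter_of_dominated_convergence
    (fun x : ℝ => 2 ^ (2 - a.re) * Real.exp (Real.pi * |a.im|) * Real.exp (Real.pi * |a.im|) *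
      x ^ (a.re - 1)) ?_ ?_ ?_ ?_
  · filter_upwards [self_mem_nhdsWithin] with δ hδ
    have hδ : 0 < δ := hδ
    refine Continuous.aestronglyMeasurable ?_
    rw [continuous_iff_continuousAt]
    intro x
    have h2 : ContinuousAt (fun x : ℝ => ((x : ℂ) + (ε * δ : ℝ) * Complex.I)) x := by fun_prop
    refine ContinuousAt.comp (g := eulerIntegrand a (ε * s)) ?_ h2
    have : ε ≠ 0 := by rcases hε with rfl | rfl <;> simp
    refine (differentiableAt_eulerIntegrand a _ (Or.inr ?_) (Or.inr ?_)).continuousAt <;>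
      simp [this, hδ.ne']
  · filter_upwards [Ioo_mem_nhdsGT (zero_lt_one' ℝ)] with δ hδ
    refine Eventually.of_forall fun x hx => ?_
    rw [uIoc_of_le zero_le_one] at hx
    have habs : |ε * δ| = δ := by rw [abs_mul, abs_of_sign hε, one_mul, abs_of_pos hδ.1]
    rw [eulerIntegrand, norm_mul, norm_mul, norm_exp_eulerPhase hε]
    have e1 : ‖((x : ℂ) + (ε * δ : ℝ) * Complex.I) ^ (a - 1)‖ ≤
        x ^ (a.re - 1) * Real.exp (Real.pi * |a.im|) := by
      refine (norm_cpow_le_rpow_mul_exp _ _).trans ?_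
      simp only [Complex.sub_re, Complex.one_re, Complex.sub_im, Complex.one_im, sub_zero]
      exact mul_le_mul_of_nonneg_right (Real.rpow_le_rpow_of_nonpos hx.1
        (norm_sub_add_ge hx.1.le) (by linarith)) (Real.exp_pos _).le
    have e2 : ‖(1 - ((x : ℂ) + (ε * δ : ℝ) * Complex.I)) ^ (2 - a)‖ ≤
        2 ^ (2 - a.re) * Real.exp (Real.pi * |a.im|) := by
      refine (norm_cpow_le_rpow_mul_exp _ _).trans ?_
      have e3 : ‖1 - ((x : ℂ) + (ε * δ : ℝ) * Complex.I)‖ ≤ 2 := by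
        rw [one_sub_add_im]
        refine (norm_add_im_le (by linarith [hx.2])).trans ?_
        rw [abs_neg, habs]; linarith [hx.1, hδ.2]
      have e4 : (2 - a).re = 2 - a.re := by simp
      have e5 : |(2 - a).im| = |a.im| := by simp
      rw [e4, e5]
      gcongr
      linarith
    calc _ ≤ 1 * ((x ^ (a.re - 1) * Real.exp (Real.pi * |a.im|)) *
          (2 ^ (2 - a.re) * Real.exp (Real.pi * |a.im|))) := by
          have : 0 ≤ x ^ (a.re - 1) := Real.rpow_nonneg hx.1.le _
          gcongr
          rw [Real.exp_le_one_iff]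
          have := hδ.1
          have : 0 < s * δ := by apply mul_pos _ this; linarith
          linarith
      _ = _ := by ring
  · exact (intervalIntegral.intervalIntegrable_rpow' (by linarith)).const_mul _
  · have : ∀ᵐ x : ℝ, x ≠ 1 := by simp [ae_iff]
    filter_upwards [this] with x hx1 hx
    rw [uIoc_of_le zero_le_one] at hx
    have h2 := (hcont x ⟨hx.1, lt_of_le_of_ne hx.2 hx1⟩ 0).tendsto
    have e : eulerIntegrand a (ε * s) (x + (ε * (0 : ℝ) : ℝ) * Complex.I) =
        Complex.exp (Complex.I * (ε * s : ℝ) * x) * eulerWeight a x := by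
      simp [eulerIntegrand, eulerWeight]
    rw [← e]
    exact h2.mono_left nhdsWithin_le_nhds

/-- Sending both ends to their limits along one sequence lets a single passage to the limit handle
the rectangle identity. -/
theorem tendsto_integral_expanding {H : ℝ → ℂ} (hH : IntegrableOn H (Ioi 0)) :
    Tendsto (fun n : ℕ => ∫ τ in (1 / ((n : ℝ) + 1))..((n : ℝ) + 1), H τ) atTop
      (𝓝 (∫ τ in Ioi (0 : ℝ), H τ)) := by
  have hT : Tendsto (fun n : ℕ => (n : ℝ) + 1) atTop atTop :=
    tendsto_atTop_add_const_right _ _ tendsto_natCast_atTop_atTop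
  have h1 := (intervalIntegral_tendsto_integral_Ioi 0 hH tendsto_id).comp hT
  have hii : ∀ x : ℝ, 0 ≤ x → IntervalIntegrable H volume 0 x := fun x hx => by
    rw [intervalIntegrable_iff, uIoc_of_le hx]
    exact hH.mono_set Ioc_subset_Ioi_self
  have h2 : Tendsto (fun n : ℕ => ∫ τ in (0 : ℝ)..(1 / ((n : ℝ) + 1)), H τ) atTop (𝓝 0) := by
    have hc := intervalIntegral.continuousOn_primitive_interval (a := (0 : ℝ)) (b := 1) (f := H)
      (μ := volume) (by
        rw [uIcc_of_le zero_le_one, integrableOn_Icc_iff_integrableOn_Ioc]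
        exact hH.mono_set Ioc_subset_Ioi_self)
    have hc0 := hc 0 left_mem_uIcc
    rw [ContinuousWithinAt, intervalIntegral.integral_same, uIcc_of_le zero_le_one] at hc0
    refine hc0.comp (tendsto_nhdsWithin_iff.2 ⟨tendsto_one_div_add_atTop_nhds_zero_nat,
      Eventually.of_forall fun n => ⟨by positivity, ?_⟩⟩)
    rw [div_le_one (by positivity)]
    linarith [(Nat.cast_nonneg n : (0 : ℝ) ≤ n)]
  have h3 := h1.sub h2
  rw [sub_zero] at h3
  refine h3.congr fun n => ?_
  simp only [Function.comp, id]
  rw [intervalIntegral.integral_interval_sub_left (hii _ (by positivity)) (hii _ (by positivity))]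

/-- The limit of the rectangle identity splits Euler's integral into the contributions of its end
points: u = 0 gives a pure symbol, u = 1 gives the oscillation. -/
theorem fourierUnit_eulerWeight_eq {a : ℂ} (h0 : 0 < a.re) (h1 : a.re ≤ 1) {ε s : ℝ}
    (m : zoneHalf.mem ε s) :
    fourierUnit (eulerWeight a) (ε * s) =
      (Complex.I * ε) ^ a * (∫ τ in Ioi (0 : ℝ), Complex.exp (-(s * τ)) *
        ((τ : ℂ) ^ (a - 1) * (1 + Complex.I * (-ε : ℝ) * τ) ^ (2 - a)))
      - Complex.I * ε * (-(Complex.I * ε)) ^ (2 - a) *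
        (Complex.exp (Complex.I * ε * s) * oscAmp a ε s) := by
  have hε := m.1
  obtain ⟨C, hb⟩ := exists_norm_cpow_mul_le (c := a - 1) (w := 2 - a)
  obtain ⟨C', hb'⟩ := exists_norm_cpow_mul_le (c := 2 - a) (w := a - 1)
  have hnε : (-ε = 1 ∨ -ε = -1) := by rcases hε with rfl | rfl <;> simp
  have i0 := laplace_integrable (c := (a - 1).re + 1) (by simp; linarith)
    (fun ε hε => continuousOn_cpow_mul (continuous_one_add_cpow _ _) _) hb
    (ε := -ε) (s := s) ⟨hnε, m.2⟩
  have i1 := laplace_integrable (c := (2 - a).re + 1) (by simp; linarith)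
    (fun ε hε => continuousOn_cpow_mul (continuous_one_add_cpow _ _) _) hb' m
  have e0 : EqOn (fun τ : ℝ => eulerIntegrand a (ε * s) ((ε * τ : ℝ) * Complex.I))
      (fun τ : ℝ => (Complex.I * ε) ^ (a - 1) * (Complex.exp (-(s * τ)) *
        ((τ : ℂ) ^ (a - 1) * (1 + Complex.I * (-ε : ℝ) * τ) ^ (2 - a)))) (Ioi 0) := by
    intro τ hτ
    simp only [eulerIntegrand_left a hε s hτ]
    ring
  have e1 : EqOn (fun τ : ℝ => eulerIntegrand a (ε * s) (1 + (ε * τ : ℝ) * Complex.I))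
      (fun τ : ℝ => Complex.exp (Complex.I * ε * s) * (-(Complex.I * ε)) ^ (2 - a) *
      (Complex.exp (-(s * τ)) * ((τ : ℂ) ^ (2 - a) * (1 + Complex.I * ε * τ) ^ (a - 1)))) (Ioi 0) :=
    fun τ hτ => eulerIntegrand_right a hε s hτ
  have l0 := tendsto_integral_expanding
    (IntegrableOn.congr_fun (i0.const_mul ((Complex.I * ε) ^ (a - 1))) e0.symm measurableSet_Ioi)
  have l1 := tendsto_integral_expanding
    (IntegrableOn.congr_fun (i1.const_mul (Complex.exp (Complex.I * ε * s) *
      (-(Complex.I * ε)) ^ (2 - a))) e1.symm measurableSet_Ioi)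
  rw [setIntegral_congr_fun measurableSet_Ioi e0, integral_const_mul] at l0
  rw [setIntegral_congr_fun measurableSet_Ioi e1, integral_const_mul] at l1
  have hT : Tendsto (fun n : ℕ => (n : ℝ) + 1) atTop atTop :=
    tendsto_atTop_add_const_right _ _ tendsto_natCast_atTop_atTop
  have l2 := (tendsto_eulerIntegrand_top a m).comp hT
  have hδ : Tendsto (fun n : ℕ => 1 / ((n : ℝ) + 1)) atTop (𝓝[>] 0) :=
    tendsto_nhdsWithin_iff.2 ⟨tendsto_one_div_add_atTop_nhds_zero_nat,
      Eventually.of_forall fun n => by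
        have : (0 : ℝ) < 1 / ((n : ℝ) + 1) := by positivity
        exact this⟩
  have l3 := (tendsto_eulerIntegrand_bottom h0 h1 m).comp hδ
  have key := ((l3.sub l2).add (l1.const_mul (Complex.I * ε))).sub (l0.const_mul (Complex.I * ε))
  have hz := tendsto_nhds_unique key (tendsto_const_nhds.congr fun n => by
    have := eulerIntegrand_rect a hε s (δ := 1 / ((n : ℝ) + 1)) (T := (n : ℝ) + 1) (by positivity) (by
      have : (0 : ℝ) ≤ n := Nat.cast_nonneg n
      rw [div_le_iff₀ (by positivity)]; nlinarith)
    exact this.symm)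
  have e2 : (Complex.I * ε : ℂ) ^ a = Complex.I * ε * (Complex.I * ε) ^ (a - 1) := by
    rw [Complex.cpow_sub _ _ (ne_zero_of_sign hε), Complex.cpow_one]
    exact (mul_div_cancel₀ _ (ne_zero_of_sign hε)).symm
  rw [e2, oscAmp]
  linear_combination hz

/-- `G(ρ)` is `M(a, 3, iρ)` with its asymptotic expansion: a classical symbol of order `-a` plus an
explicit oscillating part. -/
structure Confluent (a : ℂ) (G : ℝ → ℂ) : Prop where
  smooth : ContDiff ℝ ∞ G
  zero : G 0 = 1
  ode : ∀ ρ : ℝ, ρ * deriv (deriv G) ρ + (3 - Complex.I * ρ) * deriv G ρ - Complex.I * a * G ρ = 0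
  asymp : ∃ γ : ℕ → ℂ, ∃ b : ℝ → ℂ, γ 0 = 2 / Complex.Gamma (3 - a) ∧ ∀ n k : ℕ,
    Sym zoneHalf (fun _ s => s ^ (-a.re - n)) k (fun ε s => G (ε * s)
      - b ε * (Complex.exp (Complex.I * ε * s) * oscAmp a ε s)
      - ∑ j ∈ Finset.range n, γ j * (Complex.I * ε) ^ (a + j) * (s : ℂ) ^ (-a - j))

/-- Watson's lemma for the contribution of u = 0: the factor (1−iετ)^{2−a} is replaced by its
binomial polynomial, whose terms integrate to Gamma values, and its remainder O(τ^n) integrates to a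
symbol of order −Re a − n. The normalisation by the beta integral gives γ 0 through Γ(a)Γ(3−a) =
Γ(3)B(a, 3−a). -/
theorem confluent_of_re_le_one {a : ℂ} (h0 : 0 < a.re) (h1 : a.re ≤ 1) :
    Confluent a (fun ρ => (Complex.betaIntegral a (3 - a))⁻¹ * fourierUnit (eulerWeight a) ρ) := by
  have h3 : 0 < (3 - a).re := by simp; linarith
  have hB : Complex.Gamma a * Complex.Gamma (3 - a) = 2 * Complex.betaIntegral a (3 - a) := by
    rw [Complex.Gamma_mul_Gamma_eq_betaIntegral h0 h3, show a + (3 - a) = 2 + 1 by ring]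
    congr 1
    have := Complex.Gamma_nat_eq_factorial 2
    push_cast at this
    rw [this]; norm_num
  have hG0 := Complex.Gamma_ne_zero_of_re_pos h0
  have hG3 := Complex.Gamma_ne_zero_of_re_pos h3
  have hB0 : Complex.betaIntegral a (3 - a) ≠ 0 := by
    intro h
    rw [h, mul_zero] at hB
    exact mul_ne_zero hG0 hG3 hB
  have hw := intervalIntegrable_eulerWeight h0 (by linarith)
  have hsm := contDiff_fourierUnit hw
  refine ⟨contDiff_const.mul hsm, ?_, fun ρ => ?_, ?_⟩
  · rw [fourierUnit_eulerWeight_zero, inv_mul_cancel₀ hB0]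
  · have e1 : deriv (fun ρ => (Complex.betaIntegral a (3 - a))⁻¹ * fourierUnit (eulerWeight a) ρ) =
        fun ρ => (Complex.betaIntegral a (3 - a))⁻¹ * deriv (fourierUnit (eulerWeight a)) ρ :=
      funext fun ρ => deriv_const_mul_field _
    rw [e1, deriv_const_mul_field]
    linear_combination (Complex.betaIntegral a (3 - a))⁻¹ *
      fourierUnit_eulerWeight_ode h0 (by linarith) ρ
  · set B := Complex.betaIntegral a (3 - a) with hBdef
    refine ⟨fun j => B⁻¹ * (binomCoeff (2 - a) j * (-1) ^ j * Complex.Gamma (a + j)),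
      fun ε => -(B⁻¹ * (Complex.I * ε * (-(Complex.I * ε)) ^ (2 - a))), ?_, fun n k => ?_⟩
    · simp only [binomCoeff, pow_zero, mul_one, one_mul, Nat.cast_zero, add_zero]
      field_simp
      linear_combination hB
    obtain ⟨C, hC, hR⟩ := exists_norm_one_add_cpow_sub_le (2 - a) n
    set R : ℝ → ℝ → ℂ := fun ε τ => (1 + Complex.I * (-ε : ℝ) * τ) ^ (2 - a)
      - ∑ j ∈ Finset.range n, binomCoeff (2 - a) j * (Complex.I * (-ε : ℝ) * τ) ^ j with hRdef
    have hRc : ∀ ε, Continuous (R ε) := fun ε =>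
      (continuous_one_add_cpow (2 - a) (-ε)).sub (by fun_prop)
    have hRb : ∀ ε, (ε = 1 ∨ ε = -1) → ∀ τ : ℝ, 0 < τ →
        ‖(τ : ℂ) ^ (a - 1) * R ε τ‖ ≤ C * (τ ^ (a.re + n - 1) * Real.exp (τ / 32)) := by
      intro ε hε τ hτ
      have hnε : (-ε = 1 ∨ -ε = -1) := by rcases hε with rfl | rfl <;> simp
      rw [norm_mul, Complex.norm_cpow_eq_rpow_re_of_pos hτ]
      calc _ ≤ τ ^ (a - 1).re * (C * (τ ^ n * Real.exp (τ / 32))) := by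
            gcongr; exact hR (-ε) τ hnε hτ.le
        _ = C * (τ ^ ((a - 1).re + n) * Real.exp (τ / 32)) := by
            rw [Real.rpow_add hτ, Real.rpow_natCast]; ring
        _ = _ := by
            rw [show (a - 1).re + n = a.re + n - 1 by simp; ring]
    have hcn : 0 < a.re + n := by positivity
    have hS := Sym.laplace (k := k) hcn (h := fun ε τ => (τ : ℂ) ^ (a - 1) * R ε τ)
      (fun ε hε => continuousOn_cpow_mul (hRc ε) _) hRb
    have hS2 : Sym zoneHalf (fun ε _ => 1) k (fun ε _ => B⁻¹ * (Complex.I * ε) ^ a) := by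
      refine Sym.of_time (b := fun _ => 1) (max ‖B⁻¹ * (Complex.I * (1 : ℝ)) ^ a‖
        ‖B⁻¹ * (Complex.I * (-1 : ℝ)) ^ a‖) (by positivity) fun ε r m => ?_
      rcases m.1 with rfl | rfl
      · rw [mul_one]; exact le_max_left _ _
      · rw [mul_one]; exact le_max_right _ _
    refine ((hS2.mul hS).weight_congr fun ε s m => ?_).congr fun ε s m => ?_
    · rw [one_mul]; congr 1; ring
    · have hs : 0 < s := zoneHalf.pos m
      have hiR := laplace_integrable hcn (h := fun ε τ => (τ : ℂ) ^ (a - 1) * R ε τ)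
        (fun ε hε => continuousOn_cpow_mul (hRc ε) _) hRb m
      have hterm : ∀ j : ℕ, IntegrableOn (fun τ : ℝ => Complex.exp (-(s * τ)) *
          ((τ : ℂ) ^ (a - 1) * (binomCoeff (2 - a) j * (Complex.I * (-ε : ℝ) * τ) ^ j))) (Ioi 0) ∧
          ∫ τ in Ioi (0 : ℝ), Complex.exp (-(s * τ)) *
          ((τ : ℂ) ^ (a - 1) * (binomCoeff (2 - a) j * (Complex.I * (-ε : ℝ) * τ) ^ j)) =
          binomCoeff (2 - a) j * (-1) ^ j * (Complex.I * ε) ^ j * Complex.Gamma (a + j)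
            * (s : ℂ) ^ (-a - j) := by
        intro j
        have haj : 0 < (a + j).re := by simp; positivity
        have heq : EqOn (fun τ : ℝ => Complex.exp (-(s * τ)) *
          ((τ : ℂ) ^ (a - 1) * (binomCoeff (2 - a) j * (Complex.I * (-ε : ℝ) * τ) ^ j)))
          (fun τ : ℝ => binomCoeff (2 - a) j * (-1) ^ j * (Complex.I * ε) ^ j *
            ((τ : ℂ) ^ (a + j - 1) * Complex.exp (-(s * τ)))) (Ioi 0) := by
          intro τ hτ
          have hτ0 : (τ : ℂ) ≠ 0 := by exact_mod_cast (ne_of_gt hτ)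
          have : (τ : ℂ) ^ (a + j - 1) = τ ^ (a - 1) * τ ^ j := by
            rw [show a + j - 1 = a - 1 + j by ring, Complex.cpow_add _ _ hτ0, Complex.cpow_natCast]
          simp only [this]
          rw [mul_pow, show Complex.I * ((-ε : ℝ) : ℂ) = (-1) * (Complex.I * ε) by push_cast; ring,
            mul_pow]
          ring
        have hint : IntegrableOn (fun τ : ℝ => (τ : ℂ) ^ (a + j - 1) * Complex.exp (-(s * τ)))
            (Ioi 0) := by
          have := laplace_integrable (c := (a + j).re) haj
            (h := fun _ τ => (τ : ℂ) ^ (a + j - 1) * 1) (C := 1)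
            (fun ε hε => continuousOn_cpow_mul continuous_const _) (fun ε hε τ hτ => by
              rw [mul_one, Complex.norm_cpow_eq_rpow_re_of_pos hτ, one_mul, Complex.sub_re,
                Complex.one_re]
              exact le_mul_of_one_le_right (by positivity) (Real.one_le_exp (by positivity))) m
          refine this.congr_fun (fun τ _ => ?_) measurableSet_Ioi
          ring
        constructor
        · exact IntegrableOn.congr_fun (hint.const_mul _) heq.symm measurableSet_Ioi
        · rw [setIntegral_congr_fun measurableSet_Ioi heq, integral_const_mul,
            Complex.integral_cpow_mul_exp_neg_mul_Ioi haj (by simpa using hs)]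
          have : (1 / (s : ℂ)) ^ (a + j) = (s : ℂ) ^ (-a - j) := by
            rw [one_div, Complex.inv_cpow _ _ (by
              rw [Complex.arg_ofReal_of_nonneg hs.le]; exact Real.pi_pos.ne),
              ← Complex.cpow_neg]
            congr 1; ring
          rw [this]; ring
      have hsum : ∫ τ in Ioi (0 : ℝ), Complex.exp (-(s * τ)) *
          ((τ : ℂ) ^ (a - 1) * (1 + Complex.I * (-ε : ℝ) * τ) ^ (2 - a)) =
          (∫ τ in Ioi (0 : ℝ), Complex.exp (-(s * τ)) * ((τ : ℂ) ^ (a - 1) * R ε τ)) +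
          ∑ j ∈ Finset.range n, binomCoeff (2 - a) j * (-1) ^ j * (Complex.I * ε) ^ j *
            Complex.Gamma (a + j) * (s : ℂ) ^ (-a - j) := by
        rw [Finset.sum_congr rfl fun j _ => (hterm j).2.symm,
          ← integral_finsetSum _ fun j _ => (hterm j).1,
          ← integral_add hiR (integrable_finsetSum _ fun j _ => (hterm j).1)]
        congr 1
        ext τ
        rw [← Finset.mul_sum, ← Finset.mul_sum, hRdef]
        ring
      rw [fourierUnit_eulerWeight_eq h0 h1 m, hsum]
      have hp : ∀ j : ℕ, (Complex.I * ε : ℂ) ^ (a + j) = (Complex.I * ε) ^ a * (Complex.I * ε) ^ j :=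
        fun j => by rw [Complex.cpow_add _ _ (ne_zero_of_sign m.1), Complex.cpow_natCast]
      have hs2 : ∑ j ∈ Finset.range n, B⁻¹ * (binomCoeff (2 - a) j * (-1) ^ j *
          Complex.Gamma (a + j)) * (Complex.I * ε) ^ (a + j) * (s : ℂ) ^ (-a - j) =
          B⁻¹ * (Complex.I * ε) ^ a * ∑ j ∈ Finset.range n, binomCoeff (2 - a) j * (-1) ^ j *
            (Complex.I * ε) ^ j * Complex.Gamma (a + j) * (s : ℂ) ^ (-a - j) := by
        rw [Finset.mul_sum]
        refine Finset.sum_congr rfl fun j _ => ?_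
        rw [hp]; ring
      rw [hs2]
      ring

/-! ### Lowering the parameter by the contiguous relation -/

theorem Sym.of_sign {f : ℝ → ℂ} {k : ℕ} : Sym zoneHalf (fun _ _ => 1) k (fun ε _ => f ε) := by
  refine Sym.of_time (b := fun _ => 1) (max ‖f 1‖ ‖f (-1)‖) (by positivity) fun ε r m => ?_
  rcases m.1 with rfl | rfl
  · rw [mul_one]; exact le_max_left _ _
  · rw [mul_one]; exact le_max_right _ _

/-- The multiplication by s costs one power of s; the other terms are lower order because s > 1/16.
-/
theorem Sym.contiguous {F : ℝ → ℝ → ℂ} {p : ℝ} {k : ℕ} (c : ℂ)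
    (hF : Sym zoneHalf (fun _ s => s ^ p) (k + 1) F) :
    Sym zoneHalf (fun _ s => s ^ (p + 1)) k
      (fun ε s => (c - Complex.I * ε * s) * F ε s + CSS.rdr (F ε) s) := by
  have hle : ∀ ε s, zoneHalf.mem ε s → s ^ p ≤ 16 * s ^ (p + 1) := by
    intro ε s m
    have hs := zoneHalf.pos m
    rw [Real.rpow_add_one hs.ne']
    have : 0 < s ^ p := by positivity
    nlinarith [m.2]
  have h1 : Sym zoneHalf (fun _ s => s ^ (p + 1)) k (fun ε s => c * F ε s) :=
    ((hF.of_le k.le_succ).const_mul c).mono (by norm_num) hle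
  have h2 : Sym zoneHalf (fun _ s => s ^ (p + 1)) k (fun ε s => Complex.I * ε * (s : ℂ) * F ε s) := by
    refine (((Sym.of_sign (f := fun ε => Complex.I * ε)).mul (Sym.cpow 1)).mul
      (hF.of_le k.le_succ)).weight_congr (fun ε s m => ?_) |>.congr fun ε s m => ?_
    · rw [Complex.one_re, Real.rpow_one, Real.rpow_add_one (zoneHalf.pos m).ne']; ring
    · simp only [Complex.cpow_one]
  exact ((h1.sub h2).add (hF.rdr.mono (by norm_num) hle)).congr fun ε s m => by ring

theorem hasDerivAt_exp_I (ε s : ℝ) : HasDerivAt (fun s : ℝ => Complex.exp (Complex.I * ε * s))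
    (Complex.exp (Complex.I * ε * s) * (Complex.I * ε)) s := by
  have h1 : HasDerivAt (fun x : ℝ => Complex.I * ε * (x : ℂ)) (Complex.I * ε * 1) s :=
    ((hasDerivAt_id (s : ℂ)).comp_ofReal).const_mul _
  exact h1.cexp.congr_deriv (by ring)

/-- This is (b−a) M(a−1, b, x) = (b−a−x) M(a, b, x) + x M'(a, b, x) with b = 3 and x = iρ. The same
operator sends the oscillating part for a to a multiple of the one for a − 1, by `rdr_oscAmp`, and
acts termwise on the powers of s. -/
theorem Confluent.contiguous {a : ℂ} {G : ℝ → ℂ} (h : Confluent a G) (ha : a.re < 3) :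
    Confluent (a - 1) (fun ρ : ℝ => (3 - a)⁻¹ * ((3 - a - Complex.I * ρ) * G ρ + ρ * deriv G ρ)) := by
  have hc : 3 - a ≠ 0 := fun h => by
    have := congrArg Complex.re h; simp at this; linarith
  have hsm := h.smooth
  have hsm1 : ContDiff ℝ ∞ (deriv G) := (contDiff_infty_iff_deriv.1 hsm).2
  have hd : ∀ ρ, HasDerivAt G (deriv G ρ) ρ := fun ρ =>
    (hsm.differentiable (by simp) ρ).hasDerivAt
  have hd1 : ∀ ρ, HasDerivAt (deriv G) (deriv (deriv G) ρ) ρ := fun ρ =>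
    (hsm1.differentiable (by simp) ρ).hasDerivAt
  refine ⟨?_, ?_, fun ρ => ?_, ?_⟩
  · refine contDiff_const.mul (((contDiff_const.sub ?_).mul hsm).add
      (Complex.ofRealCLM.contDiff.mul hsm1))
    exact contDiff_const.mul Complex.ofRealCLM.contDiff
  · simp [h.zero, hc]
  · have hN : ∀ ρ : ℝ, HasDerivAt (fun ρ : ℝ =>
        (3 - a)⁻¹ * ((3 - a - Complex.I * ρ) * G ρ + ρ * deriv G ρ))
        ((3 - a)⁻¹ * (Complex.I * (a - 1) * G ρ + (1 - a) * deriv G ρ)) ρ := by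
      intro ρ
      have h1 : HasDerivAt (fun ρ : ℝ => 3 - a - Complex.I * (ρ : ℂ)) (-(Complex.I * 1)) ρ :=
        (((hasDerivAt_id (ρ : ℂ)).comp_ofReal).const_mul _).const_sub _
      have h2 : HasDerivAt (fun ρ : ℝ => (ρ : ℂ)) 1 ρ := (hasDerivAt_id (ρ : ℂ)).comp_ofReal
      refine (((h1.mul (hd ρ)).add (h2.mul (hd1 ρ))).const_mul _).congr_deriv ?_
      linear_combination (3 - a)⁻¹ * h.ode ρ
    have hN2 : ∀ ρ : ℝ, HasDerivAt (fun ρ : ℝ =>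
        (3 - a)⁻¹ * (Complex.I * (a - 1) * G ρ + (1 - a) * deriv G ρ))
        ((3 - a)⁻¹ * (Complex.I * (a - 1) * deriv G ρ + (1 - a) * deriv (deriv G) ρ)) ρ := fun ρ =>
      (((hd ρ).const_mul _).add ((hd1 ρ).const_mul _)).const_mul _
    rw [show deriv (fun ρ : ℝ => (3 - a)⁻¹ * ((3 - a - Complex.I * ρ) * G ρ + ρ * deriv G ρ)) = _ from
      funext fun ρ => (hN ρ).deriv, (hN2 ρ).deriv]
    linear_combination (3 - a)⁻¹ * (1 - a) * h.ode ρ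
  · obtain ⟨γ, b, hγ, hA⟩ := h.asymp
    -- Applied to the j-th power, the factor −iεs gives the j-th power for a − 1, because (iε)² =
    -- −1; the remaining part (3−a) + (−a−j) gives the power with index j + 1.
    set γ' : ℕ → ℂ := fun j => (3 - a)⁻¹ * Nat.casesOn j (γ 0)
      (fun i => γ (i + 1) + (3 - 2 * a - i) * γ i) with hγ'
    refine ⟨γ', fun ε => (3 - a)⁻¹ * (-(a - 1) * (Complex.I * ε) * b ε), ?_, fun n k => ?_⟩
    · have hG := Complex.Gamma_add_one (3 - a) hc
      rw [show (3 : ℂ) - (a - 1) = 3 - a + 1 by ring, hG]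
      simp only [hγ', hγ]
      rw [mul_comm (3 - a), ← div_div, div_eq_mul_inv, mul_comm]
      rfl
    · set e : ℕ → ℝ → ℝ → ℂ := fun j ε s =>
        (Complex.I * ε) ^ (a - 1 + j) * (s : ℂ) ^ (-(a - 1) - j) with he
      have hse : ∀ j k : ℕ, Sym zoneHalf (fun _ s => s ^ (1 - a.re - j)) k (e j) := by
        intro j k
        refine ((Sym.of_sign (f := fun ε => (Complex.I * ε) ^ (a - 1 + j))).mul
          (Sym.cpow (-(a - 1) - j))).weight_congr fun ε s m => ?_
        rw [one_mul]; congr 1; simp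
      -- One more term and one more derivative than required, since the operator consumes one of
      -- each. The surplus terms of index n and n + 1 are returned to the remainder below.
      have h1 := Sym.contiguous (3 - a) (hA (n + 1) (k + 1))
      have h1' : Sym zoneHalf (fun _ s => s ^ (-(a - 1).re - n)) k _ := h1.weight_congr (v :=
        fun _ s => s ^ (-a.re - n)) (fun ε s m => by congr 1; push_cast; ring) |>.mono
          (D := 16) (by norm_num) fun ε s m => by
            have hs := zoneHalf.pos m
            rw [show -(a - 1).re - (n : ℝ) = -a.re - n + 1 by simp; ring, Real.rpow_add_one hs.ne']
            have : 0 < s ^ (-a.re - n) := by positivity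
            nlinarith [m.2]
      have h2 : Sym zoneHalf (fun _ s => s ^ (-(a - 1).re - n)) k (e n) :=
        (hse n k).weight_congr fun ε s m => by congr 1; simp
      have h3 : Sym zoneHalf (fun _ s => s ^ (-(a - 1).re - n)) k (e (n + 1)) :=
        (hse (n + 1) k).mono (D := 16) (by norm_num) fun ε s m => by
          have hs := zoneHalf.pos m
          rw [show -(a - 1).re - (n : ℝ) = 1 - a.re - (n + 1 : ℕ) + 1 by simp; ring,
            Real.rpow_add_one hs.ne']
          have : 0 < s ^ (1 - a.re - (n + 1 : ℕ)) := by positivity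
          nlinarith [m.2]
      refine (((h1'.const_mul (3 - a)⁻¹).add (h3.const_mul ((3 - a)⁻¹ * ((3 - 2 * a - n) * γ n)))).add
        (h2.const_mul (γ' n))).congr fun ε s m => ?_
      have hs := zoneHalf.pos m
      have hs0 : (s : ℂ) ≠ 0 := by exact_mod_cast hs.ne'
      have hε0 := ne_zero_of_sign m.1
      -- the derivative of the remainder
      have d1 : HasDerivAt (fun s : ℝ => G (ε * s)) (ε • deriv G (ε * s)) s := by
        have := HasDerivAt.scomp s (hd (ε * s)) ((hasDerivAt_id' s).const_mul ε)
        rw [mul_one] at this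
        exact this
      have d2 := ((sym_oscAmp ha 1).diff m).hasDerivAt
      have d3 := ((hasDerivAt_exp_I ε s).mul d2).const_mul (b ε)
      have d4 : HasDerivAt (fun s : ℝ => ∑ j ∈ Finset.range (n + 1),
          γ j * (Complex.I * ε) ^ (a + j) * (s : ℂ) ^ (-a - j))
          (∑ j ∈ Finset.range (n + 1), γ j * (Complex.I * ε) ^ (a + j) *
            ((-a - j) * (s : ℂ) ^ (-a - j - 1))) s :=
        HasDerivAt.fun_sum fun j _ => (hasDerivAt_ofReal_cpow_of_pos _ hs).const_mul _
      have d5 := ((d1.sub d3).sub d4).deriv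
      have hosc := rdr_oscAmp ha m
      rw [CSS.rdr] at hosc
      have ej : ∀ j : ℕ, e j ε s = -(Complex.I * ε * s) *
          ((Complex.I * ε) ^ (a + j) * (s : ℂ) ^ (-a - j)) := by
        intro j
        have e1 : (Complex.I * ε) ^ (a + j) = Complex.I * ε * (Complex.I * ε) ^ (a - 1 + j) := by
          rw [show a + j = 1 + (a - 1 + j) by ring, Complex.cpow_add _ _ hε0, Complex.cpow_one]
        have e2 : (s : ℂ) ^ (-(a - 1) - j) = s * (s : ℂ) ^ (-a - j) := by
          rw [show -(a - 1) - (j : ℂ) = 1 + (-a - j) by ring, Complex.cpow_add _ _ hs0,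
            Complex.cpow_one]
        simp only [he]
        rw [e1, e2]
        linear_combination (s * (Complex.I * ε) ^ (a - 1 + j) * (s : ℂ) ^ (-a - j)) *
          I_mul_sign_sq m.1
      have ej1 : ∀ j : ℕ, e (j + 1) ε s = (Complex.I * ε) ^ (a + j) * (s : ℂ) ^ (-a - j) := by
        intro j
        simp only [he]
        congr 2 <;> push_cast <;> ring
      have hsum : (3 - a - Complex.I * ε * s) * (∑ j ∈ Finset.range (n + 1),
            γ j * (Complex.I * ε) ^ (a + j) * (s : ℂ) ^ (-a - j)) +
          s * ∑ j ∈ Finset.range (n + 1), γ j * (Complex.I * ε) ^ (a + j) *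
            ((-a - j) * (s : ℂ) ^ (-a - j - 1)) =
          (3 - a) * (∑ j ∈ Finset.range n, γ' j * e j ε s) + (3 - a) * (γ' n * e n ε s) +
          (3 - 2 * a - n) * γ n * e (n + 1) ε s := by
        have l1 : (3 - a - Complex.I * ε * s) * (∑ j ∈ Finset.range (n + 1),
            γ j * (Complex.I * ε) ^ (a + j) * (s : ℂ) ^ (-a - j)) +
          s * ∑ j ∈ Finset.range (n + 1), γ j * (Complex.I * ε) ^ (a + j) *
            ((-a - j) * (s : ℂ) ^ (-a - j - 1)) =
            (∑ j ∈ Finset.range (n + 1), γ j * e j ε s) +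
            ∑ j ∈ Finset.range (n + 1), (3 - 2 * a - j) * γ j * e (j + 1) ε s := by
          rw [Finset.mul_sum, Finset.mul_sum, ← Finset.sum_add_distrib, ← Finset.sum_add_distrib]
          refine Finset.sum_congr rfl fun j _ => ?_
          rw [ej, ej1, Complex.cpow_sub _ 1 hs0, Complex.cpow_one]
          field_simp
          ring
        have l2 : (3 - a) * (∑ j ∈ Finset.range n, γ' j * e j ε s) + (3 - a) * (γ' n * e n ε s) =
            (∑ j ∈ Finset.range (n + 1), γ j * e j ε s) +
            ∑ j ∈ Finset.range n, (3 - 2 * a - j) * γ j * e (j + 1) ε s := by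
          rw [← mul_add, ← Finset.sum_range_succ (fun j => γ' j * e j ε s), Finset.sum_range_succ',
            Finset.sum_range_succ' (fun j => γ j * e j ε s)]
          have g0 : (3 - a) * γ' 0 = γ 0 := mul_inv_cancel_left₀ hc _
          have gs : ∀ i, (3 - a) * γ' (i + 1) = γ (i + 1) + (3 - 2 * a - i) * γ i :=
            fun i => mul_inv_cancel_left₀ hc _
          rw [mul_add, ← mul_assoc, g0, Finset.mul_sum]
          simp only [← mul_assoc, gs, add_mul, Finset.sum_add_distrib]
          ring
        rw [l1, l2, Finset.sum_range_succ (fun j : ℕ => (3 - 2 * a - (j : ℂ)) * γ j * e (j + 1) ε s)]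
        ring
      have hrdr : CSS.rdr (fun s : ℝ => G (ε * s)
          - b ε * (Complex.exp (Complex.I * ε * s) * oscAmp a ε s)
          - ∑ j ∈ Finset.range (n + 1), γ j * (Complex.I * ε) ^ (a + j) * (s : ℂ) ^ (-a - j)) s =
          s * (ε • deriv G (ε * s) - b ε * (Complex.exp (Complex.I * ε * s) * (Complex.I * ε) *
            oscAmp a ε s + Complex.exp (Complex.I * ε * s) * deriv (oscAmp a ε) s) -
            ∑ j ∈ Finset.range (n + 1), γ j * (Complex.I * ε) ^ (a + j) *
              ((-a - j) * (s : ℂ) ^ (-a - j - 1))) := by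
        rw [CSS.rdr]
        congr 1
      rw [hrdr]
      have hfin : ∑ j ∈ Finset.range n, γ' j * (Complex.I * ε) ^ (a - 1 + j) *
          (s : ℂ) ^ (-(a - 1) - j) = ∑ j ∈ Finset.range n, γ' j * e j ε s :=
        Finset.sum_congr rfl fun j _ => by simp only [he]; ring
      rw [hfin, Complex.real_smul]
      have hcc : (3 - a)⁻¹ * (3 - a) = 1 := inv_mul_cancel₀ hc
      push_cast
      linear_combination (-(3 - a)⁻¹) * hsum - (3 - a)⁻¹ * b ε * Complex.exp (Complex.I * ε * s) * hosc
        + (-(∑ j ∈ Finset.range n, γ' j * e j ε s) - γ' n * e n ε s) * hcc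

/-- Euler's integral covers 0 < Re a ≤ 1; every a with smaller real part is reached by integer steps
down. -/
theorem exists_confluent {a : ℂ} (ha : a.re ≤ 1) : ∃ G, Confluent a G := by
  have key : ∀ (n : ℕ) (a : ℂ), 0 < a.re + n → a.re + n ≤ 1 → ∃ G, Confluent a G := by
    intro n
    induction n with
    | zero => exact fun a h0 h1 => ⟨_, confluent_of_re_le_one (by simpa using h0) (by simpa using h1)⟩
    | succ n ih =>
      intro a h0 h1
      push_cast at h0 h1
      obtain ⟨G, hG⟩ := ih (a + 1) (by simp; linarith) (by simp; linarith)
      have := hG.contiguous (by simp; linarith [(Nat.cast_nonneg n : (0 : ℝ) ≤ n)])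
      rw [add_sub_cancel_right] at this
      exact ⟨_, this⟩
  -- This is the number of steps n for which Re a + n lies in (0, 1].
  refine key ⌊1 - a.re⌋₊ a ?_ ?_
  · linarith [Nat.lt_floor_add_one (1 - a.re)]
  · linarith [Nat.floor_le (sub_nonneg.2 ha)]

/-! ### Weights and zones -/

/-- The weight `r^a (|t| / r²)^κ`. -/
def pw (a κ t r : ℝ) : ℝ := r ^ a * (|t| / r ^ 2) ^ κ

/-- All radii below `3`. -/
def zoneAll : Zone where
  mem t r := (t ≠ 0 ∧ |t| ≤ 1) ∧ 0 < r ∧ r < 3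
  isOpen_slice _ := isOpen_const.inter (isOpen_Ioi.inter isOpen_Iio)
  pos m := m.2.1

/-- The self-similar zone. -/
def zoneNear : Zone where
  mem t r := (t ≠ 0 ∧ |t| ≤ 1) ∧ 0 < r ∧ r < √|t|
  isOpen_slice _ := isOpen_const.inter (isOpen_Ioi.inter isOpen_Iio)
  pos m := m.2.1

/-- The outer zone, with some room towards the self-similar zone. -/
def zoneFar : Zone where
  mem t r := (t ≠ 0 ∧ |t| ≤ 1) ∧ √|t| / 2 < r ∧ r < 3
  isOpen_slice _ := isOpen_const.inter (isOpen_Ioi.inter isOpen_Iio)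
  pos m := lt_of_le_of_lt (by positivity) m.2.1

theorem zoneNear_le_one {t r : ℝ} (m : zoneNear.mem t r) : r < 1 :=
  m.2.2.trans_le (Real.sqrt_le_one.2 m.1.2)

theorem zoneNear_all {t r : ℝ} (m : zoneNear.mem t r) : zoneAll.mem t r :=
  ⟨m.1, m.2.1, (zoneNear_le_one m).trans (by norm_num)⟩

theorem zoneFar_all {t r : ℝ} (m : zoneFar.mem t r) : zoneAll.mem t r :=
  ⟨m.1, zoneFar.pos m, m.2.2⟩

theorem zoneAll_near_or_far {t r : ℝ} (m : zoneAll.mem t r) : zoneNear.mem t r ∨ zoneFar.mem t r := by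
  have : 0 < √|t| := Real.sqrt_pos.2 (abs_pos.2 m.1.1)
  rcases lt_or_ge r (√|t|) with h | h
  · exact Or.inl ⟨m.1, m.2.1, h⟩
  · exact Or.inr ⟨m.1, by linarith, m.2.2⟩

section pw

variable {a b κ l t r : ℝ}

theorem pw_pos (ht : t ≠ 0) (hr : 0 < r) : 0 < pw a κ t r := by
  have := abs_pos.2 ht
  unfold pw; positivity

theorem pw_mul (ht : t ≠ 0) (hr : 0 < r) : pw a κ t r * pw b l t r = pw (a + b) (κ + l) t r := by
  have := abs_pos.2 ht
  rw [pw, pw, pw, Real.rpow_add hr, Real.rpow_add (by positivity)]; ring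

theorem pw_zero_right : pw a 0 t r = r ^ a := by simp [pw]

theorem pw_zero_left : pw 0 κ t r = (|t| / r ^ 2) ^ κ := by simp [pw]

theorem pw_eq (hr : 0 < r) : pw a κ t r = |t| ^ κ * r ^ (a - 2 * κ) := by
  rw [pw, Real.div_rpow (abs_nonneg t) (by positivity), ← Real.rpow_natCast, ← Real.rpow_mul hr.le,
    Real.rpow_sub hr]
  push_cast; ring

theorem pw_two_mul (hr : 0 < r) : pw (2 * κ) κ t r = |t| ^ κ := by
  rw [pw_eq hr]; simp

theorem zoneNear_one_le (m : zoneNear.mem t r) : 1 ≤ |t| / r ^ 2 := by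
  have hr := zoneNear.pos m
  rw [le_div_iff₀ (by positivity), one_mul]
  have := Real.sq_sqrt (abs_nonneg t)
  nlinarith [m.2.2, Real.sqrt_nonneg |t|]

theorem zoneFar_le_four (m : zoneFar.mem t r) : |t| / r ^ 2 ≤ 4 := by
  have hr := zoneFar.pos m
  rw [div_le_iff₀ (by positivity)]
  have := Real.sq_sqrt (abs_nonneg t)
  nlinarith [m.2.1, Real.sqrt_nonneg |t|]

theorem pw_near_mono (m : zoneNear.mem t r) (h : κ ≤ l) : pw a κ t r ≤ pw a l t r := by
  have hr := zoneNear.pos m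
  unfold pw
  gcongr
  exact zoneNear_one_le m

/-- At these exponents the weight is |t|^{a/2−c} r^{2c}: the power of r is fixed and |t| ≤ 1 makes
the larger a the stronger bound. -/
theorem pw_near_scale (c : ℝ) (m : zoneNear.mem t r) (h : b ≤ a) :
    pw a (a / 2 - c) t r ≤ pw b (b / 2 - c) t r := by
  have hr := zoneNear.pos m
  rw [pw_eq hr, pw_eq hr, show a - 2 * (a / 2 - c) = 2 * c by ring,
    show b - 2 * (b / 2 - c) = 2 * c by ring]
  gcongr ?_ * _
  exact Real.rpow_le_rpow_of_exponent_ge (abs_pos.2 m.1.1) m.1.2 (by linarith)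

theorem rpow_le_of_le_three {r : ℝ} (hr : 0 < r) (hr3 : r ≤ 3) (h : b ≤ a) :
    r ^ a ≤ 3 ^ (a - b) * r ^ b := by
  calc r ^ a = r ^ (a - b) * r ^ b := by rw [← Real.rpow_add hr]; congr 1; ring
    _ ≤ _ := by gcongr

/-- The order in κ is opposite to that of the self-similar zone: here |t|/r² ≤ 4, so a larger κ is
stronger, and r < 3 makes a larger a stronger. -/
theorem pw_far_mono (m : zoneFar.mem t r) (h : b ≤ a) (h' : l ≤ κ) :
    pw a κ t r ≤ (3 ^ (a - b) * 4 ^ (κ - l)) * pw b l t r := by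
  have hr := zoneFar.pos m
  have ht := abs_pos.2 m.1.1
  have h1 : (|t| / r ^ 2) ^ κ ≤ 4 ^ (κ - l) * (|t| / r ^ 2) ^ l := by
    calc (|t| / r ^ 2) ^ κ = (|t| / r ^ 2) ^ (κ - l) * (|t| / r ^ 2) ^ l := by
          rw [← Real.rpow_add (by positivity)]; congr 1; ring
      _ ≤ _ := by
        gcongr
        exact zoneFar_le_four m
  calc pw a κ t r ≤ (3 ^ (a - b) * r ^ b) * (4 ^ (κ - l) * (|t| / r ^ 2) ^ l) :=
        mul_le_mul (rpow_le_of_le_three hr m.2.2.le h) h1 (by positivity) (by positivity)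
    _ = _ := by rw [pw]; ring

end pw

section Sym

variable {f g : ℝ → ℝ → ℂ} {a b κ l : ℝ} {k : ℕ}

theorem Sym.far_mono (hf : Sym zoneFar (pw a κ) k f) (h : b ≤ a) (h' : l ≤ κ) :
    Sym zoneFar (pw b l) k f :=
  hf.mono (by positivity) fun _ _ m => pw_far_mono m h h'

theorem Sym.near_mono (hf : Sym zoneNear (pw a κ) k f) (h : κ ≤ l) : Sym zoneNear (pw a l) k f :=
  hf.mono zero_le_one fun _ _ m => by rw [one_mul]; exact pw_near_mono m h

theorem Sym.near_scale (c : ℝ) (hf : Sym zoneNear (pw a (a / 2 - c)) k f) (h : b ≤ a) :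
    Sym zoneNear (pw b (b / 2 - c)) k f :=
  hf.mono zero_le_one fun _ _ m => by rw [one_mul]; exact pw_near_scale c m h

theorem Sym.far_mul (hf : Sym zoneFar (pw a κ) k f) (hg : Sym zoneFar (pw b l) k g) :
    Sym zoneFar (pw (a + b) (κ + l)) k (fun t r => f t r * g t r) :=
  (hf.mul hg).weight_congr fun _ _ m => pw_mul m.1.1 (zoneFar.pos m)

theorem Sym.near_mul (hf : Sym zoneNear (pw a κ) k f) (hg : Sym zoneNear (pw b l) k g) :
    Sym zoneNear (pw (a + b) (κ + l)) k (fun t r => f t r * g t r) :=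
  (hf.mul hg).weight_congr fun _ _ m => pw_mul m.1.1 (zoneNear.pos m)

theorem Sym.far_time_pow (j : ℕ) : Sym zoneFar (pw (2 * j) j) k (fun t _ => (t : ℂ) ^ j) := by
  refine (Sym.of_time (b := fun t => |t| ^ (j : ℝ)) 1 zero_le_one fun t r m => ?_).weight_congr
    fun t r m => (pw_two_mul (zoneFar.pos m)).symm
  rw [norm_pow, Complex.norm_real, Real.norm_eq_abs, one_mul, Real.rpow_natCast]

end Sym

/-! ### The linear solution -/

/-- The operator `∂_rr + r⁻¹ ∂_r - 4 r⁻² = r⁻² ((r ∂_r)² - 4)`. -/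
def lapTwo (f : ℝ → ℂ) (r : ℝ) : ℂ := (rdr (rdr f) r - 4 * f r) / (r : ℂ) ^ 2

/-- The solution `q p (4it)^{(ν-2)/2} r² G(r²/4t)` of the linear equation. -/
def linSol (q ν : ℂ) (G : ℝ → ℂ) (t r : ℝ) : ℂ :=
  leadCoeff q ν t * ((r : ℂ) ^ 2 * G (1 / (4 * t) * r ^ 2))

theorem hasDerivAt_leadCoeff (q ν : ℂ) {t : ℝ} (ht : t ≠ 0) :
    HasDerivAt (leadCoeff q ν) ((ν - 2) / 2 / t * leadCoeff q ν t) t := by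
  have h0 : (4 * Complex.I * (t : ℂ)) ≠ 0 := by simp [ht]
  have hs : (4 * Complex.I * (t : ℂ)) ∈ Complex.slitPlane := by right; simp [ht]
  have h1 : HasDerivAt (fun x : ℝ => 4 * Complex.I * (x : ℂ)) (4 * Complex.I * 1) t :=
    ((hasDerivAt_id (t : ℂ)).comp_ofReal).const_mul _
  have h2 := (hasDerivAt_id' (4 * Complex.I * (t : ℂ))).cpow_const (c := (ν - 2) / 2) hs
  refine ((HasDerivAt.comp (h₂ := fun z : ℂ => z ^ ((ν - 2) / 2)) t h2 h1).const_mul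
    (q * pConst ν)).congr_deriv ?_
  rw [leadCoeff, Complex.cpow_sub _ _ h0, Complex.cpow_one]
  have : (t : ℂ) ≠ 0 := by exact_mod_cast ht
  have := Complex.I_ne_zero
  field_simp

theorem rdr_sq_mul_comp {g : ℝ → ℂ} {c r : ℝ} (hg : DifferentiableAt ℝ g (c * r ^ 2)) :
    rdr (fun r : ℝ => (r : ℂ) ^ 2 * g (c * r ^ 2)) r =
      2 * ((r : ℂ) ^ 2 * (g (c * r ^ 2) + rdr g (c * r ^ 2))) := by
  have h1 : HasDerivAt (fun r : ℝ => (r : ℂ) ^ 2) (2 * r) r := by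
    refine (((hasDerivAt_id (r : ℂ)).comp_ofReal).fun_pow 2).congr_deriv ?_
    simp
  have h2 : DifferentiableAt ℝ (fun r : ℝ => g (c * r ^ 2)) r :=
    hg.comp r (by fun_prop : DifferentiableAt ℝ (fun r : ℝ => c * r ^ 2) r)
  rw [rdr_mul_of_diff h1.differentiableAt h2, rdr_comp_pow hg, rdr, h1.deriv]
  push_cast
  ring

/-- Under the self-similar ansatz the linear equation becomes Kummer's equation for G at ρ = r²/4t.
-/
theorem lapTwo_linSol {q ν : ℂ} {G : ℝ → ℂ} (hG : Confluent (1 - ν / 2) G) {t r : ℝ} (ht : t ≠ 0)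
    (hr : 0 < r) : HasDerivAt (fun t => linSol q ν G t r) (Complex.I * lapTwo (linSol q ν G t) r) t := by
  have hsm := hG.smooth
  have hsm1 : ContDiff ℝ ∞ (deriv G) := (contDiff_infty_iff_deriv.1 hsm).2
  have hd : Differentiable ℝ G := hsm.differentiable (by simp)
  have hd1 : Differentiable ℝ (deriv G) := hsm1.differentiable (by simp)
  have hdr : Differentiable ℝ (rdr G) := (contDiff_rdr hsm).differentiable (by simp)
  have e1 : rdr (linSol q ν G t) = fun r : ℝ => leadCoeff q ν t * 2 *
      ((r : ℂ) ^ 2 * (fun ρ => G ρ + rdr G ρ) (1 / (4 * t) * r ^ 2)) := by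
    ext r
    rw [show linSol q ν G t = fun r : ℝ => leadCoeff q ν t * ((r : ℂ) ^ 2 * G (1 / (4 * t) * r ^ 2))
      from rfl, rdr_const_mul, rdr_sq_mul_comp (hd _)]
    ring
  have e2 : rdr (rdr (linSol q ν G t)) r = leadCoeff q ν t * 2 * (2 * ((r : ℂ) ^ 2 *
      (G (1 / (4 * t) * r ^ 2) + rdr G (1 / (4 * t) * r ^ 2) + (rdr G (1 / (4 * t) * r ^ 2)
        + rdr (rdr G) (1 / (4 * t) * r ^ 2))))) := by
    rw [e1, rdr_const_mul, rdr_sq_mul_comp (g := fun ρ => G ρ + rdr G ρ)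
      ((hd _).add (hdr _)), rdr_add_of_diff (hd _) (hdr _)]
  set ρ := 1 / (4 * t) * r ^ 2 with hρ
  have e3 : rdr (rdr G) ρ = ρ * (deriv G ρ + ρ * deriv (deriv G) ρ) := by
    have h2 : HasDerivAt (fun ρ : ℝ => (ρ : ℂ)) 1 ρ := (hasDerivAt_id (ρ : ℂ)).comp_ofReal
    have h3 : deriv (rdr G) ρ = _ := (h2.mul (hd1 ρ).hasDerivAt).deriv
    rw [rdr, h3, one_mul]
  have hrt : HasDerivAt (fun t : ℝ => 1 / (4 * t) * r ^ 2) (-ρ / t) t := by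
    have := ((hasDerivAt_inv ht).const_mul (1 / 4 * r ^ 2))
    refine (this.congr_of_eventuallyEq (Eventually.of_forall fun x => ?_)).congr_deriv ?_
    · simp only [one_div, mul_inv]; ring
    · rw [hρ]; field_simp
  have h4 := HasDerivAt.scomp t (hd ρ).hasDerivAt hrt
  have h5 := (hasDerivAt_leadCoeff q ν ht).mul (h4.const_mul ((r : ℂ) ^ 2))
  refine (h5.congr_of_eventuallyEq (Eventually.of_forall fun x => rfl)).congr_deriv ?_
  have hr0 : (r : ℂ) ≠ 0 := by exact_mod_cast hr.ne'
  have ht0 : (t : ℂ) ≠ 0 := by exact_mod_cast ht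
  have hρr : (r : ℂ) ^ 2 = 4 * t * ρ := by rw [hρ]; push_cast; field_simp
  have hode := hG.ode ρ
  simp only [Function.comp, Complex.real_smul]
  rw [lapTwo, e2, e3, show linSol q ν G t r = leadCoeff q ν t * ((r : ℂ) ^ 2 * G ρ) from rfl, rdr]
  rw [← hρ]
  push_cast
  field_simp
  rw [hρr]
  linear_combination (-8 * leadCoeff q ν t * t * ρ * Complex.I) * hode
    + (leadCoeff q ν t * t * ρ * (G ρ * (4 * ν - 8) - 8 * ρ * deriv G ρ)) * Complex.I_sq

/-! ### Estimates for the linear solution -/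

/-- The function ρh'(ρ) again vanishes at 0, so the linear bound by |ρ| is inherited by all orders
of r∂_r. -/
theorem Sym.comp_smooth {U : Zone} {h : ℝ → ℂ} (hh : ContDiff ℝ ∞ h) (h0 : h 0 = 0) {c : ℝ → ℝ}
    {p : ℕ} {k : ℕ} (hU : ∀ t r, U.mem t r → |c t * r ^ p| ≤ 1) :
    Sym U (fun t r => |c t * r ^ p|) k (fun t r => h (c t * r ^ p)) := by
  induction k generalizing h with
  | zero =>
    obtain ⟨C, hC⟩ := (isCompact_Icc (a := (-1 : ℝ)) (b := 1)).exists_bound_of_continuousOn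
      (contDiff_infty_iff_deriv.1 hh).2.continuous.continuousOn
    refine ⟨max C 0, le_max_right _ _, fun t r m => ?_⟩
    have := (convex_Icc (-1 : ℝ) 1).norm_image_sub_le_of_norm_deriv_le
      (fun x _ => hh.differentiable (by simp) x) (fun x hx => (hC x hx).trans (le_max_left C 0))
      (show (0 : ℝ) ∈ Icc (-1 : ℝ) 1 by simp) (abs_le.1 (hU t r m))
    simpa [h0] using this
  | succ k ih =>
    refine ⟨(ih hh h0).bdd, fun t r m => ?_, ?_⟩
    · exact (hh.differentiable (by simp) _).comp r
        (by fun_prop : DifferentiableAt ℝ (fun r : ℝ => c t * r ^ p) r)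
    · refine ((ih (contDiff_rdr hh) (by simp [CSS.rdr])).const_mul p).congr fun t r m => ?_
      exact (rdr_comp_pow (hh.differentiable (by simp) _)).symm

theorem exists_norm_leadCoeff_le (q ν : ℂ) :
    ∃ C, 0 ≤ C ∧ ∀ t : ℝ, t ≠ 0 → ‖leadCoeff q ν t‖ ≤ C * |t| ^ ((ν.re - 2) / 2) := by
  refine ⟨‖q * pConst ν‖ * (4 ^ ((ν.re - 2) / 2) * Real.exp (Real.pi * |((ν - 2) / 2).im|)),
    by positivity, fun t ht => ?_⟩
  have h0 : (4 * Complex.I * (t : ℂ)) ≠ 0 := by simp [ht]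
  have hre : ((ν - 2) / 2).re = (ν.re - 2) / 2 := by
    rw [show (2 : ℂ) = ((2 : ℝ) : ℂ) by norm_num, Complex.div_ofReal_re]; simp
  have hn : ‖(4 * Complex.I * (t : ℂ))‖ = 4 * |t| := by simp
  rw [leadCoeff, norm_mul, Complex.norm_cpow_of_ne_zero h0, hre, hn,
    Real.mul_rpow (by norm_num) (abs_nonneg t), div_eq_mul_inv, ← Real.exp_neg]
  have h1 : Real.exp (-((4 * Complex.I * (t : ℂ)).arg * ((ν - 2) / 2).im)) ≤
      Real.exp (Real.pi * |((ν - 2) / 2).im|) := by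
    apply Real.exp_le_exp.2
    refine (neg_le_abs _).trans ?_
    rw [abs_mul]
    gcongr
    exact Complex.abs_arg_le_pi _
  have h2 : 0 ≤ (4 : ℝ) ^ ((ν.re - 2) / 2) * |t| ^ ((ν.re - 2) / 2) := by positivity
  calc _ ≤ ‖q * pConst ν‖ * (4 ^ ((ν.re - 2) / 2) * |t| ^ ((ν.re - 2) / 2) *
        Real.exp (Real.pi * |((ν - 2) / 2).im|)) :=
        mul_le_mul_of_nonneg_left (mul_le_mul_of_nonneg_left h1 h2) (norm_nonneg _)
    _ = _ := by ring

theorem sym_leadCoeff_mul_sq {U : Zone} (hU : ∀ t r, U.mem t r → t ≠ 0) (q ν : ℂ) (k : ℕ) :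
    Sym U (pw ν.re (ν.re / 2 - 1)) k (fun t r => leadCoeff q ν t * (r : ℂ) ^ 2) := by
  obtain ⟨C, hC, hb⟩ := exists_norm_leadCoeff_le q ν
  refine ((Sym.of_time (b := fun t => |t| ^ ((ν.re - 2) / 2)) C hC fun t r m =>
    hb t (hU t r m)).mul (Sym.cpow 2)).weight_congr (fun t r m => ?_) |>.congr fun t r m => ?_
  · rw [pw_eq (U.pos m)]
    simp only [Complex.re_ofNat]
    congr 2 <;> ring
  · norm_num

section linSol

variable {q ν : ℂ} {G : ℝ → ℂ}

theorem abs_near_le {t r : ℝ} (m : zoneNear.mem t r) : |1 / (4 * t) * r ^ 2| ≤ 1 := by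
  have ht := abs_pos.2 m.1.1
  have h1 := zoneNear_one_le m
  have hr := zoneNear.pos m
  rw [le_div_iff₀ (by positivity), one_mul] at h1
  rw [abs_mul, abs_div, abs_mul, abs_of_pos (show (0 : ℝ) < 4 by norm_num), abs_one,
    abs_of_pos (show 0 < r ^ 2 by positivity), one_div, inv_mul_le_iff₀ (by positivity)]
  linarith

theorem abs_scale_eq {t r : ℝ} (ht : t ≠ 0) (hr : 0 < r) :
    |1 / (4 * t) * r ^ 2| = 1 / 4 * pw 0 (-1) t r := by
  have ht := abs_pos.2 ht
  rw [pw_zero_left, Real.rpow_neg_one, abs_mul, abs_div, abs_mul,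
    abs_of_pos (show (0 : ℝ) < 4 by norm_num), abs_one, abs_of_pos (show 0 < r ^ 2 by positivity)]
  field_simp

/-- The difference G − 1 vanishes at ρ = 0, which gains a factor r²/|t| over the leading term. -/
theorem sym_near_linSol_sub (hG : Confluent (1 - ν / 2) G) (k : ℕ) :
    Sym zoneNear (pw ν.re (ν.re / 2 - 2)) k
      (fun t r => linSol q ν G t r - leadCoeff q ν t * (r : ℂ) ^ 2) := by
  have h1 : Sym zoneNear (pw 0 (-1)) k (fun t r => G (1 / (4 * t) * r ^ 2) - 1) := by
    refine (Sym.comp_smooth (h := fun ρ => G ρ - 1) (c := fun t => 1 / (4 * t)) (p := 2)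
      (hG.smooth.sub contDiff_const) (by simp [hG.zero]) fun t r m => abs_near_le m).mono
      (D := 1 / 4) (by norm_num) fun t r m => ?_
    rw [abs_scale_eq m.1.1 (zoneNear.pos m)]
  refine ((sym_leadCoeff_mul_sq (fun t r (m : zoneNear.mem t r) => m.1.1) q ν k).near_mul h1).weight_congr
    (fun t r m => ?_) |>.congr fun t r m => ?_
  · congr 1 <;> ring
  · rw [linSol]; ring

theorem sym_near_linSol (hG : Confluent (1 - ν / 2) G) (k : ℕ) :
    Sym zoneNear (pw ν.re (ν.re / 2 - 1)) k (linSol q ν G) :=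
  (((sym_near_linSol_sub hG k).near_mono (by linarith)).add
    (sym_leadCoeff_mul_sq (fun t r (m : zoneNear.mem t r) => m.1.1) q ν k)).congr fun t r m => by ring

/-- The condition r > |t|^{1/2}/2 reads r²/(4|t|) > 1/16; this is where the threshold of `zoneHalf`
comes from. -/
theorem zoneHalf_of_far {t r : ℝ} (m : zoneFar.mem t r) :
    zoneHalf.mem (t / |t|) (1 / (4 * |t|) * r ^ 2) := by
  have ht := abs_pos.2 m.1.1
  have h4 := zoneFar_le_four m
  have hr := zoneFar.pos m
  refine ⟨?_, ?_⟩
  · rcases lt_or_gt_of_ne m.1.1 with h | h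
    · right; rw [abs_of_neg h, div_neg, div_self m.1.1]
    · left; rw [abs_of_pos h, div_self m.1.1]
  · have := m.2.1
    have h2 : |t| < 4 * r ^ 2 := by
      have := Real.sq_sqrt (abs_nonneg t)
      nlinarith [m.2.1, Real.sqrt_nonneg |t|]
    rw [one_div_mul_eq_div, lt_div_iff₀ (by positivity)]
    linarith

theorem Sym.far_comp {f : ℝ → ℝ → ℂ} {x : ℝ} {k : ℕ} (hf : Sym zoneHalf (fun _ s => s ^ x) k f) :
    Sym zoneFar (pw 0 (-x)) k (fun t r => f (t / |t|) (1 / (4 * |t|) * r ^ 2)) := by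
  refine (Sym.comp (e := fun t => t / |t|) (c := fun t => 1 / (4 * |t|)) (p := 2) hf
    fun t r m => zoneHalf_of_far m).mono (D := 4 ^ (-x)) (by positivity) fun t r m => le_of_eq ?_
  have ht := abs_pos.2 m.1.1
  have hr := zoneFar.pos m
  rw [pw_zero_left, ← Real.mul_rpow (by norm_num) (by positivity), Real.rpow_neg (by positivity),
    ← Real.inv_rpow (by positivity)]
  congr 1
  field_simp

/-- Each s∂_s produces a factor s. This is the loss of one factor r²/|t| per derivative seen in all
bounds outside the self-similar zone. -/
theorem sym_exp_I (k : ℕ) : Sym zoneHalf (fun _ s => s ^ (k : ℝ)) k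
    (fun ε s => Complex.exp (Complex.I * ε * s)) := by
  have hle : ∀ (j k : ℝ), j ≤ k → ∀ ε s, zoneHalf.mem ε s → s ^ j ≤ 16 ^ (k - j) * s ^ k := by
    intro j k hjk ε s m
    have hs := zoneHalf.pos m
    have : 1 ≤ (16 * s) ^ (k - j) := Real.one_le_rpow (by linarith [m.2]) (by linarith)
    rw [Real.mul_rpow (by norm_num) hs.le] at this
    calc s ^ j ≤ s ^ j * (16 ^ (k - j) * s ^ (k - j)) := le_mul_of_one_le_right (by positivity) this
      _ = 16 ^ (k - j) * (s ^ (k - j) * s ^ j) := by ring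
      _ = _ := by rw [← Real.rpow_add hs]; congr 2; ring
  have hb : BddBy zoneHalf (fun _ s => s ^ (0 : ℝ)) (fun ε s => Complex.exp (Complex.I * ε * s)) := by
    refine ⟨1, zero_le_one, fun ε s m => ?_⟩
    rw [Complex.norm_exp]
    simp
  induction k with
  | zero => rw [Nat.cast_zero]; exact hb
  | succ k ih =>
    push_cast
    refine ⟨hb.mono (by positivity) (hle 0 _ (by positivity)),
      fun ε s m => (hasDerivAt_exp_I ε s).differentiableAt, ?_⟩
    refine (((Sym.of_sign (f := fun ε => Complex.I * ε)).mul (Sym.cpow 1)).mul ih).weight_congr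
      (fun ε s m => ?_) |>.congr fun ε s m => ?_
    · rw [Complex.one_re, Real.rpow_one, Real.rpow_add_one (zoneHalf.pos m).ne']; ring
    · rw [CSS.rdr, (hasDerivAt_exp_I ε s).deriv, Complex.cpow_one]; ring

/-- Since 4it = (iε)(4|t|) with ε the sign of t, the non-integer powers of iε and of 4|t| cancel
between the prefactor and the asymptotic term. Only t^j remains, so both signs of time share the
same coefficients. -/
theorem leadCoeff_mul_asymp (γ : ℂ) (j : ℕ) {t r : ℝ} (ht : t ≠ 0) (hr : 0 < r) :
    leadCoeff q ν t * (r : ℂ) ^ 2 * (γ * (Complex.I * (t / |t| : ℝ)) ^ (1 - ν / 2 + j) *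
      ((1 / (4 * |t|) * r ^ 2 : ℝ) : ℂ) ^ (-(1 - ν / 2) - j)) =
    q * pConst ν * γ * (4 * Complex.I) ^ j * ((t : ℂ) ^ j * (r : ℂ) ^ (ν - 2 * j)) := by
  have hta := abs_pos.2 ht
  have hε : Complex.I * (t / |t| : ℝ) ≠ 0 := by
    refine mul_ne_zero Complex.I_ne_zero ?_
    exact_mod_cast div_ne_zero ht hta.ne'
  have h4 : (4 * Complex.I * (t : ℂ)) = Complex.I * (t / |t| : ℝ) * (4 * |t| : ℝ) := by
    have : ((|t| : ℝ) : ℂ) ≠ 0 := by exact_mod_cast hta.ne'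
    push_cast; field_simp
  set a := 1 - ν / 2 with ha
  have hea : (ν - 2) / 2 = -a := by rw [ha]; ring
  have hT : ((4 * |t| : ℝ) : ℂ) ≠ 0 := by exact_mod_cast (by positivity : (4 * |t| : ℝ) ≠ 0)
  have hr0 : (r : ℂ) ≠ 0 := by exact_mod_cast hr.ne'
  have hs : ((1 / (4 * |t|) * r ^ 2 : ℝ) : ℂ) ^ (-a - j) =
      ((4 * |t| : ℝ) : ℂ) ^ (a + j) * (r : ℂ) ^ (ν - 2 * j - 2) := by
    rw [Complex.ofReal_mul, Complex.mul_cpow_ofReal_nonneg (by positivity) (by positivity), one_div,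
      Complex.ofReal_inv, Complex.inv_cpow, ← Complex.cpow_neg]
    · congr 1
      · congr 1; ring
      · rw [Complex.ofReal_pow, ← Complex.cpow_nat_mul' (n := 2)]
        · congr 1; rw [ha]; push_cast; ring
        · rw [Complex.arg_ofReal_of_nonneg hr.le]; simp [Real.pi_pos]
        · rw [Complex.arg_ofReal_of_nonneg hr.le]; simp [Real.pi_pos.le]
    · rw [Complex.arg_ofReal_of_nonneg (by positivity)]; exact Real.pi_pos.ne
  have hj : ∀ {x : ℂ}, x ≠ 0 → x ^ (-a) * x ^ (a + j) = x ^ j := fun hx => by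
    rw [← Complex.cpow_add _ _ hx, show -a + (a + j) = j by ring, Complex.cpow_natCast]
  have hr2 : (r : ℂ) ^ 2 * (r : ℂ) ^ (ν - 2 * j - 2) = (r : ℂ) ^ (ν - 2 * j) := by
    rw [← Complex.cpow_natCast, ← Complex.cpow_add _ _ hr0]; congr 1; push_cast; ring
  have hpow : (Complex.I * (t / |t| : ℝ)) ^ j * ((4 * |t| : ℝ) : ℂ) ^ j =
      (4 * Complex.I) ^ j * (t : ℂ) ^ j := by rw [← mul_pow, ← mul_pow, h4]
  rw [hs, leadCoeff, hea, h4, mul_ofReal_cpow hε (by positivity)]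
  calc _ = q * pConst ν * γ * (((Complex.I * (t / |t| : ℝ)) ^ (-a) * (Complex.I * (t / |t| : ℝ)) ^ (a + j)) *
        (((4 * |t| : ℝ) : ℂ) ^ (-a) * ((4 * |t| : ℝ) : ℂ) ^ (a + j))) *
        ((r : ℂ) ^ 2 * (r : ℂ) ^ (ν - 2 * j - 2)) := by ring
    _ = _ := by rw [hj hε, hj hT, hr2, hpow]; ring

/-- The value of p is dictated by γ 0; this is what makes q r^ν the leading term outside the
self-similar zone. -/
theorem pConst_mul (hν : 0 < ν.re) : pConst ν * (2 / Complex.Gamma (3 - (1 - ν / 2))) = 1 := by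
  have h : (ν / 2 + 2).re = ν.re / 2 + 2 := by
    rw [show (2 : ℂ) = ((2 : ℝ) : ℂ) by norm_num, Complex.add_re, Complex.div_ofReal_re]; simp
  have := Complex.Gamma_ne_zero_of_re_pos (s := ν / 2 + 2) (by rw [h]; positivity)
  rw [pConst, show 3 - (1 - ν / 2) = ν / 2 + 2 by ring]
  generalize Complex.Gamma (ν / 2 + 2) = g at this
  field_simp

/-- The prefactor contributes the exponent Re ν/2 − 1 of |t|/r² and the oscillating amplitude Re ν/2
+ 2, in total Re ν + 1; k derivatives reduce this to Re ν + 1 − k. With M at least that large, the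
remainder of the power series is no worse. -/
theorem exists_far_linSol (hν : 0 < ν.re) (hG : Confluent (1 - ν / 2) G) :
    ∃ c : ℕ → ℂ, c 0 = q ∧ ∀ M k : ℕ, ν.re + 1 - k ≤ M →
      Sym zoneFar (pw ν.re (ν.re + 1 - k)) k (fun t r => linSol q ν G t r
        - ∑ j ∈ Finset.range M, (t : ℂ) ^ j * (c j * (r : ℂ) ^ (ν - 2 * j))) := by
  obtain ⟨γ, b, hγ, hA⟩ := hG.asymp
  have hare : (1 - ν / 2).re = 1 - ν.re / 2 := by
    rw [show (2 : ℂ) = ((2 : ℝ) : ℂ) by norm_num, Complex.sub_re, Complex.div_ofReal_re]; simp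
  refine ⟨fun j => q * pConst ν * γ j * (4 * Complex.I) ^ j, ?_, fun M k hMk => ?_⟩
  · simp only [hγ]
    rw [pow_zero, mul_one, mul_assoc, pConst_mul hν, mul_one]
  have hL : Sym zoneFar (pw ν.re (ν.re / 2 - 1)) k (fun t r => leadCoeff q ν t * (r : ℂ) ^ 2) :=
    sym_leadCoeff_mul_sq (fun t r (m : zoneFar.mem t r) => m.1.1) q ν k
  have h1 := (hL.far_mul (hA M k).far_comp).far_mono (b := ν.re) (l := ν.re + 1 - k) (by simp)
    (by rw [hare]; linarith)
  have hosc : Sym zoneHalf (fun _ s => s ^ (k - 2 - ν.re / 2)) k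
      (fun ε s => b ε * (Complex.exp (Complex.I * ε * s) * oscAmp (1 - ν / 2) ε s)) := by
    refine (Sym.of_sign.mul ((sym_exp_I k).mul (sym_oscAmp (by rw [hare]; linarith) k))).weight_congr
      fun ε s m => ?_
    rw [hare, one_mul, ← Real.rpow_add (zoneHalf.pos m)]
    congr 1; ring
  have h2 := (hL.far_mul hosc.far_comp).far_mono (b := ν.re) (l := ν.re + 1 - k) (by simp)
    (by linarith)
  refine (h1.add h2).congr fun t r m => ?_
  have ht := abs_pos.2 m.1.1
  have hr := zoneFar.pos m
  rw [linSol, show t / |t| * (1 / (4 * |t|) * r ^ 2) = 1 / (4 * t) * r ^ 2 by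
    have := abs_mul_abs_self t
    have := m.1.1
    field_simp
    nlinarith]
  have hsum : ∑ j ∈ Finset.range M, (t : ℂ) ^ j * (q * pConst ν * γ j * (4 * Complex.I) ^ j *
      (r : ℂ) ^ (ν - 2 * j)) = leadCoeff q ν t * (r : ℂ) ^ 2 * ∑ j ∈ Finset.range M,
      γ j * (Complex.I * (t / |t| : ℝ)) ^ (1 - ν / 2 + j) *
      ((1 / (4 * |t|) * r ^ 2 : ℝ) : ℂ) ^ (-(1 - ν / 2) - j) := by
    rw [Finset.mul_sum]
    refine Finset.sum_congr rfl fun j _ => ?_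
    rw [leadCoeff_mul_asymp (γ j) j m.1.1 hr]; ring
  rw [hsum]
  ring

end linSol

/-! ### Radial primitives -/

/-- `∫₀^r f ds/s`. -/
def prim (f : ℝ → ℂ) (r : ℝ) : ℂ := ∫ s in (0 : ℝ)..r, f s / s

/-- `r⁻² ∫₀^r f s ds`. -/
def avg (f : ℝ → ℂ) (r : ℝ) : ℂ := prim (fun s => (s : ℂ) ^ 2 * f s) r / (r : ℂ) ^ 2

section prim

variable {f g : ℝ → ℂ} {A B x y r : ℝ}

/-- Two powers are admitted because the bounds in the two zones have different exponents in s, and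
the integral from 0 crosses both. -/
theorem prim_integrable (hx : 0 < x) (hy : 0 < y) (hr : 0 < r) (hc : ContinuousOn f (Ioc 0 r))
    (hb : ∀ s ∈ Ioc 0 r, ‖f s‖ ≤ A * s ^ x + B * s ^ y) :
    IntervalIntegrable (fun s : ℝ => f s / s) volume 0 r := by
  have h1 : IntervalIntegrable (fun s : ℝ => A * s ^ (x - 1) + B * s ^ (y - 1)) volume 0 r :=
    ((intervalIntegral.intervalIntegrable_rpow' (by linarith)).const_mul A).add
      ((intervalIntegral.intervalIntegrable_rpow' (by linarith)).const_mul B)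
  rw [intervalIntegrable_iff_integrableOn_Ioc_of_le hr.le] at h1 ⊢
  refine Integrable.mono' h1 ?_ ?_
  · refine ContinuousOn.aestronglyMeasurable (hc.div Complex.continuous_ofReal.continuousOn
      fun s hs => ?_) measurableSet_Ioc
    exact_mod_cast hs.1.ne'
  · filter_upwards [ae_restrict_mem measurableSet_Ioc] with s hs
    have h0 : s ≠ 0 := hs.1.ne'
    rw [norm_div, Complex.norm_real, Real.norm_eq_abs, abs_of_pos hs.1, div_le_iff₀ hs.1]
    refine (hb s hs).trans (le_of_eq ?_)
    rw [Real.rpow_sub_one h0, Real.rpow_sub_one h0]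
    field_simp

theorem norm_prim_le (hx : 0 < x) (hy : 0 < y) (hr : 0 < r)
    (hb : ∀ s ∈ Ioc 0 r, ‖f s‖ ≤ A * s ^ x + B * s ^ y) :
    ‖prim f r‖ ≤ A * (r ^ x / x) + B * (r ^ y / y) := by
  have hA := (intervalIntegral.intervalIntegrable_rpow' (a := 0) (b := r)
    (show -1 < x - 1 by linarith)).const_mul A
  have hB := (intervalIntegral.intervalIntegrable_rpow' (a := 0) (b := r)
    (show -1 < y - 1 by linarith)).const_mul B
  refine (intervalIntegral.norm_integral_le_of_norm_le (g := fun s : ℝ => A * s ^ (x - 1) +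
    B * s ^ (y - 1)) hr.le (Eventually.of_forall fun s hs => ?_) (hA.add hB)).trans (le_of_eq ?_)
  · have h0 : s ≠ 0 := hs.1.ne'
    rw [norm_div, Complex.norm_real, Real.norm_eq_abs, abs_of_pos hs.1, div_le_iff₀ hs.1]
    refine (hb s hs).trans (le_of_eq ?_)
    rw [Real.rpow_sub_one h0, Real.rpow_sub_one h0]
    field_simp
  · rw [intervalIntegral.integral_add hA hB, intervalIntegral.integral_const_mul,
      intervalIntegral.integral_const_mul, integral_rpow (Or.inl (by linarith)),
      integral_rpow (Or.inl (by linarith))]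
    simp [Real.zero_rpow hx.ne', Real.zero_rpow hy.ne']

theorem hasDerivAt_prim (hr : 0 < r) (hi : IntervalIntegrable (fun s : ℝ => f s / s) volume 0 r)
    {S : Set ℝ} (hS : S ∈ 𝓝 r) (hc : ContinuousOn f S) : HasDerivAt (prim f) (f r / r) r := by
  obtain ⟨S', hS', hS'o, hrS'⟩ := mem_nhds_iff.1 (inter_mem hS (Ioi_mem_nhds hr))
  have hc' : ContinuousOn (fun s : ℝ => f s / s) S' :=
    (hc.mono fun s hs => (hS' hs).1).div Complex.continuous_ofReal.continuousOn fun s hs => by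
      have : 0 < s := (hS' hs).2
      exact_mod_cast this.ne'
  exact intervalIntegral.integral_hasDerivAt_right hi
    (hc'.stronglyMeasurableAtFilter hS'o r hrS') (hc'.continuousAt (hS'o.mem_nhds hrS'))

theorem rdr_prim (hr : 0 < r) (hi : IntervalIntegrable (fun s : ℝ => f s / s) volume 0 r)
    {S : Set ℝ} (hS : S ∈ 𝓝 r) (hc : ContinuousOn f S) : rdr (prim f) r = f r := by
  have : (r : ℂ) ≠ 0 := by exact_mod_cast hr.ne'
  rw [rdr, (hasDerivAt_prim hr hi hS hc).deriv]
  field_simp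

theorem prim_const_mul (c : ℂ) (f : ℝ → ℂ) (r : ℝ) : prim (fun s => c * f s) r = c * prim f r := by
  simp only [prim, mul_div_assoc]
  rw [intervalIntegral.integral_const_mul]

theorem prim_sub (hf : IntervalIntegrable (fun s : ℝ => f s / s) volume 0 r)
    (hg : IntervalIntegrable (fun s : ℝ => g s / s) volume 0 r) :
    prim (fun s => f s - g s) r = prim f r - prim g r := by
  simp only [prim, sub_div]
  exact intervalIntegral.integral_sub hf hg

theorem prim_sum {ι : Type*} (S : Finset ι) {F : ι → ℝ → ℂ}
    (h : ∀ i ∈ S, IntervalIntegrable (fun s : ℝ => F i s / s) volume 0 r) :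
    prim (fun s => ∑ i ∈ S, F i s) r = ∑ i ∈ S, prim (F i) r := by
  simp only [prim, Finset.sum_div]
  exact intervalIntegral.integral_finsetSum h

end prim

/-- The function `f` is `C^∞` on `(0, 3)` and `|(r ∂_r)^k f| ≲ r^a` for all `k`. -/
def Coe (a : ℝ) (f : ℝ → ℂ) : Prop := ∀ k, Sym zoneAll (fun _ r => r ^ a) k (fun _ => f)

/-! ### Time-independent symbols -/

section Coe

variable {a b : ℝ} {f g : ℝ → ℂ} {k : ℕ}

theorem zoneAll_one : {r | zoneAll.mem 1 r} = Ioo 0 3 := by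
  ext r; simp [zoneAll]

theorem Coe.contDiffOn (hf : Coe a f) : ContDiffOn ℝ ∞ f (Ioo 0 3) :=
  zoneAll_one ▸ contDiffOn_of_sym (t := 1) hf

theorem Coe.exists_le (hf : Coe a f) : ∃ C, 0 ≤ C ∧ ∀ r ∈ Ioo (0 : ℝ) 3, ‖f r‖ ≤ C * r ^ a := by
  obtain ⟨C, hC, h⟩ := hf 0
  exact ⟨C, hC, fun r hr => h 1 r (by rwa [← zoneAll_one] at hr)⟩

theorem Coe.mono (hf : Coe a f) (h : b ≤ a) : Coe b f := fun k =>
  (hf k).mono (D := 3 ^ (a - b)) (by positivity) fun _ _ m => rpow_le_of_le_three m.2.1 m.2.2.le h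

theorem Coe.add (hf : Coe a f) (hg : Coe a g) : Coe a (fun r => f r + g r) := fun k =>
  (hf k).add (hg k)

theorem Coe.mul (hf : Coe a f) (hg : Coe b g) : Coe (a + b) (fun r => f r * g r) := fun k =>
  ((hf k).mul (hg k)).weight_congr fun _ _ m => (Real.rpow_add m.2.1 a b).symm

theorem Coe.const_mul (c : ℂ) (hf : Coe a f) : Coe a (fun r => c * f r) := fun k => (hf k).const_mul c

theorem Coe.conj (hf : Coe a f) : Coe a (fun r => (starRingEnd ℂ) (f r)) := fun k => (hf k).conj

theorem Coe.zero : Coe a (fun _ => 0) := fun _ => Sym.zero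

theorem Coe.sum {ι : Type*} (S : Finset ι) {F : ι → ℝ → ℂ} (h : ∀ i ∈ S, Coe a (F i)) :
    Coe a (fun r => ∑ i ∈ S, F i r) := fun k => Sym.sum S fun i hi => h i hi k

theorem Coe.rdr (hf : Coe a f) : Coe a (rdr f) := fun k => (hf (k + 1)).rdr

theorem Coe.congr (hf : Coe a f) (h : ∀ r ∈ Ioo (0 : ℝ) 3, f r = g r) : Coe a g := fun k =>
  (hf k).congr fun _ r m => h r m.2

theorem Coe.cpow (c : ℂ) : Coe c.re (fun r => (r : ℂ) ^ c) := fun _ => Sym.cpow c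

theorem Coe.sq : Coe 2 (fun r => (r : ℂ) ^ 2) :=
  (Coe.cpow 2).congr fun r _ => by norm_num

theorem Coe.inv_sq : Coe (-2) (fun r => ((r : ℂ) ^ 2)⁻¹) :=
  (by simpa using Coe.cpow (-2) : Coe (-2) _).congr fun r _ => by
    rw [Complex.cpow_neg]; norm_num

theorem Coe.sq_mul (hf : Coe a f) : Coe (a + 2) (fun r => (r : ℂ) ^ 2 * f r) := by
  rw [add_comm]; exact Coe.sq.mul hf

theorem Coe.div_sq (hf : Coe a f) : Coe (a - 2) (fun r => f r / (r : ℂ) ^ 2) := by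
  simp only [div_eq_mul_inv]
  exact hf.mul Coe.inv_sq

theorem Coe.lapTwo (hf : Coe a f) : Coe (a - 2) (lapTwo f) :=
  (hf.rdr.rdr.add (hf.const_mul (-4))).div_sq.congr fun r _ => by rw [CSS.lapTwo]; ring

theorem Coe.all (hf : Coe a f) : Sym zoneAll (pw a 0) k (fun _ => f) :=
  (hf k).weight_congr fun _ _ _ => pw_zero_right.symm

theorem Coe.far (hf : Coe a f) : Sym zoneFar (pw a 0) k (fun _ => f) :=
  hf.all.mono_zone fun _ _ => zoneFar_all

theorem Coe.near (hf : Coe a f) : Sym zoneNear (pw a 0) k (fun _ => f) :=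
  hf.all.mono_zone fun _ _ => zoneNear_all

theorem Coe.continuousOn (hf : Coe a f) : ContinuousOn f (Ioo 0 3) := hf.contDiffOn.continuousOn

theorem Coe.prim_integrable (ha : 0 < a) (hf : Coe a f) {r : ℝ} (hr : r ∈ Ioo (0 : ℝ) 3) :
    IntervalIntegrable (fun s : ℝ => f s / s) volume 0 r := by
  obtain ⟨C, hC, hb⟩ := hf.exists_le
  exact CSS.prim_integrable (A := C) (B := 0) ha one_pos hr.1 (hf.continuousOn.mono fun s hs =>
    ⟨hs.1, hs.2.trans_lt hr.2⟩) fun s hs => by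
      simpa using hb s ⟨hs.1, hs.2.trans_lt hr.2⟩

theorem Coe.prim (ha : 0 < a) (hf : Coe a f) : Coe a (prim f) := by
  obtain ⟨C, hC, hb⟩ := hf.exists_le
  have h0 : BddBy zoneAll (fun _ r => r ^ a) (fun _ => CSS.prim f) := by
    refine ⟨C / a, by positivity, fun t r m => ?_⟩
    refine (norm_prim_le (A := C) (B := 0) ha one_pos m.2.1 fun s hs => ?_).trans (le_of_eq ?_)
    · simpa using hb s ⟨hs.1, hs.2.trans_lt m.2.2⟩
    · ring
  intro k
  cases k with
  | zero => exact h0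
  | succ k =>
    have hn : ∀ t r, zoneAll.mem t r → Ioo (0 : ℝ) 3 ∈ 𝓝 r := fun t r m => Ioo_mem_nhds m.2.1 m.2.2
    exact ⟨h0, fun t r m => (hasDerivAt_prim m.2.1 (hf.prim_integrable ha m.2) (hn t r m)
      hf.continuousOn).differentiableAt, (hf k).congr fun t r m =>
      (rdr_prim m.2.1 (hf.prim_integrable ha m.2) (hn t r m) hf.continuousOn).symm⟩

theorem Coe.avg (ha : 0 < a) (hf : Coe a f) : Coe a (avg f) := by
  have := (hf.sq_mul.prim (by linarith)).div_sq
  rwa [add_sub_cancel_right] at this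

end Coe

/-! ### Primitives in the two zones -/

section primZone

variable {F : ℝ → ℝ → ℂ} {a κ l : ℝ} {k : ℕ}

theorem Sym.continuousOn_of_near_far {w v : ℝ → ℝ → ℝ} (hn : Sym zoneNear w 1 F)
    (hf : Sym zoneFar v 1 F) {t : ℝ} (ht : t ≠ 0) (ht1 : |t| ≤ 1) : ContinuousOn (F t) (Ioo 0 3) := by
  intro r hr
  rcases zoneAll_near_or_far (t := t) (r := r) ⟨⟨ht, ht1⟩, hr⟩ with m | m
  · exact (hn.diff m).continuousAt.continuousWithinAt
  · exact (hf.diff m).continuousAt.continuousWithinAt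

theorem prim_bound_near_far (hn : Sym zoneNear (pw a l) 1 F) (hf : Sym zoneFar (pw a κ) 1 F) :
    ∃ C D : ℝ, 0 ≤ C ∧ 0 ≤ D ∧ ∀ t r, zoneAll.mem t r → ∀ s ∈ Ioc 0 r,
      ‖F t s‖ ≤ (C * |t| ^ l) * s ^ (a - 2 * l) + (D * |t| ^ κ) * s ^ (a - 2 * κ) := by
  obtain ⟨C, hC, hn0⟩ := hn.bdd
  obtain ⟨D, hD, hf0⟩ := hf.bdd
  refine ⟨C, D, hC, hD, fun t r m s hs => ?_⟩
  have := hs.1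
  rcases zoneAll_near_or_far (t := t) (r := s) ⟨m.1, hs.1, hs.2.trans_lt m.2.2⟩ with m' | m'
  · refine (hn0 t s m').trans ?_
    rw [pw_eq hs.1, ← mul_assoc]
    exact le_add_of_nonneg_right (by positivity)
  · refine (hf0 t s m').trans ?_
    rw [pw_eq hs.1, ← mul_assoc]
    exact le_add_of_nonneg_left (by positivity)

theorem prim_integrable_near_far (hn : Sym zoneNear (pw a l) 1 F) (hf : Sym zoneFar (pw a κ) 1 F)
    (hκ : 2 * κ < a) (hl : 2 * l < a) {t r : ℝ} (m : zoneAll.mem t r) :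
    IntervalIntegrable (fun s : ℝ => F t s / s) volume 0 r := by
  obtain ⟨C, D, -, -, h⟩ := prim_bound_near_far hn hf
  exact CSS.prim_integrable (by linarith) (by linarith) m.2.1
    ((Sym.continuousOn_of_near_far hn hf m.1.1 m.1.2).mono fun s hs =>
      ⟨hs.1, hs.2.trans_lt m.2.2⟩) (h t r m)

/-- The inner part of the integral contributes r^a(|t|/r²)^l, which outside the self-similar zone is
at most the weight with κ ≤ l. Integrability at 0 needs 2l < a. -/
theorem Sym.prim_far (hn : Sym zoneNear (pw a l) 1 F) (hf : Sym zoneFar (pw a κ) 1 F)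
    (hκl : κ ≤ l) (hl : 2 * l < a) : Sym zoneFar (pw a κ) 1 (fun t => prim (F t)) := by
  obtain ⟨C, D, hC, hD, h⟩ := prim_bound_near_far hn hf
  have hi : ∀ t r, zoneFar.mem t r → IntervalIntegrable (fun s : ℝ => F t s / s) volume 0 r :=
    fun t r m => prim_integrable_near_far hn hf (by linarith) hl (zoneFar_all m)
  have hc : ∀ t r, zoneFar.mem t r → ContinuousOn (F t) {r | zoneFar.mem t r} := fun t _ _ r m =>
    (hf.diff m).continuousAt.continuousWithinAt
  refine ⟨⟨C / (a - 2 * l) * (3 ^ (a - a) * 4 ^ (l - κ)) + D / (a - 2 * κ), ?_, fun t r m => ?_⟩,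
    fun t r m => ?_, ?_⟩
  · have : 0 < a - 2 * l := by linarith
    have : 0 < a - 2 * κ := by linarith
    positivity
  · have hr := zoneFar.pos m
    have h1 : 0 < a - 2 * l := by linarith
    have h2 : 0 < a - 2 * κ := by linarith
    calc ‖CSS.prim (F t) r‖ ≤ (C * |t| ^ l) * (r ^ (a - 2 * l) / (a - 2 * l)) +
          (D * |t| ^ κ) * (r ^ (a - 2 * κ) / (a - 2 * κ)) :=
          norm_prim_le h1 h2 hr (h t r (zoneFar_all m))
      _ = C / (a - 2 * l) * pw a l t r + D / (a - 2 * κ) * pw a κ t r := by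
          rw [pw_eq hr, pw_eq hr]; ring
      _ ≤ C / (a - 2 * l) * ((3 ^ (a - a) * 4 ^ (l - κ)) * pw a κ t r) +
          D / (a - 2 * κ) * pw a κ t r := by
          gcongr
          exact pw_far_mono m le_rfl hκl
      _ = _ := by ring
  · exact (hasDerivAt_prim (zoneFar.pos m) (hi t r m) (zoneFar.mem_nhds m) (hc t r m)).differentiableAt
  · exact (hf.of_le (j := 0) (by simp)).congr fun t r m =>
      (rdr_prim (zoneFar.pos m) (hi t r m) (zoneFar.mem_nhds m) (hc t r m)).symm

theorem Sym.prim_near (hn : Sym zoneNear (pw a l) (k + 1) F) (hl : 2 * l < a) :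
    Sym zoneNear (pw a l) (k + 1) (fun t => prim (F t)) := by
  obtain ⟨C, hC, h⟩ := hn.bdd
  have h1 : 0 < a - 2 * l := by linarith
  have hs : ∀ t r, zoneNear.mem t r → ∀ s ∈ Ioc 0 r, zoneNear.mem t s := fun t r m s hs =>
    ⟨m.1, hs.1, hs.2.trans_lt m.2.2⟩
  have hb : ∀ t r, zoneNear.mem t r → ∀ s ∈ Ioc 0 r,
      ‖F t s‖ ≤ (C * |t| ^ l) * s ^ (a - 2 * l) + 0 * s ^ (1 : ℝ) := by
    intro t r m s hs'
    refine (h t s (hs t r m s hs')).trans (le_of_eq ?_)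
    rw [pw_eq hs'.1]; ring
  have hc : ∀ t, ContinuousOn (F t) {r | zoneNear.mem t r} := fun t r m =>
    (hn.diff m).continuousAt.continuousWithinAt
  have hi : ∀ t r, zoneNear.mem t r → IntervalIntegrable (fun s : ℝ => F t s / s) volume 0 r :=
    fun t r m => CSS.prim_integrable h1 one_pos (zoneNear.pos m)
      ((hc t).mono fun s hs' => hs t r m s hs') (hb t r m)
  refine ⟨⟨C / (a - 2 * l), by positivity, fun t r m => ?_⟩, fun t r m => ?_, ?_⟩
  · refine (norm_prim_le h1 one_pos (zoneNear.pos m) (hb t r m)).trans (le_of_eq ?_)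
    rw [pw_eq (zoneNear.pos m)]; ring
  · exact (hasDerivAt_prim (zoneNear.pos m) (hi t r m) (zoneNear.mem_nhds m) (hc t)).differentiableAt
  · exact (hn.of_le k.le_succ).congr fun t r m =>
      (rdr_prim (zoneNear.pos m) (hi t r m) (zoneNear.mem_nhds m) (hc t)).symm

end primZone

/-! ### Expansions in powers of time -/

/-- The Cauchy product of two sequences of functions. -/
def conv (X Y : ℕ → ℝ → ℂ) (j : ℕ) (r : ℝ) : ℂ := ∑ p ∈ Finset.HasAntidiagonal.antidiagonal j, X p.1 r * Y p.2 r

/-- The number `N` of terms of an expansion and the order `κ` of the error are compatible. -/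
structure ExpansionOrder (N : ℕ) (κ : ℝ) : Prop where
  nonneg : 0 ≤ κ
  le : κ ≤ N
  sub_one_le : (N : ℝ) - 1 ≤ κ

/-- `F` has the size of `r^α`, is `O(|t|^{α/2-1} r²)` in the self-similar zone, and is given by
`∑_{j<N} t^j F_j` up to a relative error `(|t|/r²)^κ` outside. -/
structure HasExpansion (N : ℕ) (κ α : ℝ) (F : ℝ → ℝ → ℂ) (Fs : ℕ → ℝ → ℂ) : Prop where
  coe : ∀ j < N, Coe (α - 2 * j) (Fs j)
  near : Sym zoneNear (pw α (α / 2 - 1)) 1 F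
  far : Sym zoneFar (pw α κ) 1 (fun t r => F t r - ∑ j ∈ Finset.range N, (t : ℂ) ^ j * Fs j r)

section Expansion

variable {N : ℕ} {κ α β : ℝ} {F G : ℝ → ℝ → ℂ} {Fs Gs : ℕ → ℝ → ℂ}

theorem Coe.far_time_pow {k j : ℕ} {f : ℝ → ℂ} {a : ℝ} (hf : Coe (a - 2 * j) f) :
    Sym zoneFar (pw a j) k (fun t r => (t : ℂ) ^ j * f r) :=
  ((Sym.far_time_pow j).far_mul hf.far).weight_congr fun t r m => by congr 1 <;> ring

theorem Coe.near_time_pow {k j : ℕ} {f : ℝ → ℂ} {a : ℝ} (hf : Coe (a - 2 * j) f) :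
    Sym zoneNear (pw a j) k (fun t r => (t : ℂ) ^ j * f r) := by
  have h : Sym zoneNear (pw (2 * j) j) k (fun t _ => (t : ℂ) ^ j) := by
    refine (Sym.of_time (b := fun t => |t| ^ (j : ℝ)) 1 zero_le_one fun t r m => ?_).weight_congr
      fun t r m => (pw_two_mul (zoneNear.pos m)).symm
    rw [norm_pow, Complex.norm_real, Real.norm_eq_abs, one_mul, Real.rpow_natCast]
  exact (h.near_mul hf.near).weight_congr fun t r m => by congr 1 <;> ring

theorem HasExpansion.add (hF : HasExpansion N κ α F Fs) (hG : HasExpansion N κ α G Gs) :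
    HasExpansion N κ α (fun t r => F t r + G t r) (fun j r => Fs j r + Gs j r) where
  coe j hj := (hF.coe j hj).add (hG.coe j hj)
  near := hF.near.add hG.near
  far := (hF.far.add hG.far).congr fun t r m => by
    simp only [mul_add, Finset.sum_add_distrib]; ring

theorem HasExpansion.const_mul (c : ℂ) (hF : HasExpansion N κ α F Fs) :
    HasExpansion N κ α (fun t r => c * F t r) (fun j r => c * Fs j r) where
  coe j hj := (hF.coe j hj).const_mul c
  near := hF.near.const_mul c
  far := (hF.far.const_mul c).congr fun t r m => by
    rw [mul_sub, Finset.mul_sum]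
    congr 1
    exact Finset.sum_congr rfl fun j _ => by ring

theorem HasExpansion.conj (hF : HasExpansion N κ α F Fs) :
    HasExpansion N κ α (fun t r => (starRingEnd ℂ) (F t r)) (fun j r => (starRingEnd ℂ) (Fs j r)) where
  coe j hj := (hF.coe j hj).conj
  near := hF.near.conj
  far := hF.far.conj.congr fun t r m => by simp

theorem HasExpansion.mono (hF : HasExpansion N κ α F Fs) (h : β ≤ α) : HasExpansion N κ β F Fs where
  coe j hj := (hF.coe j hj).mono (by linarith)
  near := hF.near.near_scale 1 h
  far := hF.far.far_mono h le_rfl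

theorem HasExpansion.sq_mul (hF : HasExpansion N κ α F Fs) :
    HasExpansion N κ (α + 2) (fun t r => (r : ℂ) ^ 2 * F t r) (fun j r => (r : ℂ) ^ 2 * Fs j r) where
  coe j hj := ((hF.coe j hj).sq_mul).mono (by linarith)
  near := ((Coe.sq.near.near_mul hF.near).near_mono (l := (α + 2) / 2 - 1) (by linarith)).weight_congr
    fun t r m => by congr 1; ring
  far := ((Coe.sq.far.far_mul hF.far).weight_congr (fun t r m => by congr 1 <;> ring)).congr
    fun t r m => by
      rw [mul_sub, Finset.mul_sum]
      congr 1
      exact Finset.sum_congr rfl fun j _ => by ring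

theorem sum_range_mul_sum_range (N : ℕ) (x : ℂ) (X Y : ℕ → ℂ) :
    (∑ j ∈ Finset.range N, x ^ j * X j) * (∑ j ∈ Finset.range N, x ^ j * Y j) =
      ∑ j ∈ Finset.range N, x ^ j * (∑ p ∈ Finset.HasAntidiagonal.antidiagonal j, X p.1 * Y p.2) +
      ∑ p ∈ (Finset.range N ×ˢ Finset.range N).filter (fun p => ¬ p.1 + p.2 < N),
        x ^ (p.1 + p.2) * (X p.1 * Y p.2) := by
  rw [Finset.sum_mul_sum, ← Finset.sum_product',
    ← Finset.sum_filter_add_sum_filter_not _ (fun p : ℕ × ℕ => p.1 + p.2 < N)]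
  congr 1
  · rw [← Finset.sum_fiberwise_of_maps_to (g := fun p : ℕ × ℕ => p.1 + p.2) (t := Finset.range N)
      (fun p hp => by simpa using (Finset.mem_filter.1 hp).2)]
    refine Finset.sum_congr rfl fun j hj => ?_
    have hj := Finset.mem_range.1 hj
    rw [Finset.mul_sum]
    refine Finset.sum_congr ?_ fun p hp => ?_
    · ext p
      simp only [Finset.mem_filter, Finset.mem_product, Finset.mem_range, Finset.HasAntidiagonal.mem_antidiagonal]
      omega
    · rw [← Finset.HasAntidiagonal.mem_antidiagonal.1 hp, pow_add]; ring
  · exact Finset.sum_congr rfl fun p _ => by rw [pow_add]; ring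

theorem HasExpansion.far_sum (hF : HasExpansion N κ α F Fs) :
    Sym zoneFar (pw α 0) 1 (fun t r => ∑ j ∈ Finset.range N, (t : ℂ) ^ j * Fs j r) :=
  Sym.sum _ fun j hj => ((hF.coe j (Finset.mem_range.1 hj)).far_time_pow).far_mono le_rfl
    (Nat.cast_nonneg j)

theorem HasExpansion.far_self (ho : ExpansionOrder N κ) (hF : HasExpansion N κ α F Fs) :
    Sym zoneFar (pw α 0) 1 F :=
  ((hF.far.far_mono le_rfl ho.nonneg).add hF.far_sum).congr fun t r m => by ring

/-- The products of terms whose time powers add up to N or more have order at least N ≥ κ and join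
the error. -/
theorem HasExpansion.mul (ho : ExpansionOrder N κ) (hF : HasExpansion N κ α F Fs)
    (hG : HasExpansion N κ β G Gs) :
    HasExpansion N κ (α + β) (fun t r => F t r * G t r) (conv Fs Gs) where
  coe j hj := Coe.sum _ fun p hp => by
    have hp' := Finset.HasAntidiagonal.mem_antidiagonal.1 hp
    refine ((hF.coe p.1 (by omega)).mul (hG.coe p.2 (by omega))).mono (le_of_eq ?_)
    rw [← hp']; push_cast; ring
  near := (hF.near.near_mul hG.near).near_mono (by linarith)
  far := by
    have h1 : Sym zoneFar (pw (α + β) κ) 1 (fun t r =>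
        (F t r - ∑ j ∈ Finset.range N, (t : ℂ) ^ j * Fs j r) * G t r) :=
      (hF.far.far_mul (hG.far_self ho)).weight_congr fun t r m => by congr 1; ring
    have h2 : Sym zoneFar (pw (α + β) κ) 1 (fun t r =>
        (∑ j ∈ Finset.range N, (t : ℂ) ^ j * Fs j r) *
          (G t r - ∑ j ∈ Finset.range N, (t : ℂ) ^ j * Gs j r)) :=
      (hF.far_sum.far_mul hG.far).weight_congr fun t r m => by congr 1; ring
    have h3 : Sym zoneFar (pw (α + β) κ) 1 (fun t r =>
        ∑ p ∈ (Finset.range N ×ˢ Finset.range N).filter (fun p => ¬ p.1 + p.2 < N),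
          (t : ℂ) ^ (p.1 + p.2) * (Fs p.1 r * Gs p.2 r)) := by
      refine Sym.sum _ fun p hp => ?_
      simp only [Finset.mem_filter, Finset.mem_product, Finset.mem_range] at hp
      have hc : Coe (α + β - 2 * (p.1 + p.2 : ℕ)) (fun r => Fs p.1 r * Gs p.2 r) :=
        ((hF.coe p.1 hp.1.1).mul (hG.coe p.2 hp.1.2)).mono (le_of_eq (by push_cast; ring))
      refine hc.far_time_pow.far_mono le_rfl (ho.le.trans ?_)
      exact_mod_cast not_lt.1 hp.2
    refine ((h1.add h2).add h3).congr fun t r m => ?_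
    have := sum_range_mul_sum_range N t (fun j => Fs j r) (fun j => Gs j r)
    simp only [conv]
    linear_combination -this

/-- No cancellation is used in the self-similar zone: F and the terms of its expansion are bounded
separately. The highest time power is N − 1 ≤ κ ≤ l. -/
theorem HasExpansion.near_error (ho : ExpansionOrder N κ) (hF : HasExpansion N κ α F Fs) {l : ℝ}
    (hl : κ ≤ l) (hl' : α / 2 - 1 ≤ l) : Sym zoneNear (pw α l) 1
      (fun t r => F t r - ∑ j ∈ Finset.range N, (t : ℂ) ^ j * Fs j r) := by
  refine (hF.near.near_mono hl').sub (Sym.sum _ fun j hj => ?_)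
  have hj := Finset.mem_range.1 hj
  refine ((hF.coe j hj).near_time_pow).near_mono ?_
  have : (j : ℝ) + 1 ≤ N := by exact_mod_cast hj
  linarith [ho.sub_one_le]

theorem prim_time_sum {t r : ℝ} (hi : ∀ j < N, IntervalIntegrable (fun s : ℝ => Fs j s / s) volume 0 r) :
    prim (fun s => ∑ j ∈ Finset.range N, (t : ℂ) ^ j * Fs j s) r =
      ∑ j ∈ Finset.range N, (t : ℂ) ^ j * prim (Fs j) r := by
  rw [prim_sum]
  · exact Finset.sum_congr rfl fun j _ => prim_const_mul _ _ _
  · intro j hj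
    simp only [mul_div_assoc]
    exact (hi j (Finset.mem_range.1 hj)).const_mul _

/-- The integral of the error starts at r = 0 and so passes through the self-similar zone, where the
expansion is not accurate. The condition 2κ < α makes that part integrable and small enough. -/
theorem HasExpansion.far_prim (ho : ExpansionOrder N κ) (hκ : 2 * κ < α)
    (hF : HasExpansion N κ α F Fs) : Sym zoneFar (pw α κ) 1
      (fun t r => prim (F t) r - ∑ j ∈ Finset.range N, (t : ℂ) ^ j * prim (Fs j) r) := by
  -- The weaker of the exponents of the expansion terms and of F itself; α − 2(α/2−1) = 2 shows that
  -- the second one is harmless.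
  set l := max κ (α / 2 - 1)
  have hl : 2 * l < α := by
    rcases max_choice κ (α / 2 - 1) with h | h <;> simp only [l, h] <;> linarith
  have hne := hF.near_error ho (le_max_left κ (α / 2 - 1)) (le_max_right _ _)
  refine (Sym.prim_far hne hF.far (le_max_left _ _) hl).congr fun t r m => ?_
  have hE := prim_integrable_near_far hne hF.far hκ hl (zoneFar_all m)
  have hj : ∀ j < N, IntervalIntegrable (fun s : ℝ => Fs j s / s) volume 0 r := fun j hj => by
    refine (hF.coe j hj).prim_integrable ?_ (zoneFar_all m).2
    have : (j : ℝ) + 1 ≤ N := by exact_mod_cast hj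
    linarith [ho.sub_one_le]
  have hS : IntervalIntegrable (fun s : ℝ => (∑ j ∈ Finset.range N, (t : ℂ) ^ j * Fs j s) / s)
      volume 0 r := by
    simp only [Finset.sum_div, mul_div_assoc]
    simpa only [Finset.sum_fn] using IntervalIntegrable.sum (Finset.range N) fun j h =>
      (hj j (Finset.mem_range.1 h)).const_mul ((t : ℂ) ^ j)
  rw [← prim_time_sum hj, ← prim_sub ((hE.add hS).congr fun s _ => ?_) hS]
  ring

theorem HasExpansion.prim (ho : ExpansionOrder N κ) (hκ : 2 * κ < α)
    (hF : HasExpansion N κ α F Fs) :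
    HasExpansion N κ α (fun t => prim (F t)) (fun j => prim (Fs j)) where
  coe j hj := (hF.coe j hj).prim (by
    have : (j : ℝ) + 1 ≤ N := by exact_mod_cast hj
    linarith [ho.sub_one_le])
  near := hF.near.prim_near (by linarith)
  far := hF.far_prim ho hκ

theorem Sym.near_avg {a l : ℝ} {k : ℕ} (hn : Sym zoneNear (pw a l) (k + 1) F) (hl : 2 * l < a + 2) :
    Sym zoneNear (pw a l) (k + 1) (fun t => avg (F t)) := by
  have h1 : Sym zoneNear (pw (a + 2) l) (k + 1) (fun t r => (r : ℂ) ^ 2 * F t r) :=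
    (Coe.sq.near.near_mul hn).weight_congr fun t r m => by congr 1 <;> ring
  have h2 := h1.prim_near hl
  refine ((h2.near_mul Coe.inv_sq.near).weight_congr fun t r m => by congr 1 <;> ring).congr
    fun t r m => ?_
  rw [avg, div_eq_mul_inv]

theorem HasExpansion.avg (ho : ExpansionOrder N κ) (hκ : 2 * κ < α)
    (hF : HasExpansion N κ α F Fs) :
    HasExpansion N κ α (fun t => avg (F t)) (fun j => avg (Fs j)) where
  coe j hj := (hF.coe j hj).avg (by
    have : (j : ℝ) + 1 ≤ N := by exact_mod_cast hj
    linarith [ho.sub_one_le])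
  near := hF.near.near_avg (by linarith)
  far := by
    have := hF.sq_mul.far_prim ho (by linarith)
    refine ((this.far_mul Coe.inv_sq.far).weight_congr fun t r m => by congr 1 <;> ring).congr
      fun t r m => ?_
    simp only [CSS.avg, div_eq_mul_inv, sub_mul, Finset.sum_mul, mul_assoc]

/-! ### The nonlinearity -/

/-- The potential of the nonlinear equation: `spatialPart (-2) u = lapTwo u + potential u * u`. -/
def potential (u : ℝ → ℂ) : ℝ → ℂ :=
  let a := fun r : ℝ => u r * (starRingEnd ℂ) (u r)
  let p := avg a
  let b := fun r : ℝ => (r : ℂ) ^ 2 * p r * a r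
  fun r : ℝ => (-2) * p r + (-1 / 4) * ((r : ℂ) ^ 2 * p r * p r)
    + prim (fun r => 2 * a r + (1 / 2) * b r) r + a r

/-- The coefficients of `potential u` when `u` has coefficients `Z`. -/
def potentialCoeff (Z : ℕ → ℝ → ℂ) : ℕ → ℝ → ℂ :=
  let a := conv Z (fun j r => (starRingEnd ℂ) (Z j r))
  let p := fun j => avg (a j)
  let b := conv (fun j r => (r : ℂ) ^ 2 * p j r) a
  fun j r => (-2) * p j r + (-1 / 4) * conv (fun j r => (r : ℂ) ^ 2 * p j r) p j r
    + prim (fun r => 2 * a j r + (1 / 2) * b j r) r + a j r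

/-- The potential is built from |F|², of size r^{2α}, so integration from 0 only asks for 2κ < 2α.
-/
theorem HasExpansion.potential (ho : ExpansionOrder N κ) (hκ : κ < α)
    (hF : HasExpansion N κ α F Fs) :
    HasExpansion N κ (2 * α) (fun t => potential (F t)) (potentialCoeff Fs) := by
  have := ho.nonneg
  have ha : HasExpansion N κ (2 * α) (fun t r => F t r * (starRingEnd ℂ) (F t r)) _ :=
    (hF.mul ho hF.conj).mono (by linarith)
  have hp := ha.avg ho (by linarith)
  have hb := (hp.sq_mul.mul ho ha).mono (β := 2 * α) (by linarith)
  have hq := (hp.sq_mul.mul ho hp).mono (β := 2 * α) (by linarith)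
  exact (((hp.const_mul (-2)).add (hq.const_mul (-1 / 4))).add
    (((ha.const_mul 2).add (hb.const_mul (1 / 2))).prim ho (by linarith))).add ha

end Expansion

/-! ### The equation in terms of `lapTwo` and `potential` -/

theorem ofReal_Atheta (u : ℝ → ℂ) {r : ℝ} (hr : 0 < r) :
    (Atheta u r : ℂ) = -(1 / 2) * ((r : ℂ) ^ 2 * avg (fun r => u r * (starRingEnd ℂ) (u r)) r) := by
  have h0 : (r : ℂ) ≠ 0 := by exact_mod_cast hr.ne'
  have h : ∀ s : ℝ, (((‖u s‖ ^ 2 * s : ℝ)) : ℂ) =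
      (s : ℂ) ^ 2 * (u s * (starRingEnd ℂ) (u s)) / s := by
    intro s
    rw [Complex.mul_conj']
    rcases eq_or_ne s 0 with rfl | hs
    · simp
    · have : (s : ℂ) ≠ 0 := by exact_mod_cast hs
      push_cast
      field_simp
  rw [Atheta, Complex.ofReal_mul, ← intervalIntegral.integral_ofReal]
  simp only [h]
  rw [avg, mul_div_cancel₀ _ (pow_ne_zero 2 h0), prim]
  push_cast
  rfl

theorem ofReal_phaseRotatedAt (u : ℝ → ℂ) {r : ℝ} (hr : 0 < r) :
    (phaseRotatedAt (-2) u r : ℂ) = -prim (fun r => 2 * (u r * (starRingEnd ℂ) (u r)) + (1 / 2) *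
      ((r : ℂ) ^ 2 * avg (fun r => u r * (starRingEnd ℂ) (u r)) r * (u r * (starRingEnd ℂ) (u r)))) r := by
  rw [phaseRotatedAt, ← intervalIntegral.integral_ofReal, prim, ← intervalIntegral.integral_neg]
  refine intervalIntegral.integral_congr_ae (Eventually.of_forall fun s hs => ?_)
  rw [uIoc_of_le hr.le] at hs
  push_cast
  rw [ofReal_Atheta u hs.1, ← Complex.mul_conj']
  ring

/-- With P = `avg` of |u|² one has A_θ = −r²P/2, hence (−2 + A_θ)²/r² = 4/r² + 2P + r²P²/4. The term
4/r² belongs to `lapTwo`, the rest to the potential. -/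
theorem spatialPart_eq {u : ℝ → ℂ} {r : ℝ} (hr : 0 < r) (hd : DifferentiableAt ℝ (deriv u) r) :
    spatialPart (-2) u r = lapTwo u r + potential u r * u r := by
  have h0 : (r : ℂ) ≠ 0 := by exact_mod_cast hr.ne'
  have h2 : rdr (rdr u) r = r * (deriv u r + r * deriv (deriv u) r) := by
    have h1 : HasDerivAt (fun r : ℝ => (r : ℂ)) 1 r := (hasDerivAt_id (r : ℂ)).comp_ofReal
    have h3 : deriv (rdr u) r = _ := (h1.mul hd.hasDerivAt).deriv
    rw [rdr, h3, one_mul]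
  rw [spatialPart, lapTwo, h2, ofReal_phaseRotatedAt u hr, potential]
  push_cast
  rw [ofReal_Atheta u hr, ← Complex.mul_conj']
  field_simp
  ring

/-! ### The coefficients of the correction -/

section Coeff

variable {X Y X' Y' Z Z' : ℕ → ℝ → ℂ} {α β : ℝ} {j : ℕ}

theorem Coe.conv (hX : ∀ i ≤ j, Coe (α - 2 * i) (X i)) (hY : ∀ i ≤ j, Coe (β - 2 * i) (Y i)) :
    Coe (α + β - 2 * j) (conv X Y j) :=
  Coe.sum _ fun p hp => by
    have hp' := Finset.HasAntidiagonal.mem_antidiagonal.1 hp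
    refine ((hX p.1 (by omega)).mul (hY p.2 (by omega))).mono (le_of_eq ?_)
    rw [← hp']; push_cast; ring

theorem conv_congr (hX : ∀ i ≤ j, X i = X' i) (hY : ∀ i ≤ j, Y i = Y' i) :
    conv X Y j = conv X' Y' j := by
  ext r
  refine Finset.sum_congr rfl fun p hp => ?_
  have hp' := Finset.HasAntidiagonal.mem_antidiagonal.1 hp
  rw [hX p.1 (by omega), hY p.2 (by omega)]

/-- The coefficient of t^j involves only lower or equal orders, which makes the recursion for the
correction well founded. -/
theorem potentialCoeff_congr (h : ∀ i ≤ j, Z i = Z' i) : potentialCoeff Z j = potentialCoeff Z' j := by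
  have ha : ∀ i ≤ j, CSS.conv Z (fun j r => (starRingEnd ℂ) (Z j r)) i =
      CSS.conv Z' (fun j r => (starRingEnd ℂ) (Z' j r)) i := fun i hi =>
    conv_congr (fun l hl => h l (hl.trans hi)) fun l hl => by rw [h l (hl.trans hi)]
  have hp : ∀ i ≤ j, (fun r : ℝ => (r : ℂ) ^ 2 * avg (CSS.conv Z (fun j r => (starRingEnd ℂ) (Z j r)) i) r) =
      fun r : ℝ => (r : ℂ) ^ 2 * avg (CSS.conv Z' (fun j r => (starRingEnd ℂ) (Z' j r)) i) r :=
    fun i hi => by rw [ha i hi]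
  simp only [potentialCoeff]
  rw [conv_congr hp ha, conv_congr hp fun i hi => by rw [ha i hi], ha j le_rfl]

/-- The j-th coefficient of |u|² has size r^{2α−2j}; integration against ds/s from 0 requires j < α.
-/
theorem Coe.potentialCoeff (hα : j < α) (h : ∀ i ≤ j, Coe (α - 2 * i) (Z i)) :
    Coe (2 * α - 2 * j) (potentialCoeff Z j) := by
  have hj : ∀ i ≤ j, (i : ℝ) ≤ j := fun i hi => by exact_mod_cast hi
  have ha : ∀ i ≤ j, Coe (2 * α - 2 * i) (CSS.conv Z (fun j r => (starRingEnd ℂ) (Z j r)) i) :=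
    fun i hi => (Coe.conv (fun l hl => h l (hl.trans hi)) fun l hl =>
      (h l (hl.trans hi)).conj).mono (by linarith)
  have hp := fun i (hi : i ≤ j) => (ha i hi).avg (by linarith [hj i hi])
  have hp2 : ∀ i ≤ j, Coe (2 * α + 2 - 2 * i) _ := fun i hi => (hp i hi).sq_mul.mono (by linarith)
  have hα0 : 0 < α := (Nat.cast_nonneg j).trans_lt hα
  have hb := (Coe.conv hp2 ha).mono (b := 2 * α - 2 * j) (by linarith)
  have hq := (Coe.conv hp2 hp).mono (b := 2 * α - 2 * j) (by linarith)
  exact ((((hp j le_rfl).const_mul (-2)).add (hq.const_mul (-1 / 4))).add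
    ((((ha j le_rfl).const_mul 2).add (hb.const_mul (1 / 2))).prim (by linarith))).add (ha j le_rfl)

end Coeff

/-- The commutator of `lapTwo` with the multiplication by `h`. -/
def lapComm (h f : ℝ → ℂ) (r : ℝ) : ℂ := (rdr (rdr h) r * f r + 2 * rdr h r * rdr f r) / (r : ℂ) ^ 2

theorem lapTwo_mul {h f : ℝ → ℂ} {S : Set ℝ} (hS : IsOpen S) (hh : ContDiffOn ℝ ∞ h S)
    (hf : ContDiffOn ℝ ∞ f S) {r : ℝ} (hr : r ∈ S) :
    lapTwo (fun r => h r * f r) r = h r * lapTwo f r + lapComm h f r := by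
  have hd : ∀ {g : ℝ → ℂ}, ContDiffOn ℝ ∞ g S → ∀ s ∈ S, DifferentiableAt ℝ g s := fun hg s hs =>
    (hg.contDiffAt (hS.mem_nhds hs)).differentiableAt (by simp)
  have hh1 := contDiffOn_rdr hS hh
  have hf1 := contDiffOn_rdr hS hf
  have h1 : rdr (rdr (fun r => h r * f r)) r = rdr (fun r => rdr h r * f r + h r * rdr f r) r := by
    refine rdr_congr ?_
    filter_upwards [hS.mem_nhds hr] with s hs using rdr_mul_of_diff (hd hh s hs) (hd hf s hs)
  rw [lapTwo, h1, rdr_add_of_diff (f := fun r => rdr h r * f r) (g := fun r => h r * rdr f r)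
    ((hd hh1 r hr).mul (hd hf r hr)) ((hd hh r hr).mul (hd hf1 r hr)),
    rdr_mul_of_diff (hd hh1 r hr) (hd hf r hr), rdr_mul_of_diff (hd hh r hr) (hd hf1 r hr), lapTwo,
    lapComm]
  ring

/-! ### The cutoff and the recursion for the correction -/

section Cutoff

variable {χ : ℝ → ℝ}

theorem IsCutoff.contDiff (hχ : IsCutoff χ) : ContDiff ℝ ∞ (fun r => (χ r : ℂ)) :=
  Complex.ofRealCLM.contDiff.comp hχ.1

theorem rdr_of_const_on {f : ℝ → ℂ} {S : Set ℝ} (hS : IsOpen S) {c : ℂ} (h : ∀ r ∈ S, f r = c) {r : ℝ}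
    (hr : r ∈ S) : rdr f r = 0 := by
  rw [rdr_congr (g := fun _ => c) (by filter_upwards [hS.mem_nhds hr] using h)]
  simp [rdr]

theorem IsCutoff.eq_zero (hχ : IsCutoff χ) {r : ℝ} (hr : 2 < r) : (χ r : ℂ) = 0 := by
  rw [hχ.2.2 r (hr.le.trans (le_abs_self r)), Complex.ofReal_zero]

theorem IsCutoff.eq_one (hχ : IsCutoff χ) {r : ℝ} (h0 : 0 < r) (hr : r < 1) : (χ r : ℂ) = 1 := by
  rw [hχ.2.1 r (by rw [abs_of_pos h0]; exact hr.le), Complex.ofReal_one]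

theorem IsCutoff.rdr_eq_zero (hχ : IsCutoff χ) {r : ℝ} (hr : r ∈ Ioo 0 1 ∪ Ioi 2) :
    rdr (fun r => (χ r : ℂ)) r = 0 := by
  rcases hr with h | h
  · exact rdr_of_const_on isOpen_Ioo (fun s hs => hχ.eq_one hs.1 hs.2) h
  · exact rdr_of_const_on isOpen_Ioi (fun s hs => hχ.eq_zero hs) h

theorem Coe.of_contDiff {h : ℝ → ℂ} (hh : ContDiff ℝ ∞ h) : Coe 0 h := fun k =>
  Sym.of_contDiff hh (isCompact_Icc (a := (0 : ℝ)) (b := 3)) isOpen_empty (by simp) zero_le_one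
    fun t r m => by simp [m.2.1.le, m.2.2.le]

theorem one_le_two_rpow_mul {r : ℝ} (h1 : 1 / 2 ≤ r) (h2 : r ≤ 2) (b : ℝ) : 1 ≤ 2 ^ |b| * r ^ b := by
  have hr : 0 < r := by linarith
  rcases le_total 0 b with h | h
  · rw [abs_of_nonneg h, ← Real.mul_rpow (by norm_num) hr.le]
    exact Real.one_le_rpow (by linarith) h
  · rw [abs_of_nonpos h, Real.rpow_neg (by norm_num), ← Real.inv_rpow (by norm_num),
      ← Real.mul_rpow (by norm_num) hr.le]
    exact Real.one_le_rpow_of_pos_of_le_one_of_nonpos (by positivity) (by linarith) h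

theorem Coe.of_support {h : ℝ → ℂ} (hh : ContDiff ℝ ∞ h) (h0 : ∀ r ∈ Ioo (0 : ℝ) 1 ∪ Ioi 2, h r = 0)
    (b : ℝ) : Coe b h := fun k =>
  Sym.of_contDiff hh (isCompact_Icc (a := (1 : ℝ)) (b := 2)) (isOpen_Ioo.union isOpen_Ioi) h0
    (D := 2 ^ |b|) (by positivity) fun t r m => by
      refine ⟨Real.rpow_nonneg m.2.1.le b, fun hr => ?_⟩
      simp only [mem_union, mem_Ioo, mem_Ioi, not_or, not_and, not_lt] at hr
      exact ⟨⟨hr.1 m.2.1, hr.2⟩, one_le_two_rpow_mul (by linarith [hr.1 m.2.1]) hr.2 b⟩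

theorem IsCutoff.coe_rdr (hχ : IsCutoff χ) (b : ℝ) : Coe b (rdr (fun r => (χ r : ℂ))) :=
  Coe.of_support (contDiff_rdr hχ.contDiff) (fun _ hr => hχ.rdr_eq_zero hr) b

/-- The commutator is supported in 1 ≤ r ≤ 2, where all powers of r are comparable, so b is free. -/
theorem IsCutoff.coe_lapComm (hχ : IsCutoff χ) {a : ℝ} (b : ℝ) {f : ℝ → ℂ} (hf : Coe a f) :
    Coe b (lapComm (fun r => (χ r : ℂ)) f) := by
  have h := ((((hχ.coe_rdr (b + 2 - a)).rdr.mul hf).add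
    (((hχ.coe_rdr (b + 2 - a)).const_mul 2).mul hf.rdr))).div_sq
  rw [show b + 2 - a + a - 2 = b by ring] at h
  exact h

/-- The `j`-th coefficient of the expansion of the radiation. -/
def radCoeff (χ : ℝ → ℝ) (ν : ℂ) (c : ℕ → ℂ) (W : ℕ → ℝ → ℂ) (j : ℕ) (r : ℝ) : ℂ :=
  χ r * (c j * (r : ℂ) ^ (ν - 2 * j)) + W j r

/-- The coefficient following `W j` in the expansion of the correction. -/
def corrStep (χ : ℝ → ℝ) (ν : ℂ) (c : ℕ → ℂ) (W : ℕ → ℝ → ℂ) (j : ℕ) (r : ℝ) : ℂ :=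
  Complex.I / (j + 1) * (lapTwo (W j) r
    + conv (potentialCoeff (radCoeff χ ν c W)) (radCoeff χ ν c W) j r
    + lapComm (fun r => (χ r : ℂ)) (fun r : ℝ => c j * (r : ℂ) ^ (ν - 2 * j)) r)

variable {ν : ℂ} {c : ℕ → ℂ} {W W' : ℕ → ℝ → ℂ}

theorem corrStep_congr {j : ℕ} (h : ∀ i ≤ j, W i = W' i) :
    corrStep χ ν c W j = corrStep χ ν c W' j := by
  have hZ : ∀ i ≤ j, radCoeff χ ν c W i = radCoeff χ ν c W' i := fun i hi => by
    ext r; rw [radCoeff, radCoeff, h i hi]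
  ext r
  rw [corrStep, corrStep, h j le_rfl,
    conv_congr (fun i hi => potentialCoeff_congr fun l hl => hZ l (hl.trans hi)) hZ]

theorem lapTwo_eq_zero {f : ℝ → ℂ} {S : Set ℝ} (hS : IsOpen S) (h : ∀ r ∈ S, f r = 0) {r : ℝ}
    (hr : r ∈ S) : lapTwo f r = 0 := by
  rw [lapTwo, rdr_of_const_on hS (fun s hs => rdr_of_const_on hS h hs) hr, h r hr]
  simp

theorem lapComm_eq_zero {h : ℝ → ℂ} (f : ℝ → ℂ) {S : Set ℝ} (hS : IsOpen S) {c : ℂ}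
    (hc : ∀ r ∈ S, h r = c) {r : ℝ} (hr : r ∈ S) : lapComm h f r = 0 := by
  rw [lapComm, rdr_of_const_on hS (fun s hs => rdr_of_const_on hS hc hs) hr, rdr_of_const_on hS hc hr]
  simp

theorem Coe.radCoeff (hχ : IsCutoff χ) (hν : 0 < ν.re) {j : ℕ} (hW : Coe (3 * ν.re + 2 - 2 * j) (W j)) :
    Coe (ν.re - 2 * j) (radCoeff χ ν c W j) := by
  have hg : Coe (ν.re - 2 * j) (fun r : ℝ => c j * (r : ℂ) ^ (ν - 2 * j)) := by
    have := (Coe.cpow (ν - 2 * j)).const_mul (c j)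
    simpa using this
  refine (((Coe.of_contDiff hχ.contDiff).mul hg).mono (by linarith)).add (hW.mono (by linarith))

/-- Each step applies `lapTwo`, which costs r^{-2}, and adds the nonlinear coefficient of size r^{3
Re ν − 2j} and a compactly supported commutator. The step from n to n + 1 needs n < Re ν for the
nonlocal coefficients, which is the bound on N. -/
theorem exists_correction (hχ : IsCutoff χ) (hν : 0 < ν.re) (c : ℕ → ℂ) (N : ℕ) (hN : (N : ℝ) < ν.re + 1) :
    ∃ W : ℕ → ℝ → ℂ, W 0 = 0 ∧ (∀ j ≤ N, Coe (3 * ν.re + 2 - 2 * j) (W j)) ∧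
      (∀ j ≤ N, ∀ r, 2 < r → W j r = 0) ∧ ∀ j < N, W (j + 1) = corrStep χ ν c W j := by
  induction N with
  | zero =>
    refine ⟨0, rfl, fun j _ => Coe.zero, fun j _ r _ => rfl, fun j hj => absurd hj (by simp)⟩
  | succ n ih =>
    push_cast at hN
    obtain ⟨W, hW0, hWc, hWs, hWr⟩ := ih (by linarith)
    -- Changing the entry n + 1 does not affect the earlier recursion relations, by
    -- `corrStep_congr`.
    set W' := Function.update W (n + 1) (corrStep χ ν c W n) with hW'
    have hne : ∀ j ≤ n, W' j = W j := fun j hj => Function.update_of_ne (by omega) _ _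
    have heq : W' (n + 1) = corrStep χ ν c W n := Function.update_self _ _ _
    have hZ : ∀ i ≤ n, Coe (ν.re - 2 * i) (radCoeff χ ν c W i) := fun i hi =>
      Coe.radCoeff hχ hν (hWc i hi)
    have hNL : Coe (3 * ν.re - 2 * n)
        (conv (potentialCoeff (radCoeff χ ν c W)) (radCoeff χ ν c W) n) := by
      refine (Coe.conv (α := 2 * ν.re) (fun i hi => Coe.potentialCoeff ?_ fun l hl =>
        hZ l (hl.trans hi)) hZ).mono (by linarith)
      have : (i : ℝ) ≤ n := by exact_mod_cast hi
      linarith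
    have hg : Coe (ν.re - 2 * n) (fun r : ℝ => c n * (r : ℂ) ^ (ν - 2 * n)) := by
      have := (Coe.cpow (ν - 2 * n)).const_mul (c n)
      simpa using this
    refine ⟨W', by rw [hne 0 (Nat.zero_le n), hW0], fun j hj => ?_, fun j hj r hr => ?_, fun j hj => ?_⟩
    · rcases Nat.le_succ_iff.1 hj with hj | rfl
      · rw [hne j hj]; exact hWc j hj
      · rw [Nat.succ_eq_add_one, heq]
        refine ((((hWc n le_rfl).lapTwo.mono ?_).add (hNL.mono ?_)).add
          (hχ.coe_lapComm _ hg)).const_mul _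
        · push_cast; linarith
        · push_cast; linarith
    · rcases Nat.le_succ_iff.1 hj with hj | rfl
      · rw [hne j hj]; exact hWs j hj r hr
      · rw [Nat.succ_eq_add_one, heq, corrStep, lapTwo_eq_zero isOpen_Ioi (hWs n le_rfl) hr,
          lapComm_eq_zero _ isOpen_Ioi (fun s hs => hχ.eq_zero hs) hr, conv,
          Finset.sum_eq_zero, add_zero, add_zero, mul_zero]
        intro p hp
        have hp' := Finset.HasAntidiagonal.mem_antidiagonal.1 hp
        rw [radCoeff, hχ.eq_zero hr, hWs p.2 (by omega) r hr]
        ring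
    · rw [corrStep_congr (W' := W) fun i hi => hne i (by omega)]
      rcases Nat.lt_succ_iff_lt_or_eq.1 hj with hj | rfl
      · rw [hne (j + 1) (by omega), hWr j hj]
      · exact heq

end Cutoff

/-! ### The radiation -/

/-- The radii above `1/2`. -/
def zoneBump : Zone where
  mem _ y := 1 / 2 < y
  isOpen_slice _ := isOpen_Ioi
  pos m := lt_trans (by norm_num) m

/-- On the support r ≤ 2|t|^{1/2}, so in this zone |t|/r² is bounded above and below there and every
exponent l is admissible. -/
theorem sym_far_bump {h : ℝ → ℂ} (hh : ContDiff ℝ ∞ h) (h0 : ∀ r ∈ Ioi (2 : ℝ), h r = 0) (l : ℝ)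
    (k : ℕ) : Sym zoneFar (pw 0 l) k (fun t r => h (r / √|t|)) := by
  have h1 : Sym zoneBump (fun _ y => y ^ (-2 * l)) k (fun _ => h) :=
    Sym.of_contDiff hh (isCompact_Icc (a := (1 / 2 : ℝ)) (b := 2)) isOpen_Ioi h0
      (D := 2 ^ |-2 * l|) (by positivity) fun t r m => by
        refine ⟨Real.rpow_nonneg (zoneBump.pos m).le _, fun hr => ?_⟩
        have m' : 1 / 2 < r := m
        exact ⟨⟨m'.le, not_lt.1 hr⟩, one_le_two_rpow_mul m'.le (not_lt.1 hr) _⟩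
  refine ((h1.comp (U := zoneFar) (e := id) (c := fun t => 1 / √|t|) (p := 1)
    fun t r m => ?_).weight_congr fun t r m => ?_).congr fun t r m => ?_
  · have h2 : 0 < √|t| := Real.sqrt_pos.2 (abs_pos.2 m.1.1)
    change 1 / 2 < 1 / √|t| * r ^ 1
    rw [pow_one, one_div_mul_eq_div, lt_div_iff₀ h2]
    linarith [m.2.1]
  · have ht := abs_pos.2 m.1.1
    have hr := zoneFar.pos m
    rw [pw_zero_left, pow_one, one_div_mul_eq_div, neg_mul, Real.rpow_neg (by positivity),
      Real.rpow_mul (by positivity), ← Real.inv_rpow (by positivity), Real.rpow_two, div_pow,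
      Real.sq_sqrt ht.le, inv_div]
  · rw [pow_one, one_div_mul_eq_div]

/-- The ingredients of the radiation: the solution `G` of the confluent equation, the coefficients
`c` of the expansion of the linear solution, and the coefficients `W` of the correction. -/
structure RadData (χ : ℝ → ℝ) (q ν : ℂ) (N : ℕ) where
  G : ℝ → ℂ
  c : ℕ → ℂ
  W : ℕ → ℝ → ℂ
  cutoff : IsCutoff χ
  re_pos : 0 < ν.re
  confluent : Confluent (1 - ν / 2) G
  c_zero : c 0 = q
  far_linSol : ∀ M k : ℕ, ν.re + 1 - k ≤ M →
    Sym zoneFar (pw ν.re (ν.re + 1 - k)) k (fun t r => linSol q ν G t r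
      - ∑ j ∈ Finset.range M, (t : ℂ) ^ j * (c j * (r : ℂ) ^ (ν - 2 * j)))
  W_zero : W 0 = 0
  W_coe : ∀ j ≤ N, Coe (3 * ν.re + 2 - 2 * j) (W j)
  W_support : ∀ j ≤ N, ∀ r, 2 < r → W j r = 0
  W_succ : ∀ j < N, W (j + 1) = corrStep χ ν c W j

theorem nonempty_radData {χ : ℝ → ℝ} (hχ : IsCutoff χ) (q : ℂ) {ν : ℂ} (hν : 0 < ν.re) {N : ℕ}
    (hN : (N : ℝ) < ν.re + 1) : Nonempty (RadData χ q ν N) := by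
  have ha : (1 - ν / 2).re ≤ 1 := by
    rw [show (2 : ℂ) = ((2 : ℝ) : ℂ) by norm_num, Complex.sub_re, Complex.div_ofReal_re,
      Complex.one_re]
    linarith
  obtain ⟨G, hG⟩ := exists_confluent ha
  obtain ⟨c, hc0, hc⟩ := exists_far_linSol (q := q) hν hG
  obtain ⟨W, h0, h1, h2, h3⟩ := exists_correction hχ hν c N hN
  exact ⟨⟨G, c, W, hχ, hν, hG, hc0, hc, h0, h1, h2, h3⟩⟩

/-! ### Definition and size of the radiation -/

namespace RadData

variable {χ : ℝ → ℝ} {q ν : ℂ} {N : ℕ} (D : RadData χ q ν N) {κ : ℝ} {k : ℕ} {t r : ℝ}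

/-- The coefficients of the linear solution. -/
def g (j : ℕ) (r : ℝ) : ℂ := D.c j * (r : ℂ) ^ (ν - 2 * j)

/-- The correction. -/
def V (t r : ℝ) : ℂ := ∑ j ∈ Finset.range (N + 1), (t : ℂ) ^ j * D.W j r

/-- The coefficients of the radiation. -/
def Z : ℕ → ℝ → ℂ := radCoeff χ ν D.c D.W

/-- The linear solution. -/
def lin (t r : ℝ) : ℂ := linSol q ν D.G t r

/-- The cutoff to `r ≥ |t|^{1/2}`. -/
def eta (_ : RadData χ q ν N) (t r : ℝ) : ℂ := 1 - χ (r / √|t|)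

/-- The radiation. -/
def z (t r : ℝ) : ℂ := if t = 0 then profile χ q ν r else χ r * D.lin t r + D.eta t r * D.V t r

theorem z_of_ne (ht : t ≠ 0) (r : ℝ) : D.z t r = χ r * D.lin t r + D.eta t r * D.V t r := by
  rw [z, if_neg ht]

theorem coe_g (j : ℕ) : Coe (ν.re - 2 * j) (D.g j) := by
  have := (Coe.cpow (ν - 2 * j)).const_mul (D.c j)
  rw [show (ν - 2 * j).re = ν.re - 2 * j by simp] at this
  exact this

theorem coe_χ (D : RadData χ q ν N) : Coe 0 (fun r => (χ r : ℂ)) := Coe.of_contDiff D.cutoff.contDiff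

theorem coe_Z {j : ℕ} (hj : j ≤ N) : Coe (ν.re - 2 * j) (D.Z j) :=
  Coe.radCoeff D.cutoff D.re_pos (D.W_coe j hj)

/-- Terms of index at least M have order at least M ≥ κ and may be moved into the remainder, so the
length of the expansion can be chosen freely. -/
theorem far_lin_sub (M : ℕ) (h : κ ≤ M) (h' : κ ≤ ν.re + 1 - k) :
    Sym zoneFar (pw ν.re κ) k (fun t r => D.lin t r - ∑ j ∈ Finset.range M, (t : ℂ) ^ j * D.g j r) := by
  set M' := max M ⌈ν.re + 1⌉₊ with hM'
  have h1 := D.far_linSol M' k (by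
    have h2 : (⌈ν.re + 1⌉₊ : ℝ) ≤ M' := by exact_mod_cast le_max_right _ _
    linarith [Nat.le_ceil (ν.re + 1), (Nat.cast_nonneg k : (0 : ℝ) ≤ k)])
  have h3 : Sym zoneFar (pw ν.re κ) k (fun t r => ∑ j ∈ Finset.Ico M M', (t : ℂ) ^ j * D.g j r) :=
    Sym.sum _ fun j hj => (D.coe_g j).far_time_pow.far_mono le_rfl (h.trans (by
      exact_mod_cast (Finset.mem_Ico.1 hj).1))
  refine ((h1.far_mono le_rfl h').add h3).congr fun t r m => ?_
  rw [← Finset.sum_range_add_sum_Ico _ (le_max_left M ⌈ν.re + 1⌉₊), lin]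
  simp only [g]
  ring

theorem far_V : Sym zoneFar (pw (3 * ν.re + 2) 0) k D.V :=
  Sym.sum _ fun j hj => (D.W_coe j (Nat.lt_succ_iff.1 (Finset.mem_range.1 hj))).far_time_pow.far_mono
    le_rfl (Nat.cast_nonneg j)

theorem far_one_sub_eta (l : ℝ) : Sym zoneFar (pw 0 l) k (fun t r => 1 - D.eta t r) :=
  (sym_far_bump D.cutoff.contDiff (fun r hr => D.cutoff.eq_zero hr) l k).congr fun t r m => by
    rw [eta]; ring

theorem far_eta : Sym zoneFar (pw 0 0) k D.eta :=
  (((Sym.const 1).weight_congr fun t r m => by simp [pw]).sub (D.far_one_sub_eta 0)).congr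
    fun t r m => by ring

theorem sqrt_pos_of_ne {t : ℝ} (ht : t ≠ 0) : 0 < √|t| := Real.sqrt_pos.2 (abs_pos.2 ht)

theorem eta_eq_zero (ht : t ≠ 0) (hr : r ∈ Ioo 0 (√|t|)) : D.eta t r = 0 := by
  have h := sqrt_pos_of_ne ht
  rw [eta, D.cutoff.eq_one (div_pos hr.1 h) ((div_lt_one h).2 hr.2), sub_self]

theorem z_near (m : zoneNear.mem t r) : D.z t r = D.lin t r := by
  rw [D.z_of_ne m.1.1, D.eta_eq_zero m.1.1 m.2, D.cutoff.eq_one m.2.1 (zoneNear_le_one m)]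
  ring

theorem z_sub_sum (ht : t ≠ 0) (M : ℕ) : D.z t r - ∑ j ∈ Finset.range M, (t : ℂ) ^ j * D.Z j r =
    χ r * (D.lin t r - ∑ j ∈ Finset.range M, (t : ℂ) ^ j * D.g j r) +
      (D.eta t r * D.V t r - ∑ j ∈ Finset.range M, (t : ℂ) ^ j * D.W j r) := by
  rw [D.z_of_ne ht]
  simp only [Z, radCoeff, g, mul_add, Finset.sum_add_distrib, mul_sub, Finset.mul_sum]
  have : ∀ j, (t : ℂ) ^ j * (χ r * (D.c j * (r : ℂ) ^ (ν - 2 * j))) =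
      χ r * ((t : ℂ) ^ j * (D.c j * (r : ℂ) ^ (ν - 2 * j))) := fun j => by ring
  simp only [this]
  ring

/-- The linear solution with one derivative allows κ up to Re ν + 1 − 1. Replacing η by 1 costs
nothing, because 1 − η is a bump at r ≲ |t|^{1/2}. -/
theorem hasExpansion_z (ho : ExpansionOrder N κ) (hκ : κ ≤ ν.re) :
    HasExpansion N κ ν.re D.z D.Z where
  coe j hj := D.coe_Z hj.le
  near := (sym_near_linSol D.confluent 1).congr fun t r m => (D.z_near m).symm
  far := by
    have hν := D.re_pos
    have h1 : Sym zoneFar (pw ν.re κ) 1 _ := ((D.coe_χ).far.far_mul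
      (D.far_lin_sub N ho.le (k := 1) (by push_cast; linarith))).weight_congr
        fun t r m => by congr 1 <;> ring
    have h2 : Sym zoneFar (pw ν.re κ) 1 (fun t r => (1 - D.eta t r) *
        ∑ j ∈ Finset.range N, (t : ℂ) ^ j * D.W j r) := by
      refine ((D.far_one_sub_eta κ).far_mul (Sym.sum _ fun j hj =>
        (D.W_coe j (Finset.mem_range.1 hj).le).far_time_pow.far_mono (b := ν.re) (l := 0)
        (by linarith) (Nat.cast_nonneg j))).far_mono (by linarith) (by linarith)
    -- V contains one power of t more than the expansion; it has order N ≥ κ.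
    have h3 : Sym zoneFar (pw ν.re κ) 1 (fun t r => D.eta t r * ((t : ℂ) ^ N * D.W N r)) :=
      (D.far_eta.far_mul (D.W_coe N le_rfl).far_time_pow).far_mono (by linarith) (by linarith [ho.le])
    refine ((h1.sub h2).add h3).congr fun t r m => ?_
    rw [D.z_sub_sum m.1.1, V, Finset.sum_range_succ]
    ring

/-- The non-oscillating terms lose nothing under r∂_r; only the remainder of the linear solution
carries the loss in k. -/
theorem far_z (k : ℕ) : ∃ C, 0 ≤ C ∧ ∀ t r, zoneFar.mem t r →
    absPos k (D.z t) r ≤ C * (pw ν.re 0 t r + pw ν.re (ν.re + 1 - k) t r) := by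
  have hν := D.re_pos
  set M := ⌈ν.re + 1⌉₊
  have hM : ν.re + 1 ≤ M := Nat.le_ceil _
  have hpos : ∀ {a κ t r}, zoneFar.mem t r → 0 < pw a κ t r := fun m => pw_pos m.1.1 (zoneFar.pos m)
  have h1 := ((D.coe_χ).far.far_mul (D.far_lin_sub (κ := ν.re + 1 - k) (k := k) M
    (by linarith [(Nat.cast_nonneg k : (0 : ℝ) ≤ k)]) le_rfl)).far_mono
    (b := ν.re) (l := ν.re + 1 - k) (by linarith) (by linarith)
  have h2 : Sym zoneFar (pw ν.re 0) k (fun t r => χ r * ∑ j ∈ Finset.range M, (t : ℂ) ^ j * D.g j r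
      + D.eta t r * D.V t r) := by
    refine (((D.coe_χ).far.far_mul (Sym.sum _ fun j _ => (D.coe_g j).far_time_pow.far_mono le_rfl
      (Nat.cast_nonneg j))).far_mono (by linarith) (by linarith)).add
      ((D.far_eta.far_mul D.far_V).far_mono (by linarith) (by linarith))
  refine ((((h1.mono zero_le_one fun t r m => ?_).add (h2.mono zero_le_one fun t r m => ?_)).congr
    fun t r m => ?_) : Sym zoneFar (fun t r => pw ν.re 0 t r + pw ν.re (ν.re + 1 - k) t r) k
      D.z).absPos_le
  · rw [one_mul]; exact le_add_of_nonneg_left (hpos m).le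
  · rw [one_mul]; exact le_add_of_nonneg_right (hpos m).le
  · rw [D.z_of_ne m.1.1]; ring

theorem z_eq_zero (hr : 2 < r) : D.z t r = 0 := by
  have h1 := D.cutoff.eq_zero hr
  by_cases ht : t = 0
  · rw [z, if_pos ht, profile, h1, mul_zero]
  · rw [D.z_of_ne ht, h1, V, Finset.sum_eq_zero fun j hj => by
      rw [D.W_support j (Nat.lt_succ_iff.1 (Finset.mem_range.1 hj)) r hr, mul_zero]]
    ring

theorem contDiff_lin (t : ℝ) : ContDiff ℝ ∞ (D.lin t) := by
  refine contDiff_const.mul ((Complex.ofRealCLM.contDiff.pow 2).mul (D.confluent.smooth.comp ?_))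
  exact contDiff_const.mul (contDiff_id.pow 2)

theorem contDiff_eta (t : ℝ) : ContDiff ℝ ∞ (D.eta t) :=
  contDiff_const.sub (D.cutoff.contDiff.comp (contDiff_id.div_const _))

theorem contDiffOn_Ioi {f : ℝ → ℂ} (h : ContDiffOn ℝ ∞ f (Ioo 0 3)) (h0 : ∀ r, 2 < r → f r = 0) :
    ContDiffOn ℝ ∞ f (Ioi 0) := by
  intro r hr
  refine ContDiffAt.contDiffWithinAt ?_
  rcases lt_or_ge r 3 with h3 | h3
  · exact h.contDiffAt (Ioo_mem_nhds hr h3)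
  · refine (contDiffAt_const (c := (0 : ℂ))).congr_of_eventuallyEq ?_
    filter_upwards [Ioi_mem_nhds (show 2 < r by linarith)] with s hs using h0 s hs

theorem contDiffOn_V (t : ℝ) : ContDiffOn ℝ ∞ (D.V t) (Ioo 0 3) :=
  ContDiffOn.sum fun j hj => contDiffOn_const.mul
    (D.W_coe j (Nat.lt_succ_iff.1 (Finset.mem_range.1 hj))).contDiffOn

theorem contDiffOn_z (ht : t ≠ 0) : ContDiffOn ℝ ∞ (D.z t) (Ioi 0) := by
  refine contDiffOn_Ioi ?_ fun r hr => D.z_eq_zero hr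
  exact ((D.cutoff.contDiff.mul (D.contDiff_lin t)).contDiffOn.add
    ((D.contDiff_eta t).contDiffOn.mul (D.contDiffOn_V t))).congr fun r _ => D.z_of_ne ht r

end RadData

/-! ### The error -/

theorem diff_of_contDiffOn {f : ℝ → ℂ} {S : Set ℝ} (hS : IsOpen S) (hf : ContDiffOn ℝ ∞ f S) {r : ℝ}
    (hr : r ∈ S) : DifferentiableAt ℝ f r :=
  (hf.contDiffAt (hS.mem_nhds hr)).differentiableAt (by simp)

theorem rdr_time_sum {n : ℕ} {F : ℕ → ℝ → ℂ} (x : ℂ) {r : ℝ} (h : ∀ j < n, DifferentiableAt ℝ (F j) r) :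
    rdr (fun r => ∑ j ∈ Finset.range n, x ^ j * F j r) r =
      ∑ j ∈ Finset.range n, x ^ j * rdr (F j) r := by
  induction n with
  | zero => simp [rdr]
  | succ n ih =>
    simp only [Finset.sum_range_succ]
    rw [rdr_add_of_diff (DifferentiableAt.fun_sum fun j hj =>
      (h j (by have := Finset.mem_range.1 hj; omega)).const_mul _) ((h n n.lt_succ_self).const_mul _),
      ih fun j hj => h j (by omega), rdr_const_mul]

theorem lapTwo_time_sum {n : ℕ} {F : ℕ → ℝ → ℂ} (x : ℂ) {S : Set ℝ} (hS : IsOpen S)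
    (h : ∀ j < n, ContDiffOn ℝ ∞ (F j) S) {r : ℝ} (hr : r ∈ S) :
    lapTwo (fun r => ∑ j ∈ Finset.range n, x ^ j * F j r) r =
      ∑ j ∈ Finset.range n, x ^ j * lapTwo (F j) r := by
  have h1 : rdr (rdr fun r => ∑ j ∈ Finset.range n, x ^ j * F j r) r =
      rdr (fun r => ∑ j ∈ Finset.range n, x ^ j * rdr (F j) r) r := by
    refine rdr_congr ?_
    filter_upwards [hS.mem_nhds hr] with s hs using
      rdr_time_sum x fun j hj => diff_of_contDiffOn hS (h j hj) hs
  rw [lapTwo, h1, rdr_time_sum x fun j hj => diff_of_contDiffOn hS (contDiffOn_rdr hS (h j hj)) hr,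
    Finset.mul_sum, ← Finset.sum_sub_distrib, Finset.sum_div]
  exact Finset.sum_congr rfl fun j _ => by rw [lapTwo]; ring

theorem lapTwo_add {f g : ℝ → ℂ} {S : Set ℝ} (hS : IsOpen S) (hf : ContDiffOn ℝ ∞ f S)
    (hg : ContDiffOn ℝ ∞ g S) {r : ℝ} (hr : r ∈ S) :
    lapTwo (fun r => f r + g r) r = lapTwo f r + lapTwo g r := by
  have h1 : rdr (rdr fun r => f r + g r) r = rdr (fun r => rdr f r + rdr g r) r := by
    refine rdr_congr ?_
    filter_upwards [hS.mem_nhds hr] with s hs using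
      rdr_add_of_diff (diff_of_contDiffOn hS hf hs) (diff_of_contDiffOn hS hg hs)
  rw [lapTwo, h1, rdr_add_of_diff (diff_of_contDiffOn hS (contDiffOn_rdr hS hf) hr)
    (diff_of_contDiffOn hS (contDiffOn_rdr hS hg) hr), lapTwo, lapTwo]
  ring

theorem lapComm_time_sum (h : ℝ → ℂ) {n : ℕ} {F : ℕ → ℝ → ℂ} (x : ℂ) {r : ℝ}
    (hd : ∀ j < n, DifferentiableAt ℝ (F j) r) :
    lapComm h (fun r => ∑ j ∈ Finset.range n, x ^ j * F j r) r =
      ∑ j ∈ Finset.range n, x ^ j * lapComm h (F j) r := by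
  rw [lapComm, rdr_time_sum x hd, Finset.mul_sum, Finset.mul_sum, ← Finset.sum_add_distrib,
    Finset.sum_div]
  exact Finset.sum_congr rfl fun j _ => by rw [lapComm]; ring

theorem lapComm_sub (h : ℝ → ℂ) {f g : ℝ → ℂ} {r : ℝ} (hf : DifferentiableAt ℝ f r)
    (hg : DifferentiableAt ℝ g r) :
    lapComm h (fun r => f r - g r) r = lapComm h f r - lapComm h g r := by
  have : rdr (fun r => f r - g r) r = rdr f r - rdr g r := by
    simp only [rdr]; rw [deriv_fun_sub hf hg]; ring
  rw [lapComm, this, lapComm, lapComm]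
  ring

theorem hasDerivAt_div_sqrt_abs (r : ℝ) {t : ℝ} (ht : t ≠ 0) :
    HasDerivAt (fun t => r / √|t|) (-(r / √|t|) / (2 * t)) t := by
  have hp := abs_pos.2 ht
  have hs := Real.sqrt_pos.2 hp
  have h1 := (((hasDerivAt_abs ht).sqrt hp.ne').inv hs.ne').const_mul r
  refine h1.congr_deriv ?_
  have h2 : (SignType.sign t : ℝ) * |t| = t := sign_mul_abs t
  have h3 : (SignType.sign t : ℝ) * t = |t| := sign_mul_self t
  rw [Real.sq_sqrt hp.le]
  field_simp
  linear_combination (-r) * h3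

/-- The commutator contains one derivative of F, hence one order is lost; its support in 1 ≤ r ≤ 2
again makes the power b arbitrary. -/
theorem Sym.lapComm_cutoff {χ : ℝ → ℝ} (hχ : IsCutoff χ) {F : ℝ → ℝ → ℂ} {a κ : ℝ} {k : ℕ} (b : ℝ)
    (hF : Sym zoneFar (pw a κ) (k + 1) F) :
    Sym zoneFar (pw b κ) k (fun t => lapComm (fun r => (χ r : ℂ)) (F t)) := by
  have h1 := ((hχ.coe_rdr (b + 2 - a)).rdr.far (k := k)).far_mul (hF.of_le k.le_succ)
  have h2 := (((hχ.coe_rdr (b + 2 - a)).const_mul 2).far (k := k)).far_mul hF.rdr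
  refine (((h1.add h2).far_mul (Coe.inv_sq.far (k := k))).weight_congr fun t r m => ?_).congr
    fun t r m => ?_
  · congr 1 <;> ring
  · rw [lapComm, div_eq_mul_inv]

theorem Sym.all_of_near_far {w : ℝ → ℝ → ℝ} {F : ℝ → ℝ → ℂ} {k : ℕ}
    (hw : ∀ t r, zoneAll.mem t r → 0 ≤ w t r) (hn : Sym zoneNear w k F) (hf : Sym zoneFar w k F) :
    Sym zoneAll w k F := by
  have key : ∀ {F}, BddBy zoneNear w F → BddBy zoneFar w F → BddBy zoneAll w F := by
    rintro F ⟨C, hC, h⟩ ⟨D, hD, h'⟩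
    refine ⟨C + D, by positivity, fun t r m => ?_⟩
    rw [add_mul]
    rcases zoneAll_near_or_far m with m' | m'
    · exact (h t r m').trans (le_add_of_nonneg_right (mul_nonneg hD (hw t r m)))
    · exact (h' t r m').trans (le_add_of_nonneg_left (mul_nonneg hC (hw t r m)))
  induction k generalizing F with
  | zero => exact key hn hf
  | succ k ih =>
    refine ⟨key hn.bdd hf.bdd, fun t r m => ?_, ih hn.rdr hf.rdr⟩
    rcases zoneAll_near_or_far m with m' | m'
    · exact hn.diff m'
    · exact hf.diff m'

/-! ### The error term and its pointwise bounds -/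

namespace RadData

variable {χ : ℝ → ℝ} {q ν : ℂ} {N : ℕ} (D : RadData χ q ν N) {κ δ : ℝ} {k : ℕ} {t r : ℝ}

/-- The time derivative of the correction. -/
def Vt (t r : ℝ) : ℂ := ∑ j ∈ Finset.range N, (t : ℂ) ^ j * ((j + 1) * D.W (j + 1) r)

/-- The time derivative of the cutoff. -/
def etat (_ : RadData χ q ν N) (t r : ℝ) : ℂ := rdr (fun r => (χ r : ℂ)) (r / √|t|) / (2 * t)

/-- The time derivative of the radiation. -/
def zt (t r : ℝ) : ℂ :=
  χ r * (Complex.I * lapTwo (D.lin t) r) + (D.etat t r * D.V t r + D.eta t r * D.Vt t r)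

/-- The error of the radiation in the nonlinear equation. -/
def Psi (t r : ℝ) : ℂ := Complex.I * D.zt t r + spatialPart (-2) (D.z t) r

/-- The coefficients of the nonlinearity. -/
def NL : ℕ → ℝ → ℂ := conv (potentialCoeff D.Z) D.Z

theorem hasDerivAt_V (t r : ℝ) : HasDerivAt (fun t => D.V t r) (D.Vt t r) t := by
  have h : ∀ j ∈ Finset.range (N + 1), HasDerivAt (fun t : ℝ => (t : ℂ) ^ j * D.W j r)
      (j * (t : ℂ) ^ (j - 1) * D.W j r) t := fun j _ => by
    refine ((((hasDerivAt_id (t : ℂ)).comp_ofReal).fun_pow j).congr_deriv ?_).mul_const _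
    simp
  refine (HasDerivAt.fun_sum h).congr_deriv ?_
  rw [Finset.sum_range_succ', Vt]
  simp only [Nat.cast_zero, zero_mul, add_zero, Nat.add_sub_cancel]
  exact Finset.sum_congr rfl fun j _ => by push_cast; ring

theorem hasDerivAt_eta (ht : t ≠ 0) (r : ℝ) : HasDerivAt (fun t => D.eta t r) (D.etat t r) t := by
  have h1 := (D.cutoff.contDiff.differentiable (by simp) (r / √|t|)).hasDerivAt
  have h2 := (HasDerivAt.scomp t h1 (hasDerivAt_div_sqrt_abs r ht)).const_sub 1
  refine h2.congr_deriv ?_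
  rw [etat, rdr, Complex.real_smul]
  push_cast
  ring

theorem hasDerivAt_z (ht : t ≠ 0) (hr : 0 < r) : HasDerivAt (fun t => D.z t r) (D.zt t r) t := by
  have h := ((lapTwo_linSol (q := q) D.confluent ht hr).const_mul (χ r : ℂ)).add
    ((D.hasDerivAt_eta ht r).mul (D.hasDerivAt_V t r))
  refine (h.congr_of_eventuallyEq ?_).congr_deriv rfl
  filter_upwards [isOpen_ne.mem_nhds ht] with s hs using D.z_of_ne hs r

theorem lapTwo_z (ht : t ≠ 0) (hr : r ∈ Ioo (0 : ℝ) 3) : lapTwo (D.z t) r =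
    χ r * lapTwo (D.lin t) r + lapComm (fun r => (χ r : ℂ)) (D.lin t) r +
      (D.eta t r * lapTwo (D.V t) r + lapComm (D.eta t) (D.V t) r) := by
  have h1 := D.cutoff.contDiff.contDiffOn (s := Ioo 0 3)
  have h2 := (D.contDiff_lin t).contDiffOn (s := Ioo 0 3)
  have h3 := (D.contDiff_eta t).contDiffOn (s := Ioo 0 3)
  have h4 := D.contDiffOn_V t
  rw [show D.z t = _ from funext (D.z_of_ne ht), lapTwo_add isOpen_Ioo (h1.mul h2) (h3.mul h4) hr,
    lapTwo_mul isOpen_Ioo h1 h2 hr, lapTwo_mul isOpen_Ioo h3 h4 hr]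

theorem Psi_eq (ht : t ≠ 0) (hr : 0 < r) :
    D.Psi t r = Complex.I * D.zt t r + lapTwo (D.z t) r + potential (D.z t) r * D.z t r := by
  have h := (contDiffOn_infty_iff_deriv_of_isOpen isOpen_Ioi).1 (D.contDiffOn_z ht)
  rw [Psi, spatialPart_eq hr (diff_of_contDiffOn isOpen_Ioi h.2 hr)]
  ring

/-- Here χ = 1 and η = 0, and z solves the linear equation exactly. -/
theorem Psi_near (m : zoneNear.mem t r) : D.Psi t r = potential (D.z t) r * D.z t r := by
  have hr : r ∈ Ioo (0 : ℝ) 3 := (zoneNear_all m).2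
  have h1 : lapComm (D.eta t) (D.V t) r = 0 :=
    lapComm_eq_zero _ isOpen_Ioo (fun s hs => D.eta_eq_zero m.1.1 hs) m.2
  have h2 : lapComm (fun r => (χ r : ℂ)) (D.lin t) r = 0 :=
    lapComm_eq_zero _ isOpen_Ioo (fun s hs => D.cutoff.eq_one hs.1 hs.2) ⟨m.2.1, zoneNear_le_one m⟩
  have h3 := sqrt_pos_of_ne m.1.1
  have h4 : D.etat t r = 0 := by
    rw [etat, D.cutoff.rdr_eq_zero (Or.inl ⟨div_pos m.2.1 h3, (div_lt_one h3).2 m.2.2⟩), zero_div]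
  rw [D.Psi_eq m.1.1 m.2.1, D.lapTwo_z m.1.1 hr, zt, h1, h2, h4, D.eta_eq_zero m.1.1 m.2]
  linear_combination (χ r * lapTwo (D.lin t) r) * Complex.I_sq

/-- The recursion cancels the orders below N where η = 1. What survives is, in turn: the commutator
of χ with the remainder of the linear solution, the uncancelled orders where η ≠ 1, the error of the
expanded nonlinearity, the last term of V, and the derivatives falling on η. -/
theorem Psi_far (m : zoneFar.mem t r) : D.Psi t r =
    lapComm (fun r => (χ r : ℂ)) (fun r => D.lin t r - ∑ j ∈ Finset.range N, (t : ℂ) ^ j * D.g j r) r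
    + (1 - D.eta t r) * ∑ j ∈ Finset.range N, (t : ℂ) ^ j * (lapComm (fun r => (χ r : ℂ)) (D.g j) r + D.NL j r)
    + (potential (D.z t) r * D.z t r - ∑ j ∈ Finset.range N, (t : ℂ) ^ j * D.NL j r)
    + D.eta t r * ((t : ℂ) ^ N * lapTwo (D.W N) r)
    + Complex.I * (D.etat t r * D.V t r) + lapComm (D.eta t) (D.V t) r := by
  have hr : r ∈ Ioo (0 : ℝ) 3 := (zoneFar_all m).2
  have hg : ∀ j < N, DifferentiableAt ℝ (D.g j) r := fun j _ =>
    diff_of_contDiffOn isOpen_Ioo (D.coe_g j).contDiffOn hr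
  have h1 := lapComm_sub (fun r => (χ r : ℂ)) ((D.contDiff_lin t).differentiable (by simp) r)
    (DifferentiableAt.fun_sum (u := Finset.range N) fun j hj =>
      (hg j (Finset.mem_range.1 hj)).const_mul ((t : ℂ) ^ j))
  rw [lapComm_time_sum _ _ hg] at h1
  have h2 : lapTwo (D.V t) r = ∑ j ∈ Finset.range (N + 1), (t : ℂ) ^ j * lapTwo (D.W j) r :=
    lapTwo_time_sum _ isOpen_Ioo (fun j hj => (D.W_coe j (Nat.lt_succ_iff.1 hj)).contDiffOn) hr
  -- The time derivative of V is by construction minus the sum of all sources of order below N.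
  have h3 : Complex.I * D.Vt t r = -∑ j ∈ Finset.range N, (t : ℂ) ^ j *
      (lapTwo (D.W j) r + D.NL j r + lapComm (fun r => (χ r : ℂ)) (D.g j) r) := by
    rw [Vt, Finset.mul_sum, ← Finset.sum_neg_distrib]
    refine Finset.sum_congr rfl fun j hj => ?_
    have hj0 : (j : ℂ) + 1 ≠ 0 := by exact_mod_cast j.succ_ne_zero
    have h4 : ((j : ℂ) + 1) * D.W (j + 1) r = Complex.I *
        (lapTwo (D.W j) r + D.NL j r + lapComm (fun r => (χ r : ℂ)) (D.g j) r) := by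
      rw [D.W_succ j (Finset.mem_range.1 hj), corrStep, ← mul_assoc,
        show ((j : ℂ) + 1) * (Complex.I / (j + 1)) = Complex.I by field_simp]
      rfl
    rw [h4]
    linear_combination ((t : ℂ) ^ j *
      (lapTwo (D.W j) r + D.NL j r + lapComm (fun r => (χ r : ℂ)) (D.g j) r)) * Complex.I_sq
  rw [D.Psi_eq m.1.1 hr.1, D.lapTwo_z m.1.1 hr, zt, h1, h2, Finset.sum_range_succ]
  simp only [mul_add, Finset.sum_add_distrib] at h3 ⊢
  linear_combination (χ r * lapTwo (D.lin t) r) * Complex.I_sq + D.eta t r * h3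

theorem hasExpansion_NL (ho : ExpansionOrder N κ) (hκ : κ < ν.re) :
    HasExpansion N κ (3 * ν.re) (fun t r => potential (D.z t) r * D.z t r) D.NL := by
  have h := D.hasExpansion_z ho hκ.le
  exact ((h.potential ho hκ).mul ho h).mono (by linarith)

/-- The factor 1/t from differentiating the cutoff in time is paid by one more power of |t|/r²,
which is free on the support of the bump. -/
theorem far_etat_mul_V (l : ℝ) : Sym zoneFar (pw (3 * ν.re) l) k (fun t r => D.etat t r * D.V t r) := by
  have h1 : Sym zoneFar (pw 0 (l + 1)) k (fun t r => rdr (fun r => (χ r : ℂ)) (r / √|t|)) :=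
    sym_far_bump (contDiff_rdr D.cutoff.contDiff) (fun r hr => D.cutoff.rdr_eq_zero (Or.inr hr)) _ _
  have h2 : Sym zoneFar (pw (-2) (-1)) k (fun t _ => 1 / (2 * (t : ℂ))) := by
    refine (Sym.of_time (b := fun t => |t| ^ (-1 : ℝ)) 1 zero_le_one fun t r m => ?_).weight_congr
      fun t r m => by rw [← pw_two_mul (zoneFar.pos m)]; norm_num
    have := abs_pos.2 m.1.1
    rw [norm_div, norm_mul, Complex.norm_real, Real.rpow_neg_one, Real.norm_eq_abs, norm_one,
      Complex.norm_ofNat, one_mul, one_div]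
    exact inv_anti₀ this (by linarith)
  refine (((h1.far_mul h2).far_mul D.far_V).weight_congr fun t r m => ?_).congr fun t r m => ?_
  · congr 1 <;> ring
  · rw [etat]; ring

theorem far_lapComm_eta (l : ℝ) : Sym zoneFar (pw (3 * ν.re) l) k
    (fun t => lapComm (D.eta t) (D.V t)) := by
  have h := D.far_one_sub_eta (k := k + 2) l
  have hV := D.far_V (k := k + 1)
  refine ((((h.rdr.rdr.far_mul (hV.of_le k.le_succ)).add
    (((h.rdr.of_le k.le_succ).const_mul 2).far_mul hV.rdr)).neg.far_mul
    (Coe.inv_sq.far (k := k))).weight_congr fun t r m => ?_).congr fun t r m => ?_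
  · congr 1 <;> ring
  · have h1 : rdr (fun r => 1 - D.eta t r) = fun r => -rdr (D.eta t) r := by
      ext r; simp only [rdr]; rw [deriv_const_sub]; ring
    have h2 : rdr (fun r => -rdr (D.eta t) r) r = -rdr (rdr (D.eta t)) r := by
      change (r : ℂ) * deriv (fun r => -rdr (D.eta t) r) r = -((r : ℂ) * deriv (rdr (D.eta t)) r)
      rw [deriv.fun_neg]; ring
    rw [h1, h2, lapComm, div_eq_mul_inv]
    ring

/-- The commutator with the linear remainder is set apart because it is the only term whose bound
deteriorates with derivatives through the oscillation at r ∼ 1. -/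
theorem far_Psi_sub (ho : ExpansionOrder N κ) (hκ : κ < ν.re) :
    Sym zoneFar (pw (3 * ν.re) κ) 1 (fun t r => D.Psi t r - lapComm (fun r => (χ r : ℂ))
      (fun r => D.lin t r - ∑ j ∈ Finset.range N, (t : ℂ) ^ j * D.g j r) r) := by
  have hNL := D.hasExpansion_NL ho hκ
  have h1 : Sym zoneFar (pw (3 * ν.re) κ) 1 (fun t r => (1 - D.eta t r) * ∑ j ∈ Finset.range N,
      (t : ℂ) ^ j * (lapComm (fun r => (χ r : ℂ)) (D.g j) r + D.NL j r)) := by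
    refine ((D.far_one_sub_eta κ).far_mul (Sym.sum _ fun j hj => (Coe.far_time_pow
      ((D.cutoff.coe_lapComm _ (D.coe_g j)).add (hNL.coe j (Finset.mem_range.1 hj)))).far_mono le_rfl
      (Nat.cast_nonneg j))).far_mono (by linarith) (by linarith)
  have h2 : Sym zoneFar (pw (3 * ν.re) κ) 1 (fun t r => D.eta t r * ((t : ℂ) ^ N * lapTwo (D.W N) r)) :=
    (D.far_eta.far_mul (Coe.far_time_pow (a := 3 * ν.re)
      ((D.W_coe N le_rfl).lapTwo.mono (by linarith)))).far_mono (by linarith) (by linarith [ho.le])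
  refine ((((h1.add hNL.far).add h2).add ((D.far_etat_mul_V κ).const_mul Complex.I)).add
    (D.far_lapComm_eta κ)).congr fun t r m => ?_
  rw [D.Psi_far m]
  ring

theorem near_Psi (ho : ExpansionOrder N κ) (hκ : κ < ν.re) {a l : ℝ} (ha : a ≤ 3 * ν.re)
    (hl : a / 2 - 1 ≤ l) : Sym zoneNear (pw a l) 1 D.Psi :=
  (((D.hasExpansion_NL ho hκ).near.near_scale 1 ha).near_mono hl).congr fun _ _ m =>
    (D.Psi_near m).symm

/-- The pointwise bound for the error. -/
theorem Psi_bound (ho : ExpansionOrder N κ) (hκ : κ < ν.re) (hδ : δ ≤ 1 / 4)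
    (hδκ : (ν.re - 1) / 2 + δ ≤ κ) :
    Sym zoneAll (pw (ν.re - 2 + 4 * δ) ((ν.re - 1) / 2 + δ)) 0 D.Psi := by
  have hν := D.re_pos
  refine Sym.all_of_near_far (fun _ _ m => (pw_pos m.1.1 m.2.1).le)
    ((D.near_Psi ho hκ (by linarith) (by linarith)).of_le zero_le_one) ?_
  -- One derivative of the linear remainder is used by the commutator, so the exponent may go up to
  -- Re ν.
  have h1 := (D.far_lin_sub (k := 1) N ho.le (by push_cast; linarith)).lapComm_cutoff D.cutoff
    (3 * ν.re)
  exact (((h1.add ((D.far_Psi_sub ho hκ).of_le zero_le_one)).far_mono (by linarith) hδκ)).congr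
    fun t r m => by ring

/-- The pointwise bound for the error and its derivative. -/
theorem Psi_deriv_bound (ho : ExpansionOrder N κ) (hκ : κ < ν.re) (hδ : δ ≤ 1 / 4)
    (hδκ : (ν.re - 1) / 2 + δ ≤ κ) (hδν : δ ≤ ν.re / 2) :
    Sym zoneAll (pw (ν.re - 2 + 4 * δ) ((ν.re - 2) / 2 + δ)) 1 D.Psi := by
  have hν := D.re_pos
  refine Sym.all_of_near_far (fun _ _ m => (pw_pos m.1.1 m.2.1).le)
    (D.near_Psi ho hκ (by linarith) (by linarith)) ?_
  -- The commutator and the extra derivative together allow only Re ν − 1, and (Re ν − 2)/2 + δ ≤ Re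
  -- ν − 1 is the condition δ ≤ Re ν/2.
  have h1 := (D.far_lin_sub (k := 2) (κ := (ν.re - 2) / 2 + δ) N (by linarith [ho.le])
    (by push_cast; linarith)).lapComm_cutoff D.cutoff (ν.re - 2 + 4 * δ)
  exact (h1.add ((D.far_Psi_sub ho hκ).far_mono (by linarith) (by linarith))).congr
    fun t r m => by ring

theorem Psi_eq_zero (ht : t ≠ 0) (hr : 2 < r) : D.Psi t r = 0 := by
  have hz : ∀ s ∈ Ioi (2 : ℝ), D.z t s = 0 := fun s hs => D.z_eq_zero hs
  have hV : D.V t r = 0 := Finset.sum_eq_zero fun j hj => by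
    rw [D.W_support j (Nat.lt_succ_iff.1 (Finset.mem_range.1 hj)) r hr, mul_zero]
  have hVt : D.Vt t r = 0 := Finset.sum_eq_zero fun j hj => by
    have := Finset.mem_range.1 hj
    rw [D.W_support (j + 1) (by omega) r hr, mul_zero, mul_zero]
  rw [D.Psi_eq ht (by linarith), zt, hV, hVt, D.cutoff.eq_zero hr, lapTwo_eq_zero isOpen_Ioi hz hr,
    D.z_eq_zero hr]
  ring

end RadData

/-! ### Smoothness -/

section Smooth

variable {f : ℝ → ℂ} {F : ℝ → ℝ → ℂ} {Fs : ℕ → ℝ → ℂ} {α t : ℝ} {N : ℕ} {κ : ℝ}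

theorem contDiffOn_inv {S : Set ℝ} (hS : S ⊆ Ioi 0) : ContDiffOn ℝ ∞ (fun r : ℝ => (r : ℂ)⁻¹) S :=
  Complex.ofRealCLM.contDiff.contDiffOn.inv fun r hr => by
    have : 0 < r := hS hr
    simp [this.ne']

theorem contDiffOn_prim (hf : ContDiffOn ℝ ∞ f (Ioo 0 3))
    (hi : ∀ r ∈ Ioo (0 : ℝ) 3, IntervalIntegrable (fun s : ℝ => f s / s) volume 0 r) :
    ContDiffOn ℝ ∞ (prim f) (Ioo 0 3) := by
  have h : ∀ r ∈ Ioo (0 : ℝ) 3, HasDerivAt (prim f) (f r / r) r := fun r hr =>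
    hasDerivAt_prim hr.1 (hi r hr) (Ioo_mem_nhds hr.1 hr.2) hf.continuousOn
  rw [contDiffOn_infty_iff_deriv_of_isOpen isOpen_Ioo]
  refine ⟨fun r hr => (h r hr).differentiableAt.differentiableWithinAt, ?_⟩
  exact (hf.mul (contDiffOn_inv fun r hr => hr.1)).congr fun r hr => by
    rw [(h r hr).deriv, div_eq_mul_inv]

theorem contDiffOn_div_sq (hf : ContDiffOn ℝ ∞ f (Ioo 0 3)) :
    ContDiffOn ℝ ∞ (fun r => f r / (r : ℂ) ^ 2) (Ioo 0 3) :=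
  (hf.mul ((contDiffOn_inv (S := Ioo 0 3) fun r hr => hr.1).pow 2)).congr fun r _ => by
    rw [div_eq_mul_inv, inv_pow]

theorem contDiffOn_sq_mul (hf : ContDiffOn ℝ ∞ f (Ioo 0 3)) :
    ContDiffOn ℝ ∞ (fun r : ℝ => (r : ℂ) ^ 2 * f r) (Ioo 0 3) :=
  (Complex.ofRealCLM.contDiff.pow 2).contDiffOn.mul hf

theorem contDiffOn_lapTwo (hf : ContDiffOn ℝ ∞ f (Ioo 0 3)) :
    ContDiffOn ℝ ∞ (lapTwo f) (Ioo 0 3) :=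
  contDiffOn_div_sq ((contDiffOn_rdr isOpen_Ioo (contDiffOn_rdr isOpen_Ioo hf)).sub
    (contDiffOn_const.mul hf))

theorem contDiffOn_conj (hf : ContDiffOn ℝ ∞ f (Ioo 0 3)) :
    ContDiffOn ℝ ∞ (fun r => (starRingEnd ℂ) (f r)) (Ioo 0 3) :=
  Complex.conjCLE.contDiff.comp_contDiffOn hf

theorem expansionOrder_zero : ExpansionOrder 0 0 := ⟨le_rfl, by simp, by simp⟩

/-- The version without terms records only sizes, which is all that integrability at r = 0, and
hence smoothness of the nonlocal terms, requires. -/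
theorem HasExpansion.toZero (ho : ExpansionOrder N κ) (h : HasExpansion N κ α F Fs) :
    HasExpansion 0 0 α F Fs where
  coe j hj := absurd hj (by simp)
  near := h.near
  far := (h.far_self ho).congr fun t r _ => by simp

theorem HasExpansion.prim_integrable (h : HasExpansion 0 0 α F Fs) (hα : 0 < α) {r : ℝ}
    (m : zoneAll.mem t r) : IntervalIntegrable (fun s : ℝ => F t s / s) volume 0 r :=
  prim_integrable_near_far h.near (h.far_self expansionOrder_zero) (by linarith) (by linarith) m

theorem HasExpansion.contDiffOn_prim (h : HasExpansion 0 0 α F Fs) (hα : 0 < α) (ht : t ≠ 0 ∧ |t| ≤ 1)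
    (hF : ContDiffOn ℝ ∞ (F t) (Ioo 0 3)) : ContDiffOn ℝ ∞ (CSS.prim (F t)) (Ioo 0 3) :=
  CSS.contDiffOn_prim hF fun _ hr => h.prim_integrable hα ⟨ht, hr⟩

theorem HasExpansion.contDiffOn_avg (h : HasExpansion 0 0 α F Fs) (hα : 0 < α) (ht : t ≠ 0 ∧ |t| ≤ 1)
    (hF : ContDiffOn ℝ ∞ (F t) (Ioo 0 3)) : ContDiffOn ℝ ∞ (CSS.avg (F t)) (Ioo 0 3) :=
  contDiffOn_div_sq (h.sq_mul.contDiffOn_prim (by linarith) ht (contDiffOn_sq_mul hF))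

theorem HasExpansion.normSq (h : HasExpansion 0 0 α F Fs) :
    HasExpansion 0 0 (2 * α) (fun t r => F t r * (starRingEnd ℂ) (F t r))
      (CSS.conv Fs fun j r => (starRingEnd ℂ) (Fs j r)) :=
  (h.mul expansionOrder_zero h.conj).mono (by linarith)

theorem HasExpansion.contDiffOn_potential (h : HasExpansion 0 0 α F Fs) (hα : 0 < α)
    (ht : t ≠ 0 ∧ |t| ≤ 1) (hF : ContDiffOn ℝ ∞ (F t) (Ioo 0 3)) :
    ContDiffOn ℝ ∞ (CSS.potential (F t)) (Ioo 0 3) := by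
  have ha := h.normSq
  have hp := ha.avg expansionOrder_zero (by linarith)
  have hb := (hp.sq_mul.mul expansionOrder_zero ha).mono (β := 2 * α) (by linarith)
  have sa := hF.mul (contDiffOn_conj hF)
  have sp := ha.contDiffOn_avg (by linarith) ht sa
  have sb := (contDiffOn_sq_mul sp).mul sa
  have sq := (contDiffOn_sq_mul sp).mul sp
  have s1 := ((ha.const_mul 2).add (hb.const_mul (1 / 2))).contDiffOn_prim (by linarith) ht
    ((contDiffOn_const.mul sa).add (contDiffOn_const.mul sb))
  exact (((contDiffOn_const.mul sp).add (contDiffOn_const.mul sq)).add s1).add sa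

/-- Near the origin r²(x/|x|)^{-2} is the square of the conjugate of x and h depends on |x|², so the
singular phase disappears. Elsewhere |x| is smooth. -/
theorem contDiff_equivariant {u h : ℝ → ℂ} {ρ : ℝ} (hu : ContDiffOn ℝ ∞ u (Ioi 0)) (hρ : 0 < ρ)
    (hh : ContDiff ℝ ∞ h) (h0 : ∀ r ∈ Ioo 0 ρ, u r = (r : ℂ) ^ 2 * h (r ^ 2)) :
    ContDiff ℝ ∞ (equivariant (-2) u) := by
  rw [contDiff_iff_contDiffAt]
  intro x
  rcases eq_or_ne x 0 with rfl | hx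
  · have h1 : ContDiff ℝ ∞ (fun x : ℂ => (starRingEnd ℂ x) ^ 2 * h (‖x‖ ^ 2)) :=
      (Complex.conjCLE.contDiff.pow 2).mul (hh.comp (contDiff_norm_sq ℝ))
    refine h1.contDiffAt.congr_of_eventuallyEq ?_
    filter_upwards [Metric.ball_mem_nhds (0 : ℂ) hρ] with x hx
    rw [mem_ball_zero_iff] at hx
    rcases eq_or_ne x 0 with rfl | hx0
    · simp [equivariant]
    · have hn : (‖x‖ : ℂ) ≠ 0 := by exact_mod_cast norm_ne_zero_iff.2 hx0
      have hc := Complex.mul_conj' x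
      rw [equivariant, h0 _ ⟨norm_pos_iff.2 hx0, hx⟩, zpow_neg, ← inv_zpow, inv_div]
      rw [show ((2 : ℤ)) = ((2 : ℕ) : ℤ) from rfl, zpow_natCast, div_pow]
      field_simp
      linear_combination (-(h (‖x‖ ^ 2)) * (‖x‖ ^ 2 + x * (starRingEnd ℂ) x)) * hc
  · have hn : 0 < ‖x‖ := norm_pos_iff.2 hx
    have h1 : ContDiffAt ℝ ∞ (fun x : ℂ => u ‖x‖) x :=
      (hu.contDiffAt (Ioi_mem_nhds hn)).comp x (contDiffAt_norm ℝ hx)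
    have h2 : ContDiffAt ℝ ∞ (fun x : ℂ => (‖x‖ : ℂ)) x :=
      Complex.ofRealCLM.contDiff.contDiffAt.comp x (contDiffAt_norm ℝ hx)
    have h3 : ContDiffAt ℝ ∞ (fun x : ℂ => (‖x‖ : ℂ) * x⁻¹) x := h2.mul (contDiffAt_id.inv hx)
    refine (h1.mul (h3.pow 2)).congr_of_eventuallyEq (Eventually.of_forall fun x => ?_)
    rw [equivariant, zpow_neg, ← inv_zpow, inv_div, show ((2 : ℤ)) = ((2 : ℕ) : ℤ) from rfl,
      zpow_natCast, div_eq_mul_inv]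

end Smooth

/-! ### The self-similar zone -/

/-- The zone is open, and the end point r = |t|^{1/2} is recovered by continuity from the left. -/
theorem absPos_le_of_near {w : ℝ → ℝ → ℝ} {f : ℝ → ℝ → ℂ} {k : ℕ} (hf : Sym zoneNear w k f)
    (hs : ∀ t, t ≠ 0 ∧ |t| ≤ 1 → ContDiffOn ℝ ∞ (f t) (Ioo 0 3))
    (hw : ∀ t, ContinuousOn (w t) (Ioi 0)) :
    ∃ C, 0 ≤ C ∧ ∀ t, t ≠ 0 ∧ |t| ≤ 1 → ∀ r, 0 < r → r ≤ √|t| → absPos k (f t) r ≤ C * w t r := by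
  obtain ⟨C, hC, h⟩ := hf.absPos_le
  refine ⟨C, hC, fun t ht r hr hrt => Finset.sup'_le _ _ fun j hj => ?_⟩
  have hr3 : r ∈ Ioo (0 : ℝ) 3 := ⟨hr, by linarith [Real.sqrt_le_one.2 ht.2]⟩
  have h1 : Tendsto (fun s => ‖(rdr^[j]) (f t) s‖) (𝓝[<] r) (𝓝 ‖(rdr^[j]) (f t) r‖) :=
    (((contDiffOn_rdr_iterate isOpen_Ioo (hs t ht) j).continuousOn.continuousAt
      (Ioo_mem_nhds hr3.1 hr3.2)).norm).tendsto.mono_left nhdsWithin_le_nhds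
  have h2 : Tendsto (fun s => C * w t s) (𝓝[<] r) (𝓝 (C * w t r)) :=
    (((hw t).continuousAt (Ioi_mem_nhds hr)).tendsto.mono_left nhdsWithin_le_nhds).const_mul C
  refine le_of_tendsto_of_tendsto h1 h2 ?_
  filter_upwards [Ioo_mem_nhdsLT hr] with s hs'
  exact (Finset.le_sup' (fun j => ‖(rdr^[j]) (f t) s‖) hj).trans
    (h t s ⟨ht, hs'.1, hs'.2.trans_le hrt⟩)

theorem continuousOn_pw (a κ t : ℝ) : ContinuousOn (pw a κ t) (Ioi 0) := by
  refine ContinuousOn.congr (f := fun r => |t| ^ κ * r ^ (a - 2 * κ)) ?_ fun r hr => pw_eq hr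
  exact continuousOn_const.mul fun r hr =>
    (Real.continuousAt_rpow_const r _ (Or.inl (ne_of_gt hr))).continuousWithinAt

theorem Coe.id : Coe 1 (fun r => (r : ℂ)) := (Coe.cpow 1).congr fun r _ => by simp

theorem Coe.inv : Coe (-1) (fun r => (r : ℂ)⁻¹) :=
  (by simpa using Coe.cpow (-1) : Coe (-1) _).congr fun r _ => by rw [Complex.cpow_neg_one]

/-! ### Smoothness and pointwise bounds of the radiation -/

namespace RadData

variable {χ : ℝ → ℝ} {q ν : ℂ} {N : ℕ} (D : RadData χ q ν N) {κ : ℝ} {k : ℕ} {t r : ℝ}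

theorem hasExpansion_zero_z (ho : ExpansionOrder N κ) (hκ : κ ≤ ν.re) :
    HasExpansion 0 0 ν.re D.z D.Z := (D.hasExpansion_z ho hκ).toZero ho

theorem contDiffOn_z' (ht : t ≠ 0) : ContDiffOn ℝ ∞ (D.z t) (Ioo 0 3) :=
  (D.contDiffOn_z ht).mono fun _ hr => hr.1

theorem contDiffOn_Psi (ho : ExpansionOrder N κ) (hκ : κ ≤ ν.re) (ht : t ≠ 0 ∧ |t| ≤ 1) :
    ContDiffOn ℝ ∞ (D.Psi t) (Ioi 0) := by
  refine contDiffOn_Ioi ?_ fun r hr => D.Psi_eq_zero ht.1 hr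
  have hz := D.contDiffOn_z' ht.1
  have hp := (D.hasExpansion_zero_z ho hκ).contDiffOn_potential D.re_pos ht hz
  have h1 : ContDiffOn ℝ ∞ (D.etat t) (Ioo 0 3) :=
    (((contDiff_rdr D.cutoff.contDiff).comp (contDiff_id.div_const (√|t|))).div_const _).contDiffOn
  have h2 : ContDiffOn ℝ ∞ (D.Vt t) (Ioo 0 3) := ContDiffOn.sum fun j hj => contDiffOn_const.mul
    (contDiffOn_const.mul (D.W_coe (j + 1) (by have := Finset.mem_range.1 hj; omega)).contDiffOn)
  have h3 : ContDiffOn ℝ ∞ (D.zt t) (Ioo 0 3) :=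
    (D.cutoff.contDiff.contDiffOn.mul (contDiffOn_const.mul
      (contDiffOn_lapTwo (D.contDiff_lin t).contDiffOn))).add
      ((h1.mul (D.contDiffOn_V t)).add ((D.contDiff_eta t).contDiffOn.mul h2))
  exact (((contDiffOn_const.mul h3).add (contDiffOn_lapTwo hz)).add (hp.mul hz)).congr
    fun r hr => D.Psi_eq ht.1 hr.1

theorem contDiff_equivariant_z (ht : t ≠ 0 ∧ |t| ≤ 1) : ContDiff ℝ ∞ (equivariant (-2) (D.z t)) := by
  refine contDiff_equivariant (ρ := √|t|) (h := fun x => leadCoeff q ν t * D.G (1 / (4 * t) * x))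
    (D.contDiffOn_z ht.1) (sqrt_pos_of_ne ht.1) ?_ fun r hr => ?_
  · exact contDiff_const.mul (D.confluent.smooth.comp (contDiff_const.mul contDiff_id))
  · rw [D.z_near ⟨ht, hr⟩, lin, linSol]; ring

theorem sym_near_z (k : ℕ) : Sym zoneNear (pw ν.re (ν.re / 2 - 1)) k D.z :=
  (sym_near_linSol D.confluent k).congr fun _ _ m => (D.z_near m).symm

/-- The radiation minus its leading term in the self-similar zone. -/
def rem (t r : ℝ) : ℂ := D.z t r - leadCoeff q ν t * (r : ℂ) ^ 2

theorem sym_near_rem (k : ℕ) : Sym zoneNear (pw ν.re (ν.re / 2 - 2)) k D.rem :=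
  (sym_near_linSol_sub D.confluent k).congr fun t r m => by rw [rem, D.z_near m, lin]

theorem rdr_rem (ht : t ≠ 0) (hr : 0 < r) :
    rdr (D.rem t) r = rdr (D.z t) r - 2 * leadCoeff q ν t * (r : ℂ) ^ 2 := by
  have h1 : HasDerivAt (fun r : ℝ => (r : ℂ) ^ 2) (2 * r) r := by
    refine (((hasDerivAt_id (r : ℂ)).comp_ofReal).fun_pow 2).congr_deriv ?_
    simp
  have h2 := ((diff_of_contDiffOn isOpen_Ioi (D.contDiffOn_z ht) hr).hasDerivAt).sub
    (h1.const_mul (leadCoeff q ν t))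
  have h3 : deriv (D.rem t) r = _ := h2.deriv
  rw [rdr, h3, rdr]; ring

/-- The operator ∂_r + 2/r sends the leading term to 4r times its coefficient. What remains is this
operator on `rem` and the cubic contribution of A_θ. -/
theorem covCR_eq (ht : t ≠ 0) (hr : 0 < r) :
    covCR (-2) (D.z t) (D.z t) r - 4 * leadCoeff q ν t * (r : ℂ) =
      (r : ℂ)⁻¹ * (rdr (D.rem t) r + 2 * D.rem t r) + (1 / 2) *
        ((r : ℂ) * avg (fun r => D.z t r * (starRingEnd ℂ) (D.z t r)) r * D.z t r) := by
  have h0 : (r : ℂ) ≠ 0 := by exact_mod_cast hr.ne'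
  rw [covCR, D.rdr_rem ht hr, rem, rdr]
  push_cast
  rw [ofReal_Atheta _ hr]
  field_simp
  ring

/-- The operator ∂_r − 2/r annihilates r², so only `rem` contributes. -/
theorem dMinus_eq (ht : t ≠ 0) (hr : 0 < r) :
    dMinus (-2) (D.z t) r = (r : ℂ)⁻¹ * (rdr (D.rem t) r + (-2) * D.rem t r) := by
  have h0 : (r : ℂ) ≠ 0 := by exact_mod_cast hr.ne'
  rw [dMinus, D.rdr_rem ht hr, rem, rdr]
  push_cast
  field_simp
  ring

theorem sym_near_rdr_rem_add (c : ℂ) (k : ℕ) : Sym zoneNear (pw (ν.re - 1) (ν.re / 2 - 2)) k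
    (fun t r => (r : ℂ)⁻¹ * (rdr (D.rem t) r + c * D.rem t r)) :=
  (Coe.inv.near.near_mul ((D.sym_near_rem (k + 1)).rdr.add ((D.sym_near_rem k).const_mul c))).weight_congr
    fun t r m => by congr 1 <;> ring

theorem sym_near_avg_mul (k : ℕ) : Sym zoneNear (pw (ν.re - 1) (ν.re / 2 - 2)) k
    (fun t r => (r : ℂ) * avg (fun r => D.z t r * (starRingEnd ℂ) (D.z t r)) r * D.z t r) := by
  have hν := D.re_pos
  have h1 := (((D.sym_near_z (k + 1)).near_mul (D.sym_near_z (k + 1)).conj).near_avg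
    (by linarith)).of_le k.le_succ
  have h2 := ((Coe.id.near.near_mul h1).near_mul (D.sym_near_z k)).near_mono
    -- Subtracting 3/2 fixes the power r³ of the target bound; the surplus is then a positive power
    -- of |t| ≤ 1.
    (l := (1 + (ν.re + ν.re) + ν.re) / 2 - 3 / 2) (by linarith)
  exact ((h2.near_scale (b := ν.re - 1) (3 / 2) (by linarith)).weight_congr
    fun _ _ _ => by congr 1; ring)

theorem contDiffOn_rem (ht : t ≠ 0) : ContDiffOn ℝ ∞ (D.rem t) (Ioo 0 3) :=
  (D.contDiffOn_z' ht).sub (contDiffOn_const.mul (Complex.ofRealCLM.contDiff.pow 2).contDiffOn)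

theorem contDiffOn_rdr_rem_add (c : ℂ) (ht : t ≠ 0) :
    ContDiffOn ℝ ∞ (fun r : ℝ => (r : ℂ)⁻¹ * (rdr (D.rem t) r + c * D.rem t r)) (Ioo 0 3) :=
  (contDiffOn_inv fun _ hr => hr.1).mul
    ((contDiffOn_rdr isOpen_Ioo (D.contDiffOn_rem ht)).add (contDiffOn_const.mul (D.contDiffOn_rem ht)))

theorem near_bounds (ho : ExpansionOrder N κ) (hκ : κ ≤ ν.re) (k : ℕ) :
    ∃ C : ℝ, ∀ t ∈ Icc (-1 : ℝ) 1, t ≠ 0 → ∀ r : ℝ, 0 < r → r ≤ √|t| →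
      absPos k (D.z t) r ≤ C * |t| ^ ((ν.re - 2) / 2) * r ^ 2 ∧
      absPos k (fun ρ => D.z t ρ - leadCoeff q ν t * (ρ : ℂ) ^ 2) r
        ≤ C * |t| ^ ((ν.re - 4) / 2) * r ^ 4 ∧
      absPos k (fun ρ => covCR (-2) (D.z t) (D.z t) ρ - 4 * leadCoeff q ν t * (ρ : ℂ)) r
        ≤ C * |t| ^ ((ν.re - 4) / 2) * r ^ 3 ∧
      absPos k (dMinus (-2) (D.z t)) r ≤ C * |t| ^ ((ν.re - 4) / 2) * r ^ 3 := by
  obtain ⟨C₁, hC₁, h₁⟩ := absPos_le_of_near (D.sym_near_z k)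
    (fun t ht => D.contDiffOn_z' ht.1) (fun t => continuousOn_pw _ _ t)
  obtain ⟨C₂, hC₂, h₂⟩ := absPos_le_of_near (D.sym_near_rem k)
    (fun t ht => D.contDiffOn_rem ht.1) (fun t => continuousOn_pw _ _ t)
  obtain ⟨C₃, hC₃, h₃⟩ := absPos_le_of_near (k := k)
    (f := fun t r => covCR (-2) (D.z t) (D.z t) r - 4 * leadCoeff q ν t * (r : ℂ))
    (((D.sym_near_rdr_rem_add 2 k).add ((D.sym_near_avg_mul k).const_mul (1 / 2))).congr
      fun t r m => (D.covCR_eq m.1.1 m.2.1).symm)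
    (fun t ht => by
      have hz := D.contDiffOn_z' ht.1
      have ha := (D.hasExpansion_zero_z ho hκ).normSq.contDiffOn_avg (by linarith [D.re_pos]) ht
        (hz.mul (contDiffOn_conj hz))
      exact ((D.contDiffOn_rdr_rem_add 2 ht.1).add (contDiffOn_const.mul
        ((Complex.ofRealCLM.contDiff.contDiffOn.mul ha).mul hz))).congr
          fun r hr => D.covCR_eq ht.1 hr.1) (fun t => continuousOn_pw _ _ t)
  obtain ⟨C₄, hC₄, h₄⟩ := absPos_le_of_near (k := k) (f := fun t => dMinus (-2) (D.z t))
    ((D.sym_near_rdr_rem_add (-2) k).congr fun t r m => (D.dMinus_eq m.1.1 m.2.1).symm)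
    (fun t ht => (D.contDiffOn_rdr_rem_add (-2) ht.1).congr fun r hr => D.dMinus_eq ht.1 hr.1)
    (fun t => continuousOn_pw _ _ t)
  refine ⟨C₁ + C₂ + C₃ + C₄, fun t ht ht0 r hr hrt => ?_⟩
  have htp := abs_pos.2 ht0
  have ht' : t ≠ 0 ∧ |t| ≤ 1 := ⟨ht0, abs_le.2 ht⟩
  have key : ∀ {c a e x : ℝ} {n : ℕ}, x ≤ c * pw a e t r → a - 2 * e = n → c ≤ C₁ + C₂ + C₃ + C₄ →
      x ≤ (C₁ + C₂ + C₃ + C₄) * |t| ^ e * r ^ n := by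
    intro c a e x n h1 h2 h3
    rw [pw_eq hr, h2, Real.rpow_natCast, ← mul_assoc] at h1
    exact h1.trans (by gcongr)
  refine ⟨?_, ?_, ?_, ?_⟩
  · rw [show (ν.re - 2) / 2 = ν.re / 2 - 1 by ring]
    exact key (h₁ t ht' r hr hrt) (by push_cast; ring) (by linarith)
  all_goals rw [show (ν.re - 4) / 2 = ν.re / 2 - 2 by ring]
  · exact key (h₂ t ht' r hr hrt) (by push_cast; ring) (by linarith)
  · exact key (h₃ t ht' r hr hrt) (by push_cast; ring) (by linarith)
  · exact key (h₄ t ht' r hr hrt) (by push_cast; ring) (by linarith)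

theorem absPos_eq_zero {f : ℝ → ℂ} {S : Set ℝ} (hS : IsOpen S) (h : ∀ r ∈ S, f r = 0) (k : ℕ)
    (hr : r ∈ S) : absPos k f r = 0 := by
  have key : ∀ j, ∀ r ∈ S, (rdr^[j]) f r = 0 := by
    intro j
    induction j with
    | zero => exact h
    | succ j ih =>
      intro r hr
      rw [Function.iterate_succ_apply']
      exact rdr_of_const_on hS ih hr
  refine le_antisymm (Finset.sup'_le _ _ fun j _ => by rw [key j r hr, norm_zero]) ?_
  exact (norm_nonneg _).trans (Finset.le_sup' (fun j => ‖(rdr^[j]) f r‖)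
    (Finset.mem_range.2 (Nat.succ_pos k)))

/-- `zoneFar` reaches below |t|^{1/2}, so the closed end point is interior; beyond r = 2 the
radiation vanishes identically. -/
theorem far_bounds (k : ℕ) : ∃ C : ℝ, ∀ t ∈ Icc (-1 : ℝ) 1, t ≠ 0 → ∀ r : ℝ, √|t| ≤ r →
    absPos k (D.z t) r ≤ C * (Icc (√|t|) 2).indicator (fun ρ : ℝ => ρ ^ ν.re
      + |t| ^ (ν.re + 1 - (k : ℝ)) * ρ ^ (-ν.re - 2 + 2 * (k : ℝ))) r := by
  obtain ⟨C, hC, h⟩ := D.far_z k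
  refine ⟨C, fun t ht ht0 r hr => ?_⟩
  have hs := sqrt_pos_of_ne ht0
  rcases le_or_gt r 2 with h2 | h2
  · rw [indicator_of_mem (show r ∈ Icc (√|t|) 2 from ⟨hr, h2⟩)]
    refine (h t r ⟨⟨ht0, abs_le.2 ht⟩, by linarith, by linarith⟩).trans (le_of_eq ?_)
    have hr0 : 0 < r := hs.trans_le hr
    rw [pw_zero_right, pw_eq hr0]
    congr 4
    ring
  · rw [indicator_of_notMem (fun hm => absurd hm.2 (not_le.2 h2)), mul_zero]
    exact (absPos_eq_zero isOpen_Ioi (fun s hs => D.z_eq_zero hs) k h2).le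

end RadData

/-! ### `L²` bounds -/

theorem eLpNorm_le_of_le_mul {α E : Type*} [MeasurableSpace α] [NormedAddCommGroup E] {μ : Measure α}
    {w : α → ℝ} (hw : MemLp w 2 μ) {f : α → E} {T : ℝ} (hT : 0 ≤ T) (h : ∀ᵐ x ∂μ, ‖f x‖ ≤ T * w x) :
    eLpNorm f 2 μ ≤ ENNReal.ofReal (T * (eLpNorm w 2 μ).toReal) := by
  refine (eLpNorm_mono_ae_real (g := T • w) h).trans (le_of_eq ?_)
  rw [eLpNorm_const_smul, ENNReal.ofReal_mul hT, ENNReal.ofReal_toReal hw.eLpNorm_ne_top,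
    Real.enorm_eq_ofReal hT]

/-- The function `r^e` on `(0, 3)`, extended by zero. -/
def cutPow (e r : ℝ) : ℝ := (Iio (3 : ℝ)).indicator (fun r => r ^ e) r

theorem measurable_cutPow (e : ℝ) : Measurable (cutPow e) :=
  (Measurable.pow_const measurable_id e).indicator measurableSet_Iio

theorem cutPow_of_lt {e r : ℝ} (h : r < 3) : cutPow e r = r ^ e := indicator_of_mem (by exact h) _

theorem cutPow_of_ge {e r : ℝ} (h : 3 ≤ r) : cutPow e r = 0 :=
  indicator_of_notMem (by rw [mem_Iio]; exact not_lt.2 h) _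

/-- Squaring and multiplying by r gives the exponent 2e + 1, which exceeds −1 exactly for e > −1. -/
theorem memLp_cutPow_radial {e : ℝ} (he : -1 < e) : MemLp (cutPow e) 2 radialMeasure := by
  rw [memLp_two_iff_integrable_sq (measurable_cutPow e).aestronglyMeasurable, radialMeasure,
    integrable_withDensity_iff_integrable_smul' (by fun_prop) (by simp)]
  have h1 : IntegrableOn (fun r : ℝ => 2 * Real.pi * r ^ (2 * e + 1)) (Ioo 0 3) :=
    ((intervalIntegral.integrableOn_Ioo_rpow_iff (by norm_num)).2 (by linarith)).const_mul _
  have h2 : IntegrableOn ((Iio (3 : ℝ)).indicator fun r : ℝ => 2 * Real.pi * r ^ (2 * e + 1)) (Ioi 0) := by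
    rw [integrableOn_indicator_iff measurableSet_Iio, Iio_inter_Ioi]
    exact h1
  refine (integrableOn_congr_fun (fun r hr => ?_) measurableSet_Ioi).1 h2
  have hr : 0 < r := hr
  simp only [smul_eq_mul]
  rw [ENNReal.toReal_ofReal (by positivity)]
  rcases lt_or_ge r 3 with h | h
  · rw [indicator_of_mem (by exact h), cutPow_of_lt h, Real.rpow_add_one hr.ne', mul_comm 2 e,
      Real.rpow_mul hr.le, Real.rpow_two]
    ring
  · rw [indicator_of_notMem (by rw [mem_Iio]; exact not_lt.2 h), cutPow_of_ge h]
    simp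

theorem integrable_cutPow_norm {e : ℝ} (he : -2 < e) : Integrable (fun x : ℂ => cutPow e ‖x‖) := by
  have h1 : IntegrableOn (fun x : ℂ => cutPow e ‖x‖) (Metric.ball 0 3) := by
    refine integrableOn_ball_of_norm_le_rpow (C := 1) (α := -e) (by simp)
      (by rw [Complex.finrank_real_complex]; push_cast; linarith) ?_
      ((measurable_cutPow e).comp measurable_norm).aestronglyMeasurable
    filter_upwards [ae_restrict_mem measurableSet_ball] with x hx
    rw [mem_ball_zero_iff] at hx
    rw [cutPow_of_lt hx, one_mul, neg_neg, Real.norm_of_nonneg (Real.rpow_nonneg (norm_nonneg _) _)]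
  refine (integrableOn_iff_integrable_of_support_subset fun x hx => ?_).1 h1
  by_contra h
  rw [mem_ball_zero_iff, not_lt] at h
  exact hx (cutPow_of_ge h)

theorem memLp_cutPow_norm {e : ℝ} (he : -1 < e) : MemLp (fun x : ℂ => cutPow e ‖x‖) 2 volume := by
  have hm : AEStronglyMeasurable (fun x : ℂ => cutPow e ‖x‖) volume :=
    ((measurable_cutPow e).comp measurable_norm).aestronglyMeasurable
  rw [memLp_two_iff_integrable_sq hm]
  refine (integrable_cutPow_norm (e := 2 * e) (by linarith)).congr (Eventually.of_forall fun x => ?_)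
  rcases lt_or_ge ‖x‖ 3 with h | h
  · simp only [cutPow_of_lt h]
    rw [mul_comm 2 e, Real.rpow_mul (norm_nonneg x), Real.rpow_two]
  · simp [cutPow_of_ge h]

theorem exists_eLpNorm_radial_le {e : ℝ} (he : -1 < e) : ∃ M : ℝ, 0 ≤ M ∧
    ∀ {E : Type} [NormedAddCommGroup E] (f : ℝ → E) (T : ℝ), 0 ≤ T →
      (∀ r, 0 < r → r < 3 → ‖f r‖ ≤ T * r ^ e) → (∀ r, 3 ≤ r → f r = 0) →
      eLpNorm f 2 radialMeasure ≤ ENNReal.ofReal (T * M) := by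
  refine ⟨_, ENNReal.toReal_nonneg, fun f T hT h h0 =>
    eLpNorm_le_of_le_mul (memLp_cutPow_radial he) hT ?_⟩
  refine (withDensity_absolutelyContinuous _ _).ae_le ?_
  filter_upwards [ae_restrict_mem measurableSet_Ioi] with r hr
  rcases lt_or_ge r 3 with h3 | h3
  · rw [cutPow_of_lt h3]; exact h r hr h3
  · rw [cutPow_of_ge h3, h0 r h3]; simp

/-! ### The norm of equivariant functions -/

/-- Fubini along parallel lines: almost every line misses the origin, and on it the integral of a
derivative is zero when function and derivative are integrable. -/
theorem integral_eq_zero_of_hasDerivAt_lines {e : ℝ × ℝ → ℂ} (he : MeasurePreserving e)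
    (hem : MeasurableEmbedding e) {v : ℂ} (hev : ∀ y x s, e (y, x + s) = e (y, x) + s * v)
    (hne : ∀ y, y ≠ 0 → ∀ x, e (y, x) ≠ 0) {F F' : ℂ → ℂ} (hF : Integrable F) (hF' : Integrable F')
    (hd : ∀ x, x ≠ 0 → HasDerivAt (fun s : ℝ => F (x + s * v)) (F' x) 0) : ∫ x, F' x = 0 := by
  have h1 : Integrable (F ∘ e) := (he.integrable_comp_emb hem).2 hF
  have h2 : Integrable (F' ∘ e) := (he.integrable_comp_emb hem).2 hF'
  rw [← he.integral_comp hem]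
  change ∫ p, (F' ∘ e) p = 0
  rw [Measure.volume_eq_prod] at h1 h2 ⊢
  rw [integral_prod _ h2]
  refine integral_eq_zero_of_ae ?_
  have h0 : ∀ᵐ y : ℝ, y ≠ 0 := by
    rw [ae_iff]; simp
  filter_upwards [h1.prod_right_ae, h2.prod_right_ae, h0] with y hy1 hy2 hy
  refine integral_eq_zero_of_hasDerivAt_of_integrable (fun x => ?_) hy2 hy1
  have h3 := hd (e (y, x)) (hne y hy x)
  have h4 : HasDerivAt (fun x' : ℝ => x' - x) 1 x := (hasDerivAt_id' x).sub_const x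
  have h5 := HasDerivAt.scomp_of_eq x h3 h4 (by simp)
  rw [one_smul] at h5
  refine h5.congr_of_eventuallyEq (Eventually.of_forall fun x' => ?_)
  simp only [Function.comp, ← hev]
  congr 2
  ring_nf

/-- A singular point has no effect on integration by parts in the plane when the gradient is
integrable, since only one line in each coordinate direction meets it. -/
theorem isWeakGradient_of_fderiv {φ : ℂ → ℂ} (hφ : Integrable φ)
    (h1 : Integrable fun x => fderiv ℝ φ x 1) (h2 : Integrable fun x => fderiv ℝ φ x Complex.I)
    (hd : ∀ x, x ≠ 0 → DifferentiableAt ℝ φ x) :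
    IsWeakGradient φ (fun x => fderiv ℝ φ x 1) (fun x => fderiv ℝ φ x Complex.I) := by
  refine ⟨hφ.locallyIntegrable, h1.locallyIntegrable, h2.locallyIntegrable, fun ψ hψ hψc => ?_⟩
  have hψd : Differentiable ℝ ψ := hψ.differentiable (by simp)
  have bdd : ∀ {g : ℂ → ℝ}, Continuous g → HasCompactSupport g → ∀ {f : ℂ → ℂ}, Integrable f →
      Integrable fun x => (g x : ℂ) * f x := by
    intro g hg hgc f hf
    obtain ⟨C, hC⟩ := hgc.exists_bound_of_continuous hg
    refine hf.bdd_mul (c := C) (Complex.continuous_ofReal.comp hg).aestronglyMeasurable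
      (Eventually.of_forall fun x => ?_)
    rw [Complex.norm_real]
    exact hC x
  have key : ∀ (v : ℂ) (e : ℝ × ℝ → ℂ), MeasurePreserving e → MeasurableEmbedding e →
      (∀ y x s, e (y, x + s) = e (y, x) + s * v) → (∀ y, y ≠ 0 → ∀ x, e (y, x) ≠ 0) →
      (Integrable fun x => fderiv ℝ φ x v) →
      (∫ x, ((fderiv ℝ ψ x v : ℝ) : ℂ) * φ x) = -∫ x, (ψ x : ℂ) * fderiv ℝ φ x v := by
    intro v e he hem hev hne hv
    have c1 : Continuous fun x => fderiv ℝ ψ x v :=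
      (hψ.continuous_fderiv (by simp)).clm_apply continuous_const
    have s1 : HasCompactSupport fun x => fderiv ℝ ψ x v := hψc.fderiv_apply ℝ v
    have i1 := bdd c1 s1 hφ
    have i2 := bdd hψ.continuous hψc hv
    have h0 := integral_eq_zero_of_hasDerivAt_lines he hem hev hne (F := fun x => (ψ x : ℂ) * φ x)
      (bdd hψ.continuous hψc hφ) (i1.add i2) fun x hx => ?_
    · rw [integral_add' i1 i2] at h0
      exact eq_neg_of_add_eq_zero_left h0
    · have hl : HasDerivAt (fun s : ℝ => x + s * v) v 0 := by
        have := (((hasDerivAt_id ((0 : ℝ) : ℂ)).comp_ofReal).mul_const v).const_add x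
        exact this.congr_deriv (one_mul v)
      have hx0 : x = x + ((0 : ℝ) : ℂ) * v := by simp
      have d1 : HasDerivAt (fun s : ℝ => ψ (x + s * v)) (fderiv ℝ ψ x v) 0 :=
        HasFDerivAt.comp_hasDerivAt_of_eq 0 (hψd x).hasFDerivAt hl hx0
      have d2 : HasDerivAt (fun s : ℝ => φ (x + s * v)) (fderiv ℝ φ x v) 0 :=
        HasFDerivAt.comp_hasDerivAt_of_eq 0 (hd x hx).hasFDerivAt hl hx0
      refine ((d1.ofReal_comp).mul d2).congr_deriv ?_
      rw [← hx0]
      rfl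
  have e2 := Complex.volume_preserving_equiv_real_prod.symm
  refine ⟨key 1 (fun p => Complex.measurableEquivRealProd.symm p.swap) ?_ ?_ ?_ ?_ h1,
    key Complex.I Complex.measurableEquivRealProd.symm e2
      Complex.measurableEquivRealProd.symm.measurableEmbedding ?_ ?_ h2⟩
  · exact e2.comp (Measure.measurePreserving_swap (μ := (volume : Measure ℝ)) (ν := volume))
  · exact Complex.measurableEquivRealProd.symm.measurableEmbedding.comp
      MeasurableEquiv.prodComm.measurableEmbedding
  · intro y x s
    apply Complex.ext <;> simp
  · intro y hy x h
    exact hy (by simpa using congrArg Complex.im h)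
  · intro y x s
    apply Complex.ext <;> simp
  · intro y hy x h
    exact hy (by simpa using congrArg Complex.re h)

theorem equivariant_eq (u : ℝ → ℂ) (x : ℂ) :
    equivariant (-2) u x = u ‖x‖ * ((‖x‖ : ℂ) * x⁻¹) ^ 2 := by
  rw [equivariant, zpow_neg, ← inv_zpow, inv_div, show ((2 : ℤ)) = ((2 : ℕ) : ℤ) from rfl,
    zpow_natCast, div_eq_mul_inv]

theorem norm_equivariant_le (u : ℝ → ℂ) (x : ℂ) : ‖equivariant (-2) u x‖ ≤ ‖u ‖x‖‖ := by
  rw [equivariant_eq, norm_mul, norm_pow, norm_mul, Complex.norm_real, norm_norm, norm_inv]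
  refine mul_le_of_le_one_right (norm_nonneg _) (pow_le_one₀ (by positivity) ?_)
  exact mul_inv_le_one

/-- The phase factor is the square of |x|/x, a function of modulus one whose derivative in unit
directions is at most 2/|x|; this gives the constant 4. -/
theorem norm_fderiv_equivariant_le {u : ℝ → ℂ} {x : ℂ} (hx : x ≠ 0) (hu : DifferentiableAt ℝ u ‖x‖) :
    DifferentiableAt ℝ (equivariant (-2) u) x ∧ ∀ v : ℂ, ‖v‖ ≤ 1 →
      ‖fderiv ℝ (equivariant (-2) u) x v‖ ≤ ‖deriv u ‖x‖‖ + 4 * (‖u ‖x‖‖ / ‖x‖) := by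
  have hn : 0 < ‖x‖ := norm_pos_iff.2 hx
  have hnd : DifferentiableAt ℝ (fun x : ℂ => ‖x‖) x :=
    (contDiffAt_norm ℝ hx).differentiableAt one_ne_zero
  have hφd : DifferentiableAt ℝ (equivariant (-2) u) x := by
    have h1 : DifferentiableAt ℝ (fun x : ℂ => (‖x‖ : ℂ)) x :=
      Complex.ofRealCLM.differentiableAt.comp x hnd
    have h2 : DifferentiableAt ℝ (fun x : ℂ => u ‖x‖) x := DifferentiableAt.comp x hu hnd
    refine (h2.mul ((h1.mul (differentiableAt_id.inv hx)).pow 2)).congr_of_eventuallyEq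
      (Eventually.of_forall fun x => equivariant_eq u x)
  refine ⟨hφd, fun v hv => ?_⟩
  have hl : HasDerivAt (fun s : ℝ => x + s * v) v 0 := by
    have := (((hasDerivAt_id ((0 : ℝ) : ℂ)).comp_ofReal).mul_const v).const_add x
    exact this.congr_deriv (one_mul v)
  have hx0 : x = x + ((0 : ℝ) : ℂ) * v := by simp
  set n' := fderiv ℝ (fun x : ℂ => ‖x‖) x v
  have hn' : |n'| ≤ 1 := by
    refine ((fderiv ℝ (fun x : ℂ => ‖x‖) x).le_opNorm v).trans ?_
    have h1 : ‖fderiv ℝ (fun x : ℂ => ‖x‖) x‖ ≤ ((1 : NNReal) : ℝ) :=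
      norm_fderiv_le_of_lipschitz ℝ lipschitzWith_one_norm
    exact mul_le_one₀ h1 (norm_nonneg v) hv
  have d1 : HasDerivAt (fun s : ℝ => ‖x + s * v‖) n' 0 :=
    HasFDerivAt.comp_hasDerivAt_of_eq 0 hnd.hasFDerivAt hl hx0
  have d2 : HasDerivAt (fun s : ℝ => u ‖x + s * v‖) (n' • deriv u ‖x‖) 0 :=
    HasDerivAt.scomp_of_eq 0 hu.hasDerivAt d1 (by rw [← hx0])
  have d3 : HasDerivAt (fun s : ℝ => (x + s * v)⁻¹) (-(x ^ 2)⁻¹ * v) 0 := by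
    have h1 : HasDerivAt (fun z : ℂ => z⁻¹) (-(x ^ 2)⁻¹) (x + ((0 : ℝ) : ℂ) * v) := by
      rw [← hx0]; exact hasDerivAt_inv hx
    exact HasDerivAt.comp (h₂ := fun z : ℂ => z⁻¹) (0 : ℝ) h1 hl
  have d4 := d2.mul ((d1.ofReal_comp.mul d3).fun_pow 2)
  have d5 : HasDerivAt (fun s : ℝ => equivariant (-2) u (x + s * v)) _ 0 :=
    d4.congr_of_eventuallyEq (Eventually.of_forall fun s => equivariant_eq u _)
  have d6 : HasDerivAt (fun s : ℝ => equivariant (-2) u (x + s * v))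
      (fderiv ℝ (equivariant (-2) u) x v) 0 :=
    HasFDerivAt.comp_hasDerivAt_of_eq 0 hφd.hasFDerivAt hl hx0
  rw [d6.unique d5]
  simp only [Pi.mul_apply, ← hx0, Complex.real_smul]
  have hw : ‖(‖x‖ : ℂ) * x⁻¹‖ = 1 := by
    rw [norm_mul, Complex.norm_real, norm_norm, norm_inv, mul_inv_cancel₀ hn.ne']
  have hw' : ‖(n' : ℂ) * x⁻¹ + (‖x‖ : ℂ) * (-(x ^ 2)⁻¹ * v)‖ ≤ 2 / ‖x‖ := by
    refine (norm_add_le _ _).trans ?_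
    rw [norm_mul, norm_mul, norm_mul, norm_neg, norm_inv, norm_inv, norm_pow, Complex.norm_real,
      Complex.norm_real, norm_norm, Real.norm_eq_abs]
    have e1 : |n'| * ‖x‖⁻¹ ≤ 1 * ‖x‖⁻¹ := by gcongr
    have e2 : ‖x‖ * ((‖x‖ ^ 2)⁻¹ * ‖v‖) ≤ ‖x‖ * ((‖x‖ ^ 2)⁻¹ * 1) := by gcongr
    have e3 : ‖x‖ * ((‖x‖ ^ 2)⁻¹ * 1) = 1 * ‖x‖⁻¹ := by field_simp
    have e4 : 2 / ‖x‖ = 1 * ‖x‖⁻¹ + 1 * ‖x‖⁻¹ := by field_simp; norm_num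
    linarith
  refine (norm_add_le _ _).trans (add_le_add ?_ ?_)
  · rw [norm_mul, norm_pow, hw, one_pow, mul_one, norm_mul, Complex.norm_real, Real.norm_eq_abs]
    exact mul_le_of_le_one_left (norm_nonneg _) hn'
  · rw [norm_mul, norm_mul, norm_mul, norm_pow, hw, one_pow, mul_one]
    calc ‖u ‖x‖‖ * (‖((2 : ℕ) : ℂ)‖ * ‖(n' : ℂ) * x⁻¹ + (‖x‖ : ℂ) * (-(x ^ 2)⁻¹ * v)‖)
        ≤ ‖u ‖x‖‖ * (2 * (2 / ‖x‖)) := by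
          refine mul_le_mul_of_nonneg_left ?_ (norm_nonneg _)
          rw [Complex.norm_natCast]
          exact mul_le_mul_of_nonneg_left hw' (by norm_num)
      _ = _ := by ring

/-- The bounds give |∇φ| ≲ B r^{c−1}, which is square integrable on bounded sets of the plane
because c > 0. -/
theorem exists_normH11_le {c : ℝ} (hc : 0 < c) : ∃ C : ℝ, 0 ≤ C ∧ ∀ (u : ℝ → ℂ) (B : ℝ), 0 ≤ B →
    ContDiffOn ℝ ∞ u (Ioi 0) → (∀ r ∈ Ioo (0 : ℝ) 3, ‖u r‖ ≤ B * r ^ c ∧ ‖rdr u r‖ ≤ B * r ^ c) →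
    (∀ r, 2 < r → u r = 0) → normH11 (equivariant (-2) u) ≤ ENNReal.ofReal (C * B) := by
  set M := (eLpNorm (fun x : ℂ => cutPow (c - 1) ‖x‖) 2 volume).toReal with hM
  have hM0 : 0 ≤ M := ENNReal.toReal_nonneg
  -- 22 = 3 + 5 + 5 + 9, for φ, its two partial derivatives and |x|φ; the factors 3 and 9 come from
  -- |x| < 3.
  refine ⟨22 * M, by positivity, fun u B hB hu hb h0 => ?_⟩
  set φ := equivariant (-2) u with hφdef
  have hud : ∀ r, 0 < r → DifferentiableAt ℝ u r := fun r hr => diff_of_contDiffOn isOpen_Ioi hu hr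
  have hφd : ∀ x, x ≠ 0 → DifferentiableAt ℝ φ x := fun x hx =>
    (norm_fderiv_equivariant_le hx (hud _ (norm_pos_iff.2 hx))).1
  have hpow : ∀ r : ℝ, 0 < r → r ^ c = r * r ^ (c - 1) := fun r hr => by
    rw [Real.rpow_sub_one hr.ne']; field_simp
  have b0 : ∀ x : ℂ, x ≠ 0 → ‖φ x‖ ≤ 3 * B * cutPow (c - 1) ‖x‖ ∧ ‖(‖x‖ : ℂ) * φ x‖ ≤ 9 * B * cutPow (c - 1) ‖x‖ := by
    intro x hx
    have hn := norm_pos_iff.2 hx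
    rw [norm_mul, Complex.norm_real, norm_norm]
    have h1 := norm_equivariant_le u x
    rcases lt_or_ge ‖x‖ 3 with h3 | h3
    · have h2 : ‖φ x‖ ≤ B * (‖x‖ * ‖x‖ ^ (c - 1)) := by
        rw [← hpow _ hn]; exact h1.trans (hb _ ⟨hn, h3⟩).1
      have h4 : 0 ≤ ‖x‖ ^ (c - 1) := by positivity
      have h5 : ‖φ x‖ ≤ 3 * B * ‖x‖ ^ (c - 1) := by
        refine h2.trans ?_
        have := mul_le_mul_of_nonneg_right h3.le (mul_nonneg hB h4)
        linarith
      rw [cutPow_of_lt h3]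
      refine ⟨h5, ?_⟩
      calc ‖x‖ * ‖φ x‖ ≤ 3 * (3 * B * ‖x‖ ^ (c - 1)) :=
            mul_le_mul h3.le h5 (norm_nonneg _) (by norm_num)
        _ = _ := by ring
    · rw [h0 _ (by linarith), norm_zero] at h1
      rw [cutPow_of_ge h3, le_antisymm h1 (norm_nonneg _)]
      simp
  have b1 : ∀ v : ℂ, ‖v‖ ≤ 1 → ∀ x : ℂ, x ≠ 0 → ‖fderiv ℝ φ x v‖ ≤ 5 * B * cutPow (c - 1) ‖x‖ := by
    intro v hv x hx
    have hn := norm_pos_iff.2 hx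
    refine ((norm_fderiv_equivariant_le hx (hud _ hn)).2 v hv).trans ?_
    rcases lt_or_ge ‖x‖ 3 with h3 | h3
    · obtain ⟨h1, h2⟩ := hb _ ⟨hn, h3⟩
      rw [hpow _ hn] at h1 h2
      rw [rdr, norm_mul, Complex.norm_real, norm_norm] at h2
      have h4 : ‖deriv u ‖x‖‖ ≤ B * ‖x‖ ^ (c - 1) := by
        refine le_of_mul_le_mul_left ?_ hn
        linarith
      have h5 : ‖u ‖x‖‖ / ‖x‖ ≤ B * ‖x‖ ^ (c - 1) := by
        rw [div_le_iff₀ hn]; linarith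
      rw [cutPow_of_lt h3]
      linarith
    · have hz : rdr u ‖x‖ = 0 := rdr_of_const_on isOpen_Ioi (fun s hs => h0 s hs)
        (show ‖x‖ ∈ Ioi 2 by simp only [mem_Ioi]; linarith)
      have hz' : deriv u ‖x‖ = 0 := by
        rw [deriv_eq_rdr hn, hz, mul_zero]
      rw [hz', h0 _ (by linarith), cutPow_of_ge h3]
      simp
  have hne : ∀ᵐ x : ℂ, x ≠ 0 := by rw [ae_iff]; simp
  have hW : Integrable (fun x : ℂ => cutPow (c - 1) ‖x‖) := integrable_cutPow_norm (by linarith)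
  have hφm : AEStronglyMeasurable φ := by
    have h1 : ContinuousOn φ {0}ᶜ := fun x hx => (hφd x hx).continuousAt.continuousWithinAt
    have h2 := h1.aestronglyMeasurable (μ := volume) (measurableSet_singleton (0 : ℂ)).compl
    rwa [restrict_compl_singleton] at h2
  have iφ : Integrable φ := (hW.const_mul (3 * B)).mono' hφm (by
    filter_upwards [hne] with x hx using (b0 x hx).1)
  have ig : ∀ v : ℂ, ‖v‖ ≤ 1 → Integrable fun x => fderiv ℝ φ x v := fun v hv =>
    (hW.const_mul (5 * B)).mono' (measurable_fderiv_apply_const ℝ φ v).aestronglyMeasurable (by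
      filter_upwards [hne] with x hx using b1 v hv x hx)
  have hw2 : MemLp (fun x : ℂ => cutPow (c - 1) ‖x‖) 2 volume := memLp_cutPow_norm (by linarith)
  have n1 : eLpNorm φ 2 volume ≤ ENNReal.ofReal (3 * B * M) :=
    eLpNorm_le_of_le_mul hw2 (by positivity) (by filter_upwards [hne] with x hx using (b0 x hx).1)
  have n2 : ∀ v : ℂ, ‖v‖ ≤ 1 → eLpNorm (fun x => fderiv ℝ φ x v) 2 volume ≤ ENNReal.ofReal (5 * B * M) :=
    fun v hv => eLpNorm_le_of_le_mul hw2 (by positivity)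
      (by filter_upwards [hne] with x hx using b1 v hv x hx)
  have n3 : eLpNorm (fun x : ℂ => (‖x‖ : ℂ) * φ x) 2 volume ≤ ENNReal.ofReal (9 * B * M) :=
    eLpNorm_le_of_le_mul hw2 (by positivity) (by filter_upwards [hne] with x hx using (b0 x hx).2)
  have hgrad := isWeakGradient_of_fderiv iφ (ig 1 (by simp)) (ig Complex.I (by simp)) hφd
  refine (iInf₂_le _ _).trans ((iInf_le _ hgrad).trans ?_)
  refine (add_le_add (add_le_add (add_le_add n1 (n2 1 (by simp))) (n2 Complex.I (by simp))) n3).trans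
    (le_of_eq ?_)
  rw [← ENNReal.ofReal_add (by positivity) (by positivity),
    ← ENNReal.ofReal_add (by positivity) (by positivity),
    ← ENNReal.ofReal_add (by positivity) (by positivity)]
  congr 1; ring

/-! ### Norms of the error and convergence to the initial profile -/

namespace RadData

variable {χ : ℝ → ℝ} {q ν : ℂ} {N : ℕ} (D : RadData χ q ν N) {κ δ : ℝ} {k : ℕ} {t r : ℝ}

/-- Once the power of |t| is taken out of the pointwise bound, r^{-1+2δ} is left, which is square
integrable for r dr on bounded intervals. -/
theorem eLpNorm_Psi_le (ho : ExpansionOrder N κ) (hκ : κ < ν.re) (hδ0 : 0 < δ) (hδ : δ ≤ 1 / 4)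
    (hδκ : (ν.re - 1) / 2 + δ ≤ κ) : ∃ C : ℝ, ∀ t ∈ Icc (-1 : ℝ) 1, t ≠ 0 →
      eLpNorm (D.Psi t) 2 radialMeasure ≤ ENNReal.ofReal (C * |t| ^ ((ν.re - 1) / 2 + δ)) := by
  obtain ⟨C, hC, h⟩ := D.Psi_bound ho hκ hδ hδκ
  obtain ⟨M, hM, hM'⟩ := exists_eLpNorm_radial_le (e := -1 + 2 * δ) (by linarith)
  refine ⟨C * M, fun t ht ht0 => ?_⟩
  refine (hM' (D.Psi t) (C * |t| ^ ((ν.re - 1) / 2 + δ)) (by positivity) (fun r hr hr3 => ?_)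
    fun r hr => D.Psi_eq_zero ht0 (by linarith)).trans (le_of_eq (by ring_nf))
  refine (h t r ⟨⟨ht0, abs_le.2 ht⟩, hr, hr3⟩).trans (le_of_eq ?_)
  rw [pw_eq hr, ← mul_assoc]
  congr 2; ring

theorem eLpNorm_absNeg_Psi_le (ho : ExpansionOrder N κ) (hκ : κ < ν.re) (hδ0 : 0 < δ) (hδ : δ ≤ 1 / 4)
    (hδκ : (ν.re - 1) / 2 + δ ≤ κ) (hδν : δ ≤ ν.re / 2) :
    ∃ C : ℝ, ∀ t ∈ Icc (-1 : ℝ) 1, t ≠ 0 → ∀ s ∈ Icc (0 : ℝ) δ,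
      eLpNorm (fun r => r ^ (-s) * absNeg 1 (D.Psi t) r) 2 radialMeasure
        ≤ ENNReal.ofReal (C * |t| ^ ((ν.re - 2) / 2 + δ)) := by
  have hS := D.Psi_deriv_bound ho hκ hδ hδκ hδν
  obtain ⟨C₁, hC₁, h₁⟩ := hS.bdd
  obtain ⟨C₂, hC₂, h₂⟩ := hS.rdr.bdd
  obtain ⟨M, hM, hM'⟩ := exists_eLpNorm_radial_le (e := -1 + δ) (by linarith)
  refine ⟨3 ^ δ * (C₁ + C₂) * M, fun t ht ht0 s hs => ?_⟩
  have htp := abs_pos.2 ht0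
  have hsup : ∀ r (B : ℝ), ‖deriv (D.Psi t) r‖ ≤ B → ‖D.Psi t r‖ / r ≤ B → absNeg 1 (D.Psi t) r ≤ B := by
    intro r B h1 h2
    refine Finset.sup'_le _ _ fun j hj => ?_
    have hj : j = 0 ∨ j = 1 := by have := Finset.mem_range.1 hj; omega
    rcases hj with rfl | rfl
    · simpa [iteratedDeriv_one] using h1
    · simpa [iteratedDeriv_zero] using h2
  have hnn : ∀ r, 0 ≤ absNeg 1 (D.Psi t) r := fun r => by
    refine le_trans ?_ (Finset.le_sup' (fun j => ‖iteratedDeriv (1 - j) (D.Psi t) r‖ / r ^ j)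
      (Finset.mem_range.2 (Nat.succ_pos 1)))
    simp
  refine (hM' _ (3 ^ δ * (C₁ + C₂) * |t| ^ ((ν.re - 2) / 2 + δ)) (by positivity) (fun r hr hr3 => ?_)
    fun r hr => ?_).trans (le_of_eq (by ring_nf))
  · have m : zoneAll.mem t r := ⟨⟨ht0, abs_le.2 ht⟩, hr, hr3⟩
    have hw : pw (ν.re - 2 + 4 * δ) ((ν.re - 2) / 2 + δ) t r =
        |t| ^ ((ν.re - 2) / 2 + δ) * r ^ (-1 + 2 * δ) * r := by
      rw [pw_eq hr, mul_assoc, ← Real.rpow_add_one hr.ne']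
      congr 2; ring
    have e1 := h₁ t r m
    have e2 := h₂ t r m
    rw [hw] at e1 e2
    set T := |t| ^ ((ν.re - 2) / 2 + δ) with hT
    have hT0 : 0 < T := by positivity
    have hp : 0 < r ^ (-1 + 2 * δ) := by positivity
    have b : absNeg 1 (D.Psi t) r ≤ (C₁ + C₂) * (T * r ^ (-1 + 2 * δ)) := by
      refine hsup r _ ?_ ?_
      · rw [deriv_eq_rdr hr, norm_mul, norm_inv, Complex.norm_real, Real.norm_of_nonneg hr.le,
          inv_mul_le_iff₀ hr]
        nlinarith [mul_nonneg hC₁ (mul_pos (mul_pos hT0 hp) hr).le]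
      · rw [div_le_iff₀ hr]
        nlinarith [mul_nonneg hC₂ (mul_pos (mul_pos hT0 hp) hr).le]
    -- The worst case s = δ covers all s at once; half of the margin 2δ in the power of r is spent
    -- on it.
    have hrs : r ^ (-s) ≤ 3 ^ δ * r ^ (-δ) := by
      refine (rpow_le_of_le_three hr hr3.le (neg_le_neg hs.2)).trans ?_
      gcongr
      · norm_num
      · linarith [hs.1]
    rw [norm_mul, Real.norm_of_nonneg (by positivity), Real.norm_of_nonneg (hnn r)]
    calc r ^ (-s) * absNeg 1 (D.Psi t) r
        ≤ 3 ^ δ * r ^ (-δ) * ((C₁ + C₂) * (T * r ^ (-1 + 2 * δ))) :=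
          mul_le_mul hrs b (hnn r) (by positivity)
      _ = 3 ^ δ * (C₁ + C₂) * T * (r ^ (-δ) * r ^ (-1 + 2 * δ)) := by ring
      _ = _ := by rw [← Real.rpow_add hr]; congr 2; ring
  · have h0 : D.Psi t r = 0 := D.Psi_eq_zero ht0 (by linarith)
    have h1 : deriv (D.Psi t) r = 0 := by
      rw [deriv_eq_rdr (by linarith), rdr_of_const_on isOpen_Ioi
        (fun s hs => D.Psi_eq_zero ht0 hs) (show r ∈ Ioi 2 by simp only [mem_Ioi]; linarith), mul_zero]
    rw [le_antisymm (hsup r 0 (by rw [h1, norm_zero]) (by rw [h0]; simp)) (hnn r), mul_zero]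

theorem coe_profile (D : RadData χ q ν N) : Coe ν.re (profile χ q ν) :=
  ((((Coe.cpow ν).const_mul q).mul D.coe_χ)).mono (by linarith)

/-- The weight equals |t|^b r^c. In the self-similar zone z and the profile are bounded separately;
outside, the one-term expansion of the linear solution is used, whose term is the profile up to χ.
-/
theorem sym_z_sub_profile {b c : ℝ} (hb0 : 0 ≤ b) (hb : b ≤ 1) (hc : c ≤ 2) (hbc : c + 2 * b ≤ ν.re)
    (hbν : b ≤ ν.re) :
    Sym zoneAll (pw (c + 2 * b) b) 1 (fun t r => D.z t r - profile χ q ν r) := by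
  have hν := D.re_pos
  refine Sym.all_of_near_far (fun _ _ m => (pw_pos m.1.1 m.2.1).le) ?_ ?_
  · refine (((D.sym_near_z 1).near_scale 1 hbc).near_mono (by linarith)).sub ?_
    have h1 := (D.coe_profile.near (k := 1)).near_mono hb0
    refine h1.mono zero_le_one fun t r m => ?_
    have hr := zoneNear.pos m
    rw [one_mul, pw_eq hr, pw_eq hr]
    refine mul_le_mul_of_nonneg_left ?_ (by positivity)
    exact Real.rpow_le_rpow_of_exponent_ge hr (zoneNear_le_one m).le (by linarith)
  · have h1 := (D.coe_χ.far.far_mul (D.far_lin_sub (κ := b) (k := 1) 1 (by exact_mod_cast hb)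
      (by push_cast; linarith))).far_mono (b := c + 2 * b) (l := b) (by linarith) (by linarith)
    have h2 : Sym zoneFar (pw (c + 2 * b) b) 1 D.V := by
      refine Sym.sum _ fun j hj => ?_
      -- Since W_0 = 0, every term of V carries at least one power of t.
      rcases Nat.eq_zero_or_pos j with rfl | hj0
      · exact Sym.zero.congr fun t r m => by rw [D.W_zero]; simp
      · refine (D.W_coe j (Nat.lt_succ_iff.1 (Finset.mem_range.1 hj))).far_time_pow.far_mono
          (by linarith) (hb.trans (by exact_mod_cast hj0))
    have h3 := (D.far_eta.far_mul h2).far_mono (b := c + 2 * b) (l := b) (by linarith) (by linarith)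
    refine (h1.add h3).congr fun t r m => ?_
    rw [D.z_of_ne m.1.1, profile, Finset.sum_range_one, g, D.c_zero]
    simp only [Nat.cast_zero, mul_zero, sub_zero, pow_zero]
    ring

theorem tendsto_normH11 : Tendsto (fun t : ℝ =>
    normH11 (equivariant (-2) (fun r => D.z t r - profile χ q ν r))) (𝓝[≠] 0) (𝓝 0) := by
  have hν := D.re_pos
  -- The choice ensures c + 2b ≤ Re ν; b > 0 gives convergence in time, c > 0 a finite norm.
  set b := min 1 (ν.re / 4) with hb
  set c := min 1 (ν.re / 2) with hc
  have hb0 : 0 < b := lt_min one_pos (by linarith)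
  have hc0 : 0 < c := lt_min one_pos (by linarith)
  have hb1 : b ≤ 1 := min_le_left _ _
  have hb2 : b ≤ ν.re / 4 := min_le_right _ _
  have hc1 : c ≤ 1 := min_le_left _ _
  have hc2 : c ≤ ν.re / 2 := min_le_right _ _
  have hS := D.sym_z_sub_profile hb0.le hb1 (c := c) (by linarith) (by linarith) (by linarith)
  obtain ⟨C₁, hC₁, h₁⟩ := hS.bdd
  obtain ⟨C₂, hC₂, h₂⟩ := hS.rdr.bdd
  obtain ⟨C, hC, h⟩ := exists_normH11_le hc0
  have hlim : Tendsto (fun t : ℝ => ENNReal.ofReal (C * ((C₁ + C₂) * |t| ^ b))) (𝓝[≠] 0) (𝓝 0) := by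
    have h1 : ContinuousAt (fun t : ℝ => C * ((C₁ + C₂) * |t| ^ b)) 0 :=
      ((continuous_abs.continuousAt.rpow_const (Or.inr hb0.le)).const_mul _).const_mul _
    have h2 := ENNReal.tendsto_ofReal (h1.tendsto.mono_left (nhdsWithin_le_nhds (s := {0}ᶜ)))
    simpa [Real.zero_rpow hb0.ne'] using h2
  refine tendsto_of_tendsto_of_tendsto_of_le_of_le' tendsto_const_nhds hlim
    (Eventually.of_forall fun _ => bot_le) ?_
  filter_upwards [self_mem_nhdsWithin, nhdsWithin_le_nhds (Icc_mem_nhds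
    (show (-1 : ℝ) < 0 by norm_num) (show (0 : ℝ) < 1 by norm_num))] with t ht0 ht
  have ht0 : t ≠ 0 := ht0
  have htp := abs_pos.2 ht0
  have hz : ∀ r, 2 < r → D.z t r - profile χ q ν r = 0 := fun r hr => by
    rw [D.z_eq_zero hr, profile, D.cutoff.eq_zero hr, mul_zero, sub_zero]
  refine h _ _ (by positivity) (contDiffOn_Ioi ((D.contDiffOn_z' ht0).sub
    D.coe_profile.contDiffOn) hz) (fun r hr => ?_) hz
  have m : zoneAll.mem t r := ⟨⟨ht0, abs_le.2 ht⟩, hr⟩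
  have hrp := hr.1
  have hw : pw (c + 2 * b) b t r = |t| ^ b * r ^ c := by
    rw [pw_eq hr.1]; congr 2; ring
  have e1 := h₁ t r m
  have e2 := h₂ t r m
  rw [hw] at e1 e2
  have hp : 0 < |t| ^ b * r ^ c := by positivity
  rw [mul_assoc]
  constructor
  · nlinarith [mul_nonneg hC₂ hp.le]
  · nlinarith [mul_nonneg hC₁ hp.le]

end RadData

/-- The target exponent (x−1)/2 + δ must lie below both N and x, while N − 1 must not exceed κ.
Taking N = ⌊(x+1)/2⌋ leaves a strict gap N − (x−1)/2 > 0 for δ, and κ is the target exponent unless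
that is negative. -/
theorem exists_expansionOrder {x : ℝ} (hx : 0 < x) : ∃ (N : ℕ) (κ δ : ℝ), ExpansionOrder N κ ∧
    (N : ℝ) < x + 1 ∧ κ < x ∧ 0 < δ ∧ δ ≤ 1 / 4 ∧ (x - 1) / 2 + δ ≤ κ ∧ δ ≤ x / 2 := by
  set N := ⌊(x + 1) / 2⌋₊
  have h1 : (N : ℝ) ≤ (x + 1) / 2 := Nat.floor_le (by positivity)
  have h2 : (x + 1) / 2 < N + 1 := Nat.lt_floor_add_one _
  set δ := min (1 / 4) (min (x / 2) (N - (x - 1) / 2))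
  have d1 : δ ≤ 1 / 4 := min_le_left _ _
  have d2 : δ ≤ x / 2 := (min_le_right _ _).trans (min_le_left _ _)
  have d3 : δ ≤ N - (x - 1) / 2 := (min_le_right _ _).trans (min_le_right _ _)
  have d0 : 0 < δ := lt_min (by norm_num) (lt_min (by linarith) (by linarith))
  refine ⟨N, max 0 ((x - 1) / 2 + δ), δ, ⟨le_max_left _ _, max_le (Nat.cast_nonneg N) (by linarith),
    le_max_of_le_right (by linarith)⟩, by linarith, max_lt hx (by linarith), d0, d1,
    le_max_right _ _, d2⟩

end CSS

end

theorem proposition3p1 (χ : ℝ → ℝ) (hχ : CSS.IsCutoff χ) (q ν : ℂ) (hν : 0 < ν.re) (hq : q ≠ 0) :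
    ∃ δ : ℝ, 0 < δ ∧ ∃ z Ψ : ℝ → ℝ → ℂ,
      -- the equation with error `Ψ` on the time interval `[-1, 1]`
      (∀ t ∈ Icc (-1 : ℝ) 1, t ≠ 0 → ∀ r : ℝ, 0 < r →
        ∃ zt : ℂ, HasDerivWithinAt (fun s => z s r) zt (Icc (-1 : ℝ) 1) t ∧
          Complex.I * zt + CSS.spatialPart (-2) (z t) r = Ψ t r) ∧
      -- initial data
      (∀ r : ℝ, 0 < r → z 0 r = CSS.profile χ q ν r) ∧
      Tendsto (fun t : ℝ => CSS.normH11
          (CSS.equivariant (-2) (fun r => z t r - CSS.profile χ q ν r))) (𝓝[≠] 0) (𝓝 0) ∧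
      -- smoothness of the radiation (and `C¹` regularity of the error)
      (∀ t ∈ Icc (-1 : ℝ) 1, t ≠ 0 → ContDiff ℝ ∞ (CSS.equivariant (-2) (z t))) ∧
      (∀ t ∈ Icc (-1 : ℝ) 1, t ≠ 0 → ContDiffOn ℝ 1 (Ψ t) (Ioi 0)) ∧
      -- pointwise bounds in the self-similar zone
      (∀ k : ℕ, ∃ C : ℝ, ∀ t ∈ Icc (-1 : ℝ) 1, t ≠ 0 → ∀ r : ℝ, 0 < r → r ≤ √|t| →
        CSS.absPos k (z t) r ≤ C * |t| ^ ((ν.re - 2) / 2) * r ^ 2 ∧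
        CSS.absPos k (fun ρ => z t ρ - CSS.leadCoeff q ν t * (ρ : ℂ) ^ 2) r
          ≤ C * |t| ^ ((ν.re - 4) / 2) * r ^ 4 ∧
        CSS.absPos k (fun ρ => CSS.covCR (-2) (z t) (z t) ρ
            - 4 * CSS.leadCoeff q ν t * (ρ : ℂ)) r
          ≤ C * |t| ^ ((ν.re - 4) / 2) * r ^ 3 ∧
        CSS.absPos k (CSS.dMinus (-2) (z t)) r ≤ C * |t| ^ ((ν.re - 4) / 2) * r ^ 3) ∧
      -- pointwise bounds outside the self-similar zone
      (∀ k : ℕ, ∃ C : ℝ, ∀ t ∈ Icc (-1 : ℝ) 1, t ≠ 0 → ∀ r : ℝ, √|t| ≤ r →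
        CSS.absPos k (z t) r ≤ C * (Icc (√|t|) 2).indicator
          (fun ρ : ℝ => ρ ^ ν.re
            + |t| ^ (ν.re + 1 - (k : ℝ)) * ρ ^ (-ν.re - 2 + 2 * (k : ℝ))) r) ∧
      -- estimates for the error
      (∃ C : ℝ, ∀ t ∈ Icc (-1 : ℝ) 1, t ≠ 0 →
        eLpNorm (Ψ t) 2 CSS.radialMeasure
          ≤ ENNReal.ofReal (C * |t| ^ ((ν.re - 1) / 2 + δ))) ∧
      (∃ C : ℝ, ∀ t ∈ Icc (-1 : ℝ) 1, t ≠ 0 → ∀ s ∈ Icc (0 : ℝ) δ,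
        eLpNorm (fun r => r ^ (-s) * CSS.absNeg 1 (Ψ t) r) 2 CSS.radialMeasure
          ≤ ENNReal.ofReal (C * |t| ^ ((ν.re - 2) / 2 + δ))) := by
  obtain ⟨N, κ, δ, ho, hN, hκ, hδ0, hδ, hδκ, hδν⟩ := CSS.exists_expansionOrder hν
  obtain ⟨D⟩ := CSS.nonempty_radData hχ q hν hN
  refine ⟨δ, hδ0, D.z, D.Psi, fun t _ ht0 r hr => ⟨D.zt t r, (D.hasDerivAt_z ht0 hr).hasDerivWithinAt,
    rfl⟩, fun r _ => by rw [CSS.RadData.z, if_pos rfl], D.tendsto_normH11,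
    fun t ht ht0 => D.contDiff_equivariant_z ⟨ht0, abs_le.2 ht⟩,
    fun t ht ht0 => (D.contDiffOn_Psi ho hκ.le ⟨ht0, abs_le.2 ht⟩).of_le (by simp),
    D.near_bounds ho hκ.le, D.far_bounds, D.eLpNorm_Psi_le ho hκ hδ0 hδ hδκ,
    D.eLpNorm_absNeg_Psi_le ho hκ hδ0 hδ hδκ hδν⟩
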